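/- Fix $\theta\in(0,1)$ and constants $C_1\ge 155$, $C_2=C_1^3$, $C'>4$. Let $n=3^L$, $L\to\infty$, let $V=\{0,\dots,n-1\}$, let $q=q(n)\in[0,1]$ with $q=\Theta(n^{-3(1-\theta)})$, and let $E$ be the hyperedge set of the random 3-uniform hypergraph $H\sim\mathrm{ER}(n,q)$ on $V$: every set of three vertices is a hyperedge independently with probability $q$. Put $\overline m=q\binom n3$, the expected number of hyperedges. *Tests.* For each level $\ell=\ell_{\min},\dots,L$, with $\ell_{\min}=\lceil\log_3\overline m^{1/3}\rceil$, split $V$ into the $3^\ell$ consecutive blocks of $n/3^\ell$ vertices. For $\ell<L$ make $\lceil C_2\overline m^{2/3}\rceil$ iterations, and for $\ell=L$ make $\lceil C'\log n\rceil\cdot\lceil C_2\overline m^{2/3}\rceil$ iterations. In each iteration every block is assigned, independently (also of $H$) and uniformly, to one of $\lceil C_1\overline m^{1/3}\rceil$ tests. A test queries the union of the blocks assigned to it; it is negative if this union contains no hyperedge, and positive otherwise. *Decoder.* Let $\mathcal{PD}^{(\ell_{\min})}$ be the set of all triples of distinct blocks of level $\ell_{\min}$. For $\ell=\ell_{\min},\dots,L-1$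 and each triple in $\mathcal{PD}^{(\ell)}$ that is not contained in a negative test of level $\ell$, put into $\mathcal{PD}^{(\ell+1)}$ (without repetition) all the $\binom93$ triples of distinct blocks of level $\ell+1$ contained in the three blocks of the triple. Let $\widehat E$ be the set of the triples of $\mathcal{PD}^{(L)}$ (triples of single vertices) that are not contained in a negative test of level $L$. The decoding time is the number of elementary operations of this procedure on a unit-cost word RAM, where an arithmetic operation or comparison of words, a memory access and the retrieval of a block assignment or of a test outcome cost one operation each; a bit table in memory is used to avoid repetitions. Then the total number of tests is $\mathcal O(\overline m\log n)$, and there is a constant $K$ such that, with probability $1-o(1)$ as $n\to\infty$, both $\widehat E=E$ and the decoding time is at most (a) $K\,\overline m^{5/3}\log n$, if $\theta>2/3$; (b) $K\,\overline m^{5/3}\log^2\overline m\,\log n$, if $\theta\le 2/3$. -/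

import Mathlib

open Filter Asymptotics MeasureTheory ProbabilityTheory
open scoped Topology

namespace HyperLearn

/-! ### Computations on a unit-cost word RAM, with a step counter -/

/-- A computation returning `val` after executing `steps` elementary word-RAM operations. -/
structure Timed (α : Type) where
  val : α
  steps : ℕ

namespace Timed

instance : Monad Timed where
  pure a := ⟨a, 0⟩
  bind x f := ⟨(f x.val).val, x.steps + (f x.val).steps⟩

/-- One elementary operation: one arithmetic operation on words, one comparison (with the branch it
controls), one read or write of a memory cell, or one retrieval of a test outcome. -/
def op {α : Type} (a : α) : Timed α := ⟨a, 1⟩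

/-- A value built with `k` elementary operations. -/
def ops {α : Type} (k : ℕ) (a : α) : Timed α := ⟨a, k⟩

/-- `for i = 0, …, m - 1 do s := body i s`.  Each iteration pays two operations (updating the
counter and comparing it with its bound) besides the cost of the body; leaving the loop pays one. -/
def forLoop {σ : Type} (body : ℕ → σ → Timed σ) : ℕ → σ → Timed σ
  | 0, s => op s
  | m + 1, s => do
    let s₁ ← forLoop body m s
    let s₂ ← ops 2 s₁
    body m s₂

/-- `for a in l do s := body a s`, for a list stored in memory as triples of words.  Each iteration
pays five operations (comparing and advancing the pointer, reading three words) besides the cost of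
the body; leaving the loop pays one. -/
def forEach {σ : Type} (body : ℕ × ℕ × ℕ → σ → Timed σ) : List (ℕ × ℕ × ℕ) → σ → Timed σ
  | [], s => op s
  | a :: l, s => do
    let t ← ops 5 a
    let s₁ ← body t s
    forEach body l s₁

end Timed

open Timed

/-! ### The testing scheme -/

/-- The integer parameters of the scheme on the vertex set `{0, …, 3 ^ L - 1}`: the coarsest level,
the number of tests per iteration, the number of iterations per level, and the number of rounds
(of `iters` iterations each) at the finest level `L`. -/
structure Scheme where
  L : ℕ
  lMin : ℕ
  width : ℕ
  iters : ℕ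
  rounds : ℕ

namespace Scheme

/-- The number of vertices. -/
abbrev n (S : Scheme) : ℕ := 3 ^ S.L

/-- The number of iterations run at level `ℓ`; only the levels `lMin, …, L` are tested. -/
def reps (S : Scheme) (ℓ : ℕ) : ℕ :=
  if ℓ < S.lMin then 0 else if ℓ = S.L then S.rounds * S.iters else S.iters

/-- The total number of tests. -/
def numTests (S : Scheme) : ℕ := ∑ ℓ ∈ Finset.range (S.L + 1), S.reps ℓ * S.width

/-- A realisation of the test design: for every level `ℓ`, every iteration `r` at this level and
every block `j` of level `ℓ`, the test among the `width` tests of that iteration to which the block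
is assigned. -/
abbrev Design (S : Scheme) : Type :=
  (Σ ℓ : Fin (S.L + 1), Fin (S.reps ℓ) × Fin (3 ^ (ℓ : ℕ))) → Fin S.width

/-- Reading the design at level `ℓ`, iteration `r`, block `j` (with value `0` outside the table). -/
def assign {S : Scheme} (h : S.Design) (ℓ r j : ℕ) : ℕ :=
  if hℓ : ℓ < S.L + 1 then
    if hr : r < S.reps ℓ then
      if hj : j < 3 ^ ℓ then (h ⟨⟨ℓ, hℓ⟩, ⟨r, hr⟩, ⟨j, hj⟩⟩ : ℕ) else 0
    else 0
  else 0

/-- The block of level `ℓ` containing vertex `v`: block `j` is the set of the `n / 3 ^ ℓ` vertices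
`j * (n / 3 ^ ℓ), …, (j + 1) * (n / 3 ^ ℓ) - 1`. -/
def block (S : Scheme) (ℓ : ℕ) (v : Fin S.n) : ℕ := v / 3 ^ (S.L - ℓ)

/-- The set of vertices included in test `t` of iteration `r` at level `ℓ`. -/
def pool {S : Scheme} (h : S.Design) (ℓ r t : ℕ) : Finset (Fin S.n) :=
  {v | assign h ℓ r (S.block ℓ v) = t}

end Scheme

open Classical in
/-- The answer to the hyperedge-detecting query `X` on the hypergraph with hyperedge set `E`. -/
noncomputable def query {V : Type} (E : Set (Finset V)) (X : Finset V) : Bool :=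
  decide (∃ e ∈ E, e ⊆ X)

/-- All outcomes of a (non-adaptive) design. -/
noncomputable def outcomes {S : Scheme} (E : Set (Finset (Fin S.n))) (h : S.Design)
    (ℓ r t : ℕ) : Bool :=
  query E (Scheme.pool h ℓ r t)

/-! ### The decoder

Its inputs are the integer parameters of the scheme, the block assignments `h ℓ r j` and the test
outcomes `Y ℓ r t`, each of which can be read in one step.  Every number it handles is at most
polynomial in `n` and the number of tests, so that it fits in a constant number of words. -/

/-- The working memory while a level is refined: a bit table (all zero at the beginning) that is
used to enter no triple twice, and the list of the possibly defective triples found so far. -/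
structure Store where
  mark : ℕ → Bool
  pd : List (ℕ × ℕ × ℕ)

/-- Is the triple of blocks `(i, j, k)` contained in a negative test among the first `m` iterations
of the level with assignments `h` and outcomes `Y`?  The search stops at the first such test. -/
def ruledOut (h : ℕ → ℕ → ℕ) (Y : ℕ → ℕ → Bool) (i j k : ℕ) : ℕ → Timed Bool
  | 0 => op false
  | m + 1 => do
    let r ← ops 2 m
    let a ← op (h r i)
    let b ← op (h r j)
    let ab ← op (a == b)
    if ab then
      let c ← op (h r k)
      let bc ← op (b == c)
      if bc then
        let y ← op (Y r a)
        if y then ruledOut h Y i j k m else pure true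
      else ruledOut h Y i j k m
    else ruledOut h Y i j k m

/-- The `x`-th of the nine children (`x < 9`) of the blocks of a triple: block `i` of a level has
the children `3 * i`, `3 * i + 1`, `3 * i + 2` at the next level. -/
def child (t : ℕ × ℕ × ℕ) (x : ℕ) : Timed ℕ := do
  let d ← op (x / 3)
  let e ← op (x % 3)
  let p ← ops 2 (if d = 0 then t.1 else if d = 1 then t.2.1 else t.2.2)
  let y ← op (3 * p)
  op (y + e)

/-- Insert the triple `(a, b, c)` of level `ℓ`, unless it is already present.  The bit recording its
presence is at address `((ℓ * n + a) * n + b) * n + c`. -/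
def insertTriple (n ℓ a b c : ℕ) (s : Store) : Timed Store := do
  let x₁ ← op (ℓ * n)
  let x₂ ← op (x₁ + a)
  let x₃ ← op (x₂ * n)
  let x₄ ← op (x₃ + b)
  let x₅ ← op (x₄ * n)
  let x ← op (x₅ + c)
  let seen ← op (s.mark x)
  if seen then pure s
  else
    let mark ← op (Function.update s.mark x true)
    let pd ← ops 4 ((a, b, c) :: s.pd)
    pure ⟨mark, pd⟩

/-- Insert all the 84 triples of distinct children of the blocks of `t` into the list of triples of
level `ℓ`. -/
def addChildren (n ℓ : ℕ) (t : ℕ × ℕ × ℕ) (s : Store) : Timed Store :=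
  forLoop (fun z s => forLoop (fun y s => forLoop (fun x s => do
    let a ← child t x
    let b ← child t y
    let c ← child t z
    insertTriple n ℓ a b c s) y s) z s) 9 s

/-- The list of all the triples `i < j < k < g`. -/
def allTriples (g : ℕ) : Timed (List (ℕ × ℕ × ℕ)) :=
  forLoop (fun k s => forLoop (fun j s => forLoop (fun i s =>
    ops 4 ((i, j, k) :: s)) j s) k s) g []

/-- From the possibly defective triples of level `ℓ` to those of level `ℓ + 1`. -/
def refine (S : Scheme) (h : ℕ → ℕ → ℕ → ℕ) (Y : ℕ → ℕ → ℕ → Bool) (ℓ : ℕ) (s : Store) :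
    Timed Store :=
  forEach (fun t s' => do
    let out ← ruledOut (h ℓ) (Y ℓ) t.1 t.2.1 t.2.2 (S.reps ℓ)
    if out then pure s' else addChildren S.n (ℓ + 1) t s') s.pd ⟨s.mark, []⟩

/-- The decoder: start with all the triples of blocks at level `lMin`, refine level by level, and at
the level `L` of single vertices return the triples not ruled out by a negative test. -/
def decode (S : Scheme) (h : ℕ → ℕ → ℕ → ℕ) (Y : ℕ → ℕ → ℕ → Bool) :
    Timed (List (ℕ × ℕ × ℕ)) := do
  let g ← forLoop (fun _ g => op (3 * g)) S.lMin 1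
  let init ← allTriples g
  let d ← op (S.L - S.lMin)
  let s ← forLoop (fun i s => do
    let ℓ ← op (S.lMin + i)
    refine S h Y ℓ s) d ⟨fun _ => false, init⟩
  forEach (fun t res => do
    let out ← ruledOut (h S.L) (Y S.L) t.1 t.2.1 t.2.2 (S.reps S.L)
    if out then pure res else ops 4 (t :: res)) s.pd []

/-- The hyperedge set described by a list of triples of vertices. -/
def edgeSet (n : ℕ) (l : List (ℕ × ℕ × ℕ)) : Set (Finset (Fin n)) :=
  {e | ∃ t ∈ l, e.map Fin.valEmbedding = {t.1, t.2.1, t.2.2}}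

/-- The decoder run on the outcomes of the design `h` for the hyperedge set `E`. -/
noncomputable def run {S : Scheme} (E : Set (Finset (Fin S.n))) (h : S.Design) :
    Timed (List (ℕ × ℕ × ℕ)) :=
  decode S (Scheme.assign h) (outcomes E h)

/-- The estimate of the hyperedge set returned by the decoder. -/
noncomputable def estimate {S : Scheme} (E : Set (Finset (Fin S.n))) (h : S.Design) :
    Set (Finset (Fin S.n)) :=
  edgeSet S.n (run E h).val

/-- The number of elementary operations performed by the decoder. -/
noncomputable def decodingTime {S : Scheme} (E : Set (Finset (Fin S.n))) (h : S.Design) : ℕ :=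
  (run E h).steps

/-! ### The random experiment -/

/-- The law of the Erdős–Rényi random 3-uniform hypergraph on `n` vertices: each set of three
vertices is a hyperedge with probability `p`, independently. -/
noncomputable def erdosRenyi (n : ℕ) (p : unitInterval) : Measure (Set (Finset (Fin n))) :=
  setBernoulli {e : Finset (Fin n) | e.card = 3} p

/-- The expected number of hyperedges. -/
noncomputable def meanEdges (n : ℕ) (p : unitInterval) : ℝ := (p : ℝ) * (n.choose 3 : ℝ)

/-- The scheme on `n = 3 ^ L` vertices with expected number `m` of hyperedges and constants
`C₁`, `C₂`, `C'`, the real numbers of tests, iterations and rounds being rounded up. -/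
noncomputable def scheme (C₁ C₂ C' : ℝ) (L : ℕ) (m : ℝ) : Scheme where
  L := L
  lMin := ⌈Real.logb 3 (m ^ (1 / 3 : ℝ))⌉₊
  width := ⌈C₁ * m ^ (1 / 3 : ℝ)⌉₊
  iters := ⌈C₂ * m ^ (2 / 3 : ℝ)⌉₊
  rounds := ⌈C' * Real.log ((3 ^ L : ℕ) : ℝ)⌉₊

/-- The law of the random design: all blocks are assigned independently and uniformly. -/
noncomputable def designLaw (S : Scheme) : Measure S.Design :=
  Measure.pi fun _ => uniformOn Set.univ

/-- The joint law of the hypergraph and of the design, which are independent. -/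
noncomputable def experiment (S : Scheme) (p : unitInterval) :
    Measure (Set (Finset (Fin S.n)) × S.Design) :=
  (erdosRenyi S.n p).prod (designLaw S)

/-- The probability that the decoder returns the hyperedge set exactly, within `T` operations. -/
noncomputable def successProb (S : Scheme) (p : unitInterval) (T : ℝ) : ENNReal :=
  experiment S p {ω | estimate ω.1 ω.2 = ω.1 ∧ (decodingTime ω.1 ω.2 : ℝ) ≤ T}

end HyperLearn

/-!
A hyperedge is never lost by the decoder: a triple of blocks that contains a hyperedge (a
*defective* triple) lies in no negative test. What has to be shown is that the non-defective
triples are eliminated, at the finest level all of them (exactness) and at the other levels so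
many that the lists stay short (decoding time).

*One iteration.* A non-defective triple `T` of blocks falls into one test of width `w` with
probability `w ^ (-2)`. Given this, the test is positive only if some hyperedge is completed by
the blocks joining `T`, which has probability at most `∑ e, w ^ (-|e \ T|)`, where `|e \ T|`
counts the blocks of `e` outside of `T`. This linear statistic of the random hypergraph has mean
at most `3 / 10`, because the number of blocks is at least about `M`, the cube root of the
expected number of hyperedges, and `w ≥ 155 * M`; as each term is at most `1 / w`, a Chernoff
bound shows that with high probability it is at most `9 / 10` for all `T` at all levels (`Sparse`,
`Regime.prob_not_sparse_le`). Then one iteration covers `T` by a negative test with probability at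
least `w ^ (-2) / 10` (`le_frac_covered`).

*Exactness.* As `iters / w ^ 2 ≥ 140` and `rounds ≥ 4 * log n`, the iterations at the finest level
miss a given non-defective triple with probability at most `n ^ (-4)`, and a union bound over the triples of
vertices applies (`frac_exists_not_covered_le`, `estimate_eq`).

*Decoding time.* At the other levels a non-defective triple survives with probability at most
`1 / 1458`, and a surviving triple has at most `729` children. So, up to fluctuations, the number of
possibly defective triples of a level is at most `729` times the number of defective triples of
the level before plus half the number of possibly defective triples there. In expectation a level
has `O(M ^ 3)` defective triples. If `θ > 2 / 3` then `M ^ 3` is much larger than `n ^ 2`, the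
Chernoff bound gives `O(M ^ 3)` defective triples at all levels, and Chebyshev's inequality
controls the fluctuations, because two triples without a common block are rarely covered in the
same iteration (`Regime.frac_exists_card_pd_gt_le`). In general, Markov's inequality for the sum
over the `L` levels is applied to the defective triples and then to the possibly defective ones,
at the cost of a factor `√L` each (`Regime.frac_exists_card_pd_gt_le_of_sum`); the lists then have
length at most `M ^ 3 * L ^ 2`, and `L` is of the order of the logarithm of the expected
number of hyperedges. Every entry of a list costs a number of operations proportional to the
number of iterations (`decode_steps_le`), which is `O(M ^ 2)` at the levels below `L` and
`O(M ^ 2 * log n)` at level `L`.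

All random choices of the design are uniform on finite sets, so that probabilities over the design
are averages (`mean`, `frac`); the law of the hypergraph is handled through the weights of its
finitely many values (`setBernoulli_exists_le`), and `one_sub_le_successProb` combines the two.
-/

namespace HyperLearn

/-! ### Averages over finite sets -/

/-- The average of `f` over a finite type, that is, its expectation under the uniform law. -/
noncomputable def mean {X : Type*} [Fintype X] (f : X → ℝ) : ℝ :=
  (∑ x, f x) / Fintype.card X

open Classical in
/-- The probability of `p` under the uniform law on a finite type. -/
noncomputable def frac {X : Type*} [Fintype X] (p : X → Prop) : ℝ :=
  mean fun x => if p x then 1 else 0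

section Mean

variable {X : Type*} [Fintype X]

lemma mean_mono {f g : X → ℝ} (h : ∀ x, f x ≤ g x) : mean f ≤ mean g :=
  div_le_div_of_nonneg_right (Finset.sum_le_sum fun x _ => h x) (Nat.cast_nonneg _)

lemma mean_nonneg {f : X → ℝ} (h : ∀ x, 0 ≤ f x) : 0 ≤ mean f :=
  div_nonneg (Finset.sum_nonneg fun x _ => h x) (Nat.cast_nonneg _)

lemma mean_add (f g : X → ℝ) : mean (fun x => f x + g x) = mean f + mean g := by
  simp [mean, Finset.sum_add_distrib, add_div]

lemma mean_sub (f g : X → ℝ) : mean (fun x => f x - g x) = mean f - mean g := by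
  simp [mean, Finset.sum_sub_distrib, sub_div]

lemma mean_const_mul (c : ℝ) (f : X → ℝ) : mean (fun x => c * f x) = c * mean f := by
  simp [mean, ← Finset.mul_sum, mul_div_assoc]

lemma mean_sum {ι : Type*} (s : Finset ι) (f : ι → X → ℝ) :
    mean (fun x => ∑ i ∈ s, f i x) = ∑ i ∈ s, mean (f i) := by
  simp only [mean]
  rw [Finset.sum_comm, Finset.sum_div]

lemma mean_const [Nonempty X] (c : ℝ) : mean (fun _ : X => c) = c := by
  simp [mean]

lemma mean_equiv {Y : Type*} [Fintype Y] (e : X ≃ Y) (f : X → ℝ) :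
    mean (fun y => f (e.symm y)) = mean f := by
  simp only [mean]
  rw [Fintype.card_congr e, ← e.symm.sum_comp f]

lemma mean_prod {Y : Type*} [Fintype Y] (f : X × Y → ℝ) :
    mean f = mean fun y => mean fun x => f (x, y) := by
  simp only [mean]
  rw [← Finset.sum_div, Fintype.sum_prod_type_right, div_div, Fintype.card_prod]
  push_cast
  rfl

lemma frac_def (p : X → Prop) [DecidablePred p] :
    frac p = mean fun x => if p x then 1 else 0 := by
  unfold frac
  congr 1
  ext x
  congr

lemma frac_nonneg (p : X → Prop) : 0 ≤ frac p :=
  mean_nonneg fun x => by split_ifs <;> norm_num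

lemma frac_le_one (p : X → Prop) : frac p ≤ 1 := by
  classical
  rw [frac_def, mean]
  apply div_le_one_of_le₀ _ (Nat.cast_nonneg _)
  simpa using Finset.card_le_univ _

lemma frac_eq_card (p : X → Prop) [DecidablePred p] :
    frac p = (Fintype.card {x // p x} : ℝ) / Fintype.card X := by
  rw [frac_def, mean, Fintype.card_subtype]
  simp

lemma frac_mono {p r : X → Prop} (h : ∀ x, p x → r x) : frac p ≤ frac r := by
  apply mean_mono
  intro x
  by_cases hp : p x
  · simp [hp, h x hp]
  · simp only [hp, if_false]
    split_ifs <;> norm_num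

lemma frac_congr {p r : X → Prop} (h : ∀ x, p x ↔ r x) : frac p = frac r :=
  le_antisymm (frac_mono fun x => (h x).1) (frac_mono fun x => (h x).2)

lemma frac_or_le (p r : X → Prop) : frac (fun x => p x ∨ r x) ≤ frac p + frac r := by
  classical
  rw [frac_def, frac_def, frac_def, ← mean_add]
  apply mean_mono
  intro x
  by_cases hp : p x <;> by_cases hr : r x <;> simp [hp, hr]

lemma frac_exists_le {ι : Type*} (s : Finset ι) (p : ι → X → Prop) :
    frac (fun x => ∃ i ∈ s, p i x) ≤ ∑ i ∈ s, frac (p i) := by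
  classical
  simp only [frac_def]
  rw [← mean_sum]
  apply mean_mono
  intro x
  split_ifs with h
  · obtain ⟨i, hi, hp⟩ := h
    calc (1 : ℝ) = if p i x then 1 else 0 := by simp [hp]
      _ ≤ _ := Finset.single_le_sum (f := fun i => if p i x then (1 : ℝ) else 0)
        (fun j _ => by split_ifs <;> norm_num) hi
  · exact Finset.sum_nonneg fun j _ => by split_ifs <;> norm_num

lemma frac_not [Nonempty X] (p : X → Prop) : frac (fun x => ¬ p x) = 1 - frac p := by
  classical
  have : frac (fun x => ¬ p x) = mean (fun x => (1 : ℝ) - if p x then 1 else 0) := by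
    rw [frac_def]
    congr 1
    ext x
    by_cases h : p x <;> simp [h]
  rw [this, mean_sub, mean_const, frac_def]

lemma frac_not_and_not [Nonempty X] (p r : X → Prop) :
    frac (fun x => ¬ p x ∧ ¬ r x) = 1 - frac p - frac r + frac (fun x => p x ∧ r x) := by
  classical
  have : frac (fun x => ¬ p x ∧ ¬ r x) = mean (fun x => ((1 : ℝ) - (if p x then 1 else 0)
      - (if r x then 1 else 0)) + if p x ∧ r x then 1 else 0) := by
    rw [frac_def]
    congr 1
    ext x
    by_cases h : p x <;> by_cases h' : r x <;> simp [h, h']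
  rw [this, mean_add, mean_sub, mean_sub, mean_const]
  simp only [frac_def]

/-- Markov's inequality. -/
lemma frac_ge_le_mean_div {f : X → ℝ} (hf : ∀ x, 0 ≤ f x) {a : ℝ} (ha : 0 < a) :
    frac (fun x => a ≤ f x) ≤ mean f / a := by
  classical
  rw [le_div_iff₀ ha, mul_comm, frac_def, ← mean_const_mul]
  apply mean_mono
  intro x
  split_ifs with h
  · simpa using h
  · simpa using hf x

/-- Independent repetitions of a uniform experiment. -/
lemma frac_forall_pow (I : ℕ) (p : X → Prop) :
    frac (fun H : Fin I → X => ∀ r, p (H r)) = frac p ^ I := by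
  classical
  rw [frac_eq_card, frac_eq_card, div_pow, Fintype.card_subtype, Fintype.card_subtype]
  have : (Finset.univ.filter fun H : Fin I → X => ∀ r, p (H r))
      = Fintype.piFinset fun _ : Fin I => Finset.univ.filter p := by
    ext H
    simp [Fintype.mem_piFinset]
  rw [this, Fintype.card_piFinset]
  simp

end Mean

/-! ### Uniform assignments of blocks to tests -/

section Assignments

variable {α : Type*} [Fintype α] [DecidableEq α] {w : ℕ}

/-- The assignment `f` puts all the elements of `A` into the same test. -/
def Mono (f : α → Fin w) (A : Finset α) : Prop := ∀ i ∈ A, ∀ j ∈ A, f i = f j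

/-- A uniform assignment satisfies `f s = f (τ s)` for all `s ∈ S` with probability `w ^ (-|S|)`
if `τ` takes its values on `S` outside of `S`: the values on the complement of `S` are free, and
they determine the others. -/
lemma frac_agree [NeZero w] (S : Finset α) (τ : α → α) (hτ : ∀ s ∈ S, τ s ∉ S) :
    frac (fun f : α → Fin w => ∀ s ∈ S, f s = f (τ s)) = (1 / (w : ℝ)) ^ S.card := by
  classical
  have hw : (w : ℝ) ≠ 0 := by exact_mod_cast NeZero.ne w
  let e : {f : α → Fin w // ∀ s ∈ S, f s = f (τ s)} ≃ ({a // a ∉ S} → Fin w) :=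
    { toFun := fun f a => f.1 a.1
      invFun := fun k => ⟨fun a => if h : a ∈ S then k ⟨τ a, hτ a h⟩ else k ⟨a, h⟩, by
        intro s hs
        simp [hs, hτ s hs]⟩
      left_inv := by
        rintro ⟨f, hf⟩
        ext a
        by_cases h : a ∈ S
        · simp [h, hf a h]
        · simp [h]
      right_inv := by
        intro k
        ext a
        simp [a.2] }
  rw [frac_eq_card, Fintype.card_congr e]
  simp only [Fintype.card_pi, Finset.prod_const, Fintype.card_fin, Finset.card_univ]
  have h1 : Fintype.card {a // a ∉ S} + S.card = Fintype.card α := by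
    rw [Fintype.card_subtype_compl, Fintype.card_coe]
    exact Nat.sub_add_cancel (Finset.card_le_univ _)
  rw [← h1, pow_add]
  push_cast
  rw [one_div, inv_pow]
  field_simp

lemma frac_mono_eq [NeZero w] {A : Finset α} (hA : A.Nonempty) :
    frac (fun f : α → Fin w => Mono f A) = (1 / (w : ℝ)) ^ (A.card - 1) := by
  obtain ⟨a, ha⟩ := hA
  rw [← Finset.card_erase_of_mem ha, ← frac_agree (A.erase a) (fun _ => a) (by simp)]
  apply frac_congr
  intro f
  constructor
  · intro h s hs
    exact h s (Finset.mem_of_mem_erase hs) a ha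
  · intro h
    have h' : ∀ s ∈ A, f s = f a := by
      intro s hs
      by_cases hsa : s = a
      · rw [hsa]
      · exact h s (Finset.mem_erase.2 ⟨hsa, hs⟩)
    intro i hi j hj
    rw [h' i hi, h' j hj]

lemma frac_mono_and_mono_le [NeZero w] {A B : Finset α} (hAB : Disjoint A B)
    (hA : A.card = 3) (hB : B.card = 3) :
    frac (fun f : α → Fin w => Mono f A ∧ Mono f B) ≤ (1 / (w : ℝ)) ^ 4 := by
  obtain ⟨a, ha⟩ : A.Nonempty := Finset.card_pos.1 (by omega)
  obtain ⟨b, hb⟩ : B.Nonempty := Finset.card_pos.1 (by omega)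
  have hd : Disjoint (A.erase a) (B.erase b) :=
    hAB.mono (Finset.erase_subset _ _) (Finset.erase_subset _ _)
  have haB : a ∉ B := fun h => Finset.disjoint_left.1 hAB ha h
  have hbA : b ∉ A := fun h => Finset.disjoint_left.1 hAB h hb
  have hc : (A.erase a ∪ B.erase b).card = 4 := by
    rw [Finset.card_union_of_disjoint hd, Finset.card_erase_of_mem ha,
      Finset.card_erase_of_mem hb, hA, hB]
  rw [← hc, ← frac_agree (A.erase a ∪ B.erase b) (fun s => if s ∈ A then a else b)]
  · apply frac_mono
    rintro f ⟨h1, h2⟩ s hs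
    rcases Finset.mem_union.1 hs with h | h
    · have hsA := Finset.mem_of_mem_erase h
      simpa [hsA] using h1 s hsA a ha
    · have hsB := Finset.mem_of_mem_erase h
      have hsA : s ∉ A := fun h' => Finset.disjoint_left.1 hAB h' hsB
      simpa [hsA] using h2 s hsB b hb
  · intro s _
    split_ifs <;> simp [haB, hbA]

/-- The set `A` of blocks lies in a negative test of the iteration `f`, for a hypergraph whose
edges `e ∈ F` occupy the blocks `b e`. -/
def Covered {ε : Type*} (F : Finset ε) (b : ε → Finset α) (A : Finset α) (f : α → Fin w) : Prop :=
  Mono f A ∧ ∀ e ∈ F, ¬ Mono f (A ∪ b e)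

/-- A triple of blocks lies in a negative test with probability close to `w ^ (-2)`, unless some
edge is likely to be completed by the blocks that join the triple. -/
lemma le_frac_covered [NeZero w] {ε : Type*} (F : Finset ε) (b : ε → Finset α) {A : Finset α}
    (hA : A.card = 3) {z : ℝ} (hz : ∑ e ∈ F, (1 / (w : ℝ)) ^ (b e \ A).card ≤ z) :
    (1 - z) * (1 / (w : ℝ)) ^ 2 ≤ frac (fun f : α → Fin w => Covered F b A f) := by
  have hne : A.Nonempty := Finset.card_pos.1 (by omega)
  have h1 : frac (fun f : α → Fin w => Mono f A) ≤ frac (fun f : α → Fin w => Covered F b A f)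
      + ∑ e ∈ F, frac (fun f : α → Fin w => Mono f (A ∪ b e)) := by
    refine le_trans ?_ ((frac_or_le _ _).trans (add_le_add le_rfl (frac_exists_le F
      fun e (f : α → Fin w) => Mono f (A ∪ b e))))
    apply frac_mono
    intro f hf
    by_cases h : ∃ e ∈ F, Mono f (A ∪ b e)
    · exact Or.inr h
    · push Not at h
      exact Or.inl ⟨hf, h⟩
  have h2 : ∑ e ∈ F, frac (fun f : α → Fin w => Mono f (A ∪ b e))
      = (1 / (w : ℝ)) ^ 2 * ∑ e ∈ F, (1 / (w : ℝ)) ^ (b e \ A).card := by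
    rw [Finset.mul_sum]
    apply Finset.sum_congr rfl
    intro e _
    rw [frac_mono_eq (hne.mono Finset.subset_union_left), ← pow_add]
    congr 1
    have := Finset.card_sdiff_add_card (b e) A
    rw [Finset.union_comm] at this
    omega
  rw [frac_mono_eq hne, hA, h2] at h1
  have h3 : 0 ≤ (1 / (w : ℝ)) ^ 2 := by positivity
  simp only [Nat.add_one_sub_one] at h1
  nlinarith [mul_le_mul_of_nonneg_left hz h3]

end Assignments

end HyperLearn

namespace HyperLearn

/-! ### Independent iterations of a test -/

lemma pow_sub_pow_le_mul {x y : ℝ} (hx₀ : 0 ≤ x) (hx₁ : x ≤ 1) (hy₀ : 0 ≤ y) (hy₁ : y ≤ 1)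
    {b : ℝ} (hb : 0 ≤ b) (h : x - y ≤ b) (I : ℕ) : x ^ I - y ^ I ≤ I * b := by
  induction I with
  | zero => simp
  | succ I ih =>
    have h1 : x ^ (I + 1) - y ^ (I + 1) = x * (x ^ I - y ^ I) + y ^ I * (x - y) := by ring
    have h2 : y ^ I ≤ 1 := pow_le_one₀ hy₀ hy₁
    have h3 : 0 ≤ y ^ I := by positivity
    have h4 : 0 ≤ (I : ℝ) * b := by positivity
    rw [h1]
    push_cast
    have h5 : x * (x ^ I - y ^ I) ≤ I * b := by nlinarith
    nlinarith

open Classical in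
/-- The number of `t ∈ P` that are missed by all the iterations `H r`. -/
noncomputable def missed {X τ : Type*} (P : Finset τ) (c : τ → X → Prop) {I : ℕ}
    (H : Fin I → X) : ℕ :=
  (P.filter fun t => ∀ r, ¬ c t (H r)).card

lemma missed_eq_sum {X τ : Type*} (P : Finset τ) (c : τ → X → Prop) {I : ℕ} (H : Fin I → X)
    [∀ t, Decidable (∀ r, ¬ c t (H r))] :
    (missed P c H : ℝ) = ∑ t ∈ P, if ∀ r, ¬ c t (H r) then (1 : ℝ) else 0 := by
  rw [missed, Finset.sum_boole]
  congr

lemma mean_missed_eq {X τ : Type*} [Fintype X] (P : Finset τ) (c : τ → X → Prop) (I : ℕ) :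
    mean (fun H : Fin I → X => (missed P c H : ℝ))
      = ∑ t ∈ P, frac (fun H : Fin I → X => ∀ r, ¬ c t (H r)) := by
  classical
  simp only [missed_eq_sum, mean_sum, frac_def]

section Iterations

variable {X : Type*} [Fintype X] [Nonempty X]

lemma frac_forall_not_le_exp (I : ℕ) (c : X → Prop) {a : ℝ} (ha : a ≤ frac c) :
    frac (fun H : Fin I → X => ∀ r, ¬ c (H r)) ≤ Real.exp (-(a * I)) := by
  rw [frac_forall_pow I (fun x => ¬ c x), frac_not]
  have h0 : 0 ≤ 1 - frac c := by linarith [frac_le_one c]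
  calc (1 - frac c) ^ I ≤ (Real.exp (-a)) ^ I := by
        apply pow_le_pow_left₀ h0
        linarith [Real.add_one_le_exp (-a)]
    _ = Real.exp (-(a * I)) := by rw [← Real.exp_nat_mul]; congr 1; ring

/-- The events that two triples are missed by all iterations are almost uncorrelated if a single
iteration rarely hits both triples. -/
lemma frac_forall_not_and_le (I : ℕ) (c d : X → Prop) {b : ℝ}
    (hb : frac (fun x => c x ∧ d x) ≤ b) :
    frac (fun H : Fin I → X => (∀ r, ¬ c (H r)) ∧ ∀ r, ¬ d (H r))
      - frac (fun H : Fin I → X => ∀ r, ¬ c (H r)) * frac (fun H : Fin I → X => ∀ r, ¬ d (H r))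
      ≤ I * b := by
  have h1 : frac (fun H : Fin I → X => (∀ r, ¬ c (H r)) ∧ ∀ r, ¬ d (H r))
      = frac (fun x => ¬ c x ∧ ¬ d x) ^ I := by
    rw [← frac_forall_pow I (fun x => ¬ c x ∧ ¬ d x)]
    exact frac_congr fun H => forall_and.symm
  rw [h1, frac_forall_pow I (fun x => ¬ c x), frac_forall_pow I (fun x => ¬ d x), ← mul_pow]
  have hc := frac_nonneg fun x => ¬ c x
  have hc' := frac_le_one fun x => ¬ c x
  have hd := frac_nonneg fun x => ¬ d x
  have hd' := frac_le_one fun x => ¬ d x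
  apply pow_sub_pow_le_mul (frac_nonneg _) (frac_le_one _) (by positivity)
    (mul_le_one₀ hc' hd hd') ((frac_nonneg _).trans hb)
  rw [frac_not_and_not, frac_not, frac_not]
  nlinarith [frac_nonneg c, frac_nonneg d]

lemma mean_missed_le {τ : Type*} (P : Finset τ) (c : τ → X → Prop) (I : ℕ) {a : ℝ}
    (ha : ∀ t ∈ P, a ≤ frac (c t)) :
    mean (fun H : Fin I → X => (missed P c H : ℝ)) ≤ P.card * Real.exp (-(a * I)) := by
  rw [mean_missed_eq, ← nsmul_eq_mul]
  exact Finset.sum_le_card_nsmul _ _ _ fun t ht => frac_forall_not_le_exp I _ (ha t ht)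

open Classical in
/-- Chebyshev's inequality for the number of triples missed by all iterations.  Pairs of triples
in the relation `R` are the correlated ones; their number is at most `B` for each triple. -/
lemma frac_missed_ge_le {τ : Type*} (P : Finset τ) (c : τ → X → Prop) (I : ℕ) {a b B δ : ℝ}
    (ha : ∀ t ∈ P, a ≤ frac (c t)) (R : τ → τ → Prop)
    (hb : ∀ t ∈ P, ∀ u ∈ P, ¬ R t u → frac (fun x => c t x ∧ c u x) ≤ b) (hb₀ : 0 ≤ b)
    (hB : ∀ t ∈ P, ((P.filter fun u => R t u).card : ℝ) ≤ B) (hδ : 0 < δ) :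
    frac (fun H : Fin I → X => P.card * Real.exp (-(a * I)) + δ ≤ missed P c H)
      ≤ (P.card ^ 2 * (I * b) + P.card * B) / δ ^ 2 := by
  set s : τ → (Fin I → X) → Prop := fun t H => ∀ r, ¬ c t (H r) with hs
  set μ : ℝ := ∑ t ∈ P, frac (s t) with hμ
  have hμle : μ ≤ P.card * Real.exp (-(a * I)) := by
    have := mean_missed_le P c I ha
    rwa [mean_missed_eq] at this
  have hmarkov : frac (fun H : Fin I → X => δ ^ 2 ≤ ((missed P c H : ℝ) - μ) ^ 2)
      ≤ mean (fun H : Fin I → X => ((missed P c H : ℝ) - μ) ^ 2) / δ ^ 2 :=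
    frac_ge_le_mean_div (fun H => sq_nonneg _) (by positivity)
  have hsub : frac (fun H : Fin I → X => P.card * Real.exp (-(a * I)) + δ ≤ missed P c H)
      ≤ frac (fun H : Fin I → X => δ ^ 2 ≤ ((missed P c H : ℝ) - μ) ^ 2) := by
    apply frac_mono
    intro H hH
    apply pow_le_pow_left₀ hδ.le
    linarith
  refine hsub.trans (hmarkov.trans ?_)
  apply div_le_div_of_nonneg_right _ (by positivity)
  have hexp : ∀ H : Fin I → X, ((missed P c H : ℝ) - μ) ^ 2
      = (∑ t ∈ P, ∑ u ∈ P, if s t H ∧ s u H then (1 : ℝ) else 0)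
        - 2 * μ * missed P c H + μ ^ 2 := by
    intro H
    have : (missed P c H : ℝ) * missed P c H
        = ∑ t ∈ P, ∑ u ∈ P, if s t H ∧ s u H then (1 : ℝ) else 0 := by
      rw [missed_eq_sum, Finset.sum_mul_sum]
      refine Finset.sum_congr rfl fun t _ => Finset.sum_congr rfl fun u _ => ?_
      change (if s t H then (1 : ℝ) else 0) * (if s u H then (1 : ℝ) else 0) = _
      by_cases h1 : s t H <;> by_cases h2 : s u H <;> simp [h1, h2]
    rw [← this]
    ring
  have hmean : mean (fun H : Fin I → X => ((missed P c H : ℝ) - μ) ^ 2)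
      = ∑ t ∈ P, ∑ u ∈ P, (frac (fun H => s t H ∧ s u H) - frac (s t) * frac (s u)) := by
    simp only [hexp]
    rw [mean_add, mean_sub, mean_const, mean_const_mul, mean_missed_eq, mean_sum]
    simp only [mean_sum, Finset.sum_sub_distrib]
    rw [← Finset.sum_mul_sum, ← hμ]
    simp only [frac_def]
    ring
  rw [hmean]
  -- only the pairs in `R` contribute more than `I * b` to the variance
  have hpair : ∀ t ∈ P, ∀ u ∈ P,
      frac (fun H => s t H ∧ s u H) - frac (s t) * frac (s u)
        ≤ I * b + if R t u then 1 else 0 := by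
    intro t ht u hu
    by_cases h : R t u
    · have h1 := frac_le_one (fun H => s t H ∧ s u H)
      have h2 := mul_nonneg (frac_nonneg (s t)) (frac_nonneg (s u))
      have h3 : 0 ≤ (I : ℝ) * b := by positivity
      simp only [h, if_true]
      linarith
    · simp only [h, if_false, add_zero]
      exact frac_forall_not_and_le I (c t) (c u) (hb t ht u hu h)
  calc ∑ t ∈ P, ∑ u ∈ P, (frac (fun H => s t H ∧ s u H) - frac (s t) * frac (s u))
      ≤ ∑ t ∈ P, ∑ u ∈ P, (I * b + if R t u then (1 : ℝ) else 0) :=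
        Finset.sum_le_sum fun t ht => Finset.sum_le_sum fun u hu => hpair t ht u hu
    _ ≤ ∑ t ∈ P, (P.card * (I * b) + B) := by
        apply Finset.sum_le_sum
        intro t ht
        rw [Finset.sum_add_distrib, Finset.sum_const, nsmul_eq_mul, Finset.sum_boole]
        linarith [hB t ht]
    _ = P.card ^ 2 * (I * b) + P.card * B := by
        rw [Finset.sum_const, nsmul_eq_mul]
        ring

end Iterations

end HyperLearn

namespace HyperLearn

/-! ### Semantics of the word-RAM combinators -/

namespace Timed

variable {α β σ : Type}

@[simp] lemma bind_val (x : Timed α) (f : α → Timed β) : (x >>= f).val = (f x.val).val := rfl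
@[simp] lemma bind_steps (x : Timed α) (f : α → Timed β) :
    (x >>= f).steps = x.steps + (f x.val).steps := rfl
@[simp] lemma pure_val (a : α) : (pure a : Timed α).val = a := rfl
@[simp] lemma pure_steps (a : α) : (pure a : Timed α).steps = 0 := rfl
@[simp] lemma op_val (a : α) : (op a).val = a := rfl
@[simp] lemma op_steps (a : α) : (op a).steps = 1 := rfl
@[simp] lemma ops_val (k : ℕ) (a : α) : (ops k a).val = a := rfl
@[simp] lemma ops_steps (k : ℕ) (a : α) : (ops k a).steps = k := rfl

lemma forLoop_succ_val (body : ℕ → σ → Timed σ) (m : ℕ) (s : σ) :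
    (forLoop body (m + 1) s).val = (body m (forLoop body m s).val).val := rfl

lemma forLoop_induct (body : ℕ → σ → Timed σ) (P : ℕ → σ → Prop) (m : ℕ) (s : σ) (h0 : P 0 s)
    (hs : ∀ i < m, ∀ s, P i s → P (i + 1) (body i s).val) : P m (forLoop body m s).val := by
  induction m with
  | zero => exact h0
  | succ m ih =>
    exact hs m (Nat.lt_succ_self m) _ (ih fun i hi => hs i (hi.trans (Nat.lt_succ_self m)))

lemma forLoop_steps (body : ℕ → σ → Timed σ) (m : ℕ) (s : σ) :
    (forLoop body m s).steps
      = ∑ i ∈ Finset.range m, (2 + (body i (forLoop body i s).val).steps) + 1 := by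
  induction m with
  | zero => rfl
  | succ m ih =>
    rw [Finset.sum_range_succ]
    simp only [forLoop, bind_steps, ih, ops_steps, ops_val]
    ring

lemma forLoop_steps_le (body : ℕ → σ → Timed σ) (m c : ℕ) (s : σ)
    (h : ∀ i < m, ∀ s, (body i s).steps ≤ c) : (forLoop body m s).steps ≤ m * (2 + c) + 1 := by
  rw [forLoop_steps]
  apply Nat.add_le_add_right
  calc _ ≤ ∑ i ∈ Finset.range m, (2 + c) :=
        Finset.sum_le_sum fun i hi => Nat.add_le_add_left (h i (Finset.mem_range.1 hi) _) 2
    _ = _ := by simp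

lemma forEach_val (body : ℕ × ℕ × ℕ → σ → Timed σ) (l : List (ℕ × ℕ × ℕ)) (s : σ) :
    (forEach body l s).val = l.foldl (fun s a => (body a s).val) s := by
  induction l generalizing s with
  | nil => rfl
  | cons a l ih => simp [forEach, ih]

lemma forEach_steps_le (body : ℕ × ℕ × ℕ → σ → Timed σ) (c : ℕ) (l : List (ℕ × ℕ × ℕ)) (s : σ)
    (h : ∀ t s, (body t s).steps ≤ c) : (forEach body l s).steps ≤ l.length * (5 + c) + 1 := by
  induction l generalizing s with
  | nil => simp [forEach]
  | cons a l ih =>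
    simp only [forEach, bind_steps, ops_steps, ops_val, List.length_cons]
    have h1 := h a s
    have h2 := ih (body a s).val
    nlinarith

/-- Three nested loops over all `x < y < z < g` visit each such triple once; `Q A s` says that the
state `s` is the right one after the triples in `A`. -/
lemma forLoop_triples_induct (body : ℕ → ℕ → ℕ → σ → Timed σ) (Q : Set (ℕ × ℕ × ℕ) → σ → Prop)
    (g : ℕ) (s : σ) (h0 : Q ∅ s)
    (hs : ∀ x y z A s, x < y → y < z → z < g → (x, y, z) ∉ A → Q A s →
      Q (insert (x, y, z) A) (body x y z s).val) :
    Q {t | t.1 < t.2.1 ∧ t.2.1 < t.2.2 ∧ t.2.2 < g}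
      (forLoop (fun z s => forLoop (fun y s => forLoop (fun x s => body x y z s) y s) z s)
        g s).val := by
  apply forLoop_induct _ (fun z s => Q {t | t.1 < t.2.1 ∧ t.2.1 < t.2.2 ∧ t.2.2 < z} s)
  · convert h0
    ext t
    simp
  intro z hz s hQ
  have key : Q {t | t.1 < t.2.1 ∧ t.2.1 < t.2.2 ∧ (t.2.2 < z ∨ t.2.2 = z ∧ t.2.1 < z)}
      (forLoop (fun y s => forLoop (fun x s => body x y z s) y s) z s).val := by
    apply forLoop_induct _ (fun y s =>
      Q {t | t.1 < t.2.1 ∧ t.2.1 < t.2.2 ∧ (t.2.2 < z ∨ t.2.2 = z ∧ t.2.1 < y)} s)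
    · convert hQ using 2
      ext t
      simp
    intro y hy s hQ
    have key : Q {t | t.1 < t.2.1 ∧ t.2.1 < t.2.2 ∧ (t.2.2 < z ∨ t.2.2 = z ∧
        (t.2.1 < y ∨ t.2.1 = y ∧ t.1 < y))} (forLoop (fun x s => body x y z s) y s).val := by
      apply forLoop_induct _ (fun x s => Q {t | t.1 < t.2.1 ∧ t.2.1 < t.2.2 ∧
        (t.2.2 < z ∨ t.2.2 = z ∧ (t.2.1 < y ∨ t.2.1 = y ∧ t.1 < x))} s)
      · convert hQ using 2
        ext t
        simp
      intro x hx s hQ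
      have := hs x y z _ s hx hy hz (by simp) hQ
      convert this using 2
      ext ⟨a, b, c⟩
      simp only [Set.mem_ofPred_eq, Set.mem_insert_iff, Prod.mk.injEq]
      omega
    convert key using 2
    ext ⟨a, b, c⟩
    simp only
    omega
  convert key using 2
  ext ⟨a, b, c⟩
  simp only
  omega

lemma forLoop_triples_steps_le (body : ℕ → ℕ → ℕ → σ → Timed σ) (g c : ℕ) (s : σ)
    (h : ∀ x y z s, (body x y z s).steps ≤ c) :
    (forLoop (fun z s => forLoop (fun y s => forLoop (fun x s => body x y z s) y s) z s) g s).steps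
      ≤ g * (2 + (g * (2 + (g * (2 + c) + 1)) + 1)) + 1 := by
  apply forLoop_steps_le
  intro z hz s
  refine (forLoop_steps_le _ z (g * (2 + c) + 1) s ?_).trans ?_
  · intro y hy s
    refine (forLoop_steps_le _ y c s fun x _ s => h x y z s).trans ?_
    gcongr
    omega
  · gcongr

end Timed

open Timed

/-! ### Semantics of the decoder -/

/-- The triple of blocks `t` lies in a negative test among the first `m` iterations. -/
def RuledOut (h : ℕ → ℕ → ℕ) (Y : ℕ → ℕ → Bool) (m : ℕ) (t : ℕ × ℕ × ℕ) : Prop :=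
  ∃ r < m, h r t.1 = h r t.2.1 ∧ h r t.2.1 = h r t.2.2 ∧ Y r (h r t.1) = false

lemma ruledOut_val (h : ℕ → ℕ → ℕ) (Y : ℕ → ℕ → Bool) (m : ℕ) (t : ℕ × ℕ × ℕ) :
    (ruledOut h Y t.1 t.2.1 t.2.2 m).val = true ↔ RuledOut h Y m t := by
  induction m with
  | zero => simp [ruledOut, RuledOut]
  | succ m ih =>
    have : RuledOut h Y (m + 1) t ↔
        (h m t.1 = h m t.2.1 ∧ h m t.2.1 = h m t.2.2 ∧ Y m (h m t.1) = false)
          ∨ RuledOut h Y m t := by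
      simp only [RuledOut, Nat.lt_succ_iff_lt_or_eq]
      constructor
      · rintro ⟨r, hr | rfl, hrest⟩
        · exact Or.inr ⟨r, hr, hrest⟩
        · exact Or.inl hrest
      · rintro (hrest | ⟨r, hr, hrest⟩)
        · exact ⟨m, Or.inr rfl, hrest⟩
        · exact ⟨r, Or.inl hr, hrest⟩
    rw [this, ← ih]
    simp only [ruledOut, bind_val, op_val, ops_val]
    by_cases h1 : h m t.1 = h m t.2.1
    · by_cases h2 : h m t.2.1 = h m t.2.2
      · cases h3 : Y m (h m t.1) <;> simp [h1, h2]
      · simp [h1, h2]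
    · simp [h1]

lemma ruledOut_steps_le (h : ℕ → ℕ → ℕ) (Y : ℕ → ℕ → Bool) (i j k m : ℕ) :
    (ruledOut h Y i j k m).steps ≤ 8 * m + 1 := by
  induction m with
  | zero => simp [ruledOut]
  | succ m ih =>
    unfold ruledOut
    by_cases h1 : h m i = h m j
    · by_cases h2 : h m j = h m k
      · by_cases h3 : Y m (h m k) = true <;> simp [h1, h2, h3]
        all_goals omega
      · simp [h1, h2]
        omega
    · simp [h1]
      omega

/-- The child number `x < 9` of the blocks of `t`. -/
def childOf (t : ℕ × ℕ × ℕ) (x : ℕ) : ℕ :=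
  3 * (if x / 3 = 0 then t.1 else if x / 3 = 1 then t.2.1 else t.2.2) + x % 3

lemma child_steps (t : ℕ × ℕ × ℕ) (x : ℕ) : (child t x).steps = 6 := rfl

/-- All the increasing triples of numbers below `g`. -/
def increasing (g : ℕ) : Finset (ℕ × ℕ × ℕ) :=
  (Finset.range g ×ˢ Finset.range g ×ˢ Finset.range g).filter
    fun t => t.1 < t.2.1 ∧ t.2.1 < t.2.2

lemma mem_increasing {g : ℕ} {t : ℕ × ℕ × ℕ} :
    t ∈ increasing g ↔ t.1 < t.2.1 ∧ t.2.1 < t.2.2 ∧ t.2.2 < g := by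
  simp only [increasing, Finset.mem_filter, Finset.mem_product, Finset.mem_range]
  omega

lemma card_increasing_le (g : ℕ) : (increasing g).card ≤ g ^ 3 := by
  refine (Finset.card_filter_le _ _).trans ?_
  simp only [Finset.card_product, Finset.card_range]
  exact le_of_eq (by ring)

/-- The triple of children of the blocks of `t` with the numbers in `p`. -/
def childTriple (t p : ℕ × ℕ × ℕ) : ℕ × ℕ × ℕ :=
  (childOf t p.1, childOf t p.2.1, childOf t p.2.2)

/-- The triples of distinct children of the blocks of `t`. -/
def children (t : ℕ × ℕ × ℕ) : Finset (ℕ × ℕ × ℕ) :=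
  (increasing 9).image (childTriple t)

lemma card_children_le (t : ℕ × ℕ × ℕ) : (children t).card ≤ 729 :=
  Finset.card_image_le.trans (card_increasing_le 9)

lemma childOf_lt {t : ℕ × ℕ × ℕ} {g : ℕ} (ht : t ∈ increasing g) (x : ℕ) :
    childOf t x < 3 * g := by
  rw [mem_increasing] at ht
  unfold childOf
  split_ifs <;> omega

lemma children_subset {t : ℕ × ℕ × ℕ} {g : ℕ} (ht : t ∈ increasing g) :
    children t ⊆ increasing (3 * g) := by
  intro u hu
  obtain ⟨⟨x, y, z⟩, hp, rfl⟩ := Finset.mem_image.1 hu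
  have h3 := childOf_lt ht z
  rw [mem_increasing] at ht hp ⊢
  refine ⟨?_, ?_, h3⟩
  all_goals
    simp only [childTriple, childOf]
    simp only at hp
    split_ifs <;> omega

/-- The address of the bit that records the presence of `(a, b, c)` at level `ℓ`. -/
def address (n ℓ a b c : ℕ) : ℕ := ((ℓ * n + a) * n + b) * n + c

lemma mul_add_inj {n x y a b : ℕ} (ha : a < n) (hb : b < n) (h : x * n + a = y * n + b) :
    x = y ∧ a = b := by
  have hn : 0 < n := by omega
  have h1 : (x * n + a) / n = x := by
    rw [mul_comm, Nat.mul_add_div hn, Nat.div_eq_of_lt ha, add_zero]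
  have h2 : (y * n + b) / n = y := by
    rw [mul_comm, Nat.mul_add_div hn, Nat.div_eq_of_lt hb, add_zero]
  have hxy : x = y := by rw [← h1, ← h2, h]
  subst hxy
  exact ⟨rfl, by omega⟩

lemma address_inj {n ℓ ℓ' a b c a' b' c' : ℕ} (ha : a < n) (hb : b < n) (hc : c < n)
    (ha' : a' < n) (hb' : b' < n) (hc' : c' < n)
    (h : address n ℓ a b c = address n ℓ' a' b' c') : ℓ = ℓ' ∧ a = a' ∧ b = b' ∧ c = c' := by
  obtain ⟨h1, rfl⟩ := mul_add_inj hc hc' h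
  obtain ⟨h2, rfl⟩ := mul_add_inj hb hb' h1
  obtain ⟨h3, rfl⟩ := mul_add_inj ha ha' h2
  exact ⟨h3, rfl, rfl, rfl⟩

/-- The bits of the levels above `ℓ` are all zero. -/
def Store.Fresh (n ℓ : ℕ) (s : Store) : Prop :=
  ∀ ℓ' > ℓ, ∀ a < n, ∀ b < n, ∀ c < n, s.mark (address n ℓ' a b c) = false

/-- The list of the store enumerates `P` without repetition. -/
def Store.Lists (s : Store) (P : Set (ℕ × ℕ × ℕ)) : Prop :=
  s.pd.Nodup ∧ ∀ t, t ∈ s.pd ↔ t ∈ P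

/-- The bits of level `ℓ` are those of the triples in the list. -/
def Store.Marked (n ℓ : ℕ) (s : Store) : Prop :=
  ∀ a < n, ∀ b < n, ∀ c < n, s.mark (address n ℓ a b c) = true ↔ (a, b, c) ∈ s.pd

/-- The invariant of the list under construction at level `ℓ`. -/
structure Store.Inv (n ℓ : ℕ) (s : Store) (P : Set (ℕ × ℕ × ℕ)) : Prop where
  fresh : s.Fresh n ℓ
  lists : s.Lists P
  marked : s.Marked n ℓ

lemma insertTriple_val_of_mark {n ℓ a b c : ℕ} {s : Store}
    (hm : s.mark (address n ℓ a b c) = true) : (insertTriple n ℓ a b c s).val = s := by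
  unfold address at hm
  unfold insertTriple
  simp [hm]

lemma insertTriple_val_of_not_mark {n ℓ a b c : ℕ} {s : Store}
    (hm : ¬ s.mark (address n ℓ a b c) = true) : (insertTriple n ℓ a b c s).val
      = ⟨Function.update s.mark (address n ℓ a b c) true, (a, b, c) :: s.pd⟩ := by
  unfold address at hm ⊢
  unfold insertTriple
  simp [hm]

lemma insertTriple_inv {n ℓ a b c : ℕ} {s : Store} {P : Set (ℕ × ℕ × ℕ)} (ha : a < n) (hb : b < n)
    (hc : c < n) (hs : s.Inv n ℓ P) :
    (insertTriple n ℓ a b c s).val.Inv n ℓ (insert (a, b, c) P) := by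
  by_cases hm : s.mark (address n ℓ a b c) = true
  · rw [insertTriple_val_of_mark hm]
    have hin : (a, b, c) ∈ s.pd := (hs.marked a ha b hb c hc).1 hm
    rw [Set.insert_eq_of_mem ((hs.lists.2 _).1 hin)]
    exact hs
  · rw [insertTriple_val_of_not_mark hm]
    have hin : (a, b, c) ∉ s.pd := fun h => hm ((hs.marked a ha b hb c hc).2 h)
    refine ⟨?_, ⟨?_, ?_⟩, ?_⟩
    · intro ℓ' hℓ' a' ha' b' hb' c' hc'
      have hne : address n ℓ' a' b' c' ≠ address n ℓ a b c := fun h =>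
        hℓ'.ne' (address_inj ha' hb' hc' ha hb hc h).1
      simp only [Function.update_of_ne hne]
      exact hs.fresh ℓ' hℓ' a' ha' b' hb' c' hc'
    · exact List.nodup_cons.2 ⟨hin, hs.lists.1⟩
    · intro t
      simp [hs.lists.2]
    · intro a' ha' b' hb' c' hc'
      by_cases heq : address n ℓ a' b' c' = address n ℓ a b c
      · obtain ⟨-, rfl, rfl, rfl⟩ := address_inj ha' hb' hc' ha hb hc heq
        simp
      · have hne : (a', b', c') ≠ (a, b, c) := by
          rintro h
          simp only [Prod.mk.injEq] at h
          obtain ⟨rfl, rfl, rfl⟩ := h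
          exact heq rfl
        simp only [Function.update_of_ne heq, List.mem_cons, hne, false_or]
        exact hs.marked a' ha' b' hb' c' hc'

lemma insertTriple_steps_le (n ℓ a b c : ℕ) (s : Store) :
    (insertTriple n ℓ a b c s).steps ≤ 12 := by
  unfold insertTriple
  by_cases h : s.mark (((ℓ * n + a) * n + b) * n + c) = true <;> simp [h]

lemma addChildren_inv {n ℓ g : ℕ} {t : ℕ × ℕ × ℕ} {s : Store} {P : Set (ℕ × ℕ × ℕ)}
    (ht : t ∈ increasing g) (hg : 3 * g ≤ n) (hs : s.Inv n ℓ P) :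
    (addChildren n ℓ t s).val.Inv n ℓ (P ∪ children t) := by
  have hset : (children t : Set (ℕ × ℕ × ℕ))
      = childTriple t '' {p | p.1 < p.2.1 ∧ p.2.1 < p.2.2 ∧ p.2.2 < 9} := by
    rw [children, Finset.coe_image]
    congr 1
    ext p
    simp [mem_increasing]
  rw [hset]
  refine forLoop_triples_induct (fun x y z s => do
    let a ← child t x
    let b ← child t y
    let c ← child t z
    insertTriple n ℓ a b c s) (fun A s => s.Inv n ℓ (P ∪ childTriple t '' A)) 9 s ?_ ?_
  · simpa using hs
  · intro x y z A s _ _ _ _ hA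
    rw [Set.image_insert_eq, Set.union_insert]
    exact insertTriple_inv ((childOf_lt ht x).trans_le hg) ((childOf_lt ht y).trans_le hg)
      ((childOf_lt ht z).trans_le hg) hA

lemma addChildren_steps_le (n ℓ : ℕ) (t : ℕ × ℕ × ℕ) (s : Store) :
    (addChildren n ℓ t s).steps ≤ 30000 := by
  refine (forLoop_triples_steps_le _ 9 30 s ?_).trans (by norm_num)
  intro x y z s
  simp only [bind_steps, child_steps]
  have := insertTriple_steps_le n ℓ (child t x).val (child t y).val (child t z).val s
  omega

lemma allTriples_lists (g : ℕ) (mark : ℕ → Bool) :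
    Store.Lists ⟨mark, (allTriples g).val⟩ (increasing g) := by
  have hset : (increasing g : Set (ℕ × ℕ × ℕ))
      = {p | p.1 < p.2.1 ∧ p.2.1 < p.2.2 ∧ p.2.2 < g} := by
    ext p
    simp [mem_increasing]
  rw [hset]
  apply forLoop_triples_induct (fun i j k s => ops 4 ((i, j, k) :: s))
    (fun A l => Store.Lists ⟨mark, l⟩ A)
  · exact ⟨List.nodup_nil, by simp⟩
  · intro x y z A l _ _ _ hA hl
    refine ⟨List.nodup_cons.2 ⟨fun h => hA ((hl.2 _).1 h), hl.1⟩, fun t => ?_⟩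
    have := hl.2 t
    simp only at this
    simp [this]

lemma allTriples_steps_le {g : ℕ} (hg : 1 ≤ g) : (allTriples g).steps ≤ 13 * g ^ 3 := by
  refine (forLoop_triples_steps_le (fun i j k s => ops 4 ((i, j, k) :: s)) g 4 [] ?_).trans ?_
  · intro x y z s
    simp
  · have h2 : g ≤ g ^ 3 := Nat.le_self_pow (by norm_num) g
    have h3 : g ^ 2 ≤ g ^ 3 := Nat.pow_le_pow_right hg (by norm_num)
    have h4 : g * (2 + (g * (2 + (g * (2 + 4) + 1)) + 1)) + 1
        = 6 * g ^ 3 + 3 * g ^ 2 + 3 * g + 1 := by ring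
    omega

open Classical in
/-- The triples in `P` that lie in no negative test. -/
noncomputable def survivors (h : ℕ → ℕ → ℕ) (Y : ℕ → ℕ → Bool) (m : ℕ)
    (P : Finset (ℕ × ℕ × ℕ)) : Finset (ℕ × ℕ × ℕ) :=
  P.filter fun t => ¬ RuledOut h Y m t

lemma mem_survivors {h : ℕ → ℕ → ℕ} {Y : ℕ → ℕ → Bool} {m : ℕ} {P : Finset (ℕ × ℕ × ℕ)}
    {t : ℕ × ℕ × ℕ} : t ∈ survivors h Y m P ↔ t ∈ P ∧ ¬ RuledOut h Y m t := by
  simp [survivors]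

/-- The set of possibly defective triples at level `S.lMin + d`. -/
noncomputable def possible (S : Scheme) (h : ℕ → ℕ → ℕ → ℕ) (Y : ℕ → ℕ → ℕ → Bool) :
    ℕ → Finset (ℕ × ℕ × ℕ)
  | 0 => increasing (3 ^ S.lMin)
  | d + 1 => (survivors (h (S.lMin + d)) (Y (S.lMin + d)) (S.reps (S.lMin + d))
      (possible S h Y d)).biUnion children

lemma possible_subset (S : Scheme) (h : ℕ → ℕ → ℕ → ℕ) (Y : ℕ → ℕ → ℕ → Bool) (d : ℕ) :
    possible S h Y d ⊆ increasing (3 ^ (S.lMin + d)) := by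
  induction d with
  | zero => exact subset_rfl
  | succ d ih =>
    intro u hu
    obtain ⟨t, ht, hut⟩ := Finset.mem_biUnion.1 hu
    have := children_subset (ih (mem_survivors.1 ht).1) hut
    rwa [← pow_succ'] at this

lemma card_possible_succ_le (S : Scheme) (h : ℕ → ℕ → ℕ → ℕ) (Y : ℕ → ℕ → ℕ → Bool) (d : ℕ) :
    (possible S h Y (d + 1)).card ≤ 729 * (survivors (h (S.lMin + d)) (Y (S.lMin + d))
      (S.reps (S.lMin + d)) (possible S h Y d)).card := by
  refine Finset.card_biUnion_le.trans ?_
  rw [mul_comm, ← smul_eq_mul]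
  exact Finset.sum_le_card_nsmul _ _ _ fun t _ => card_children_le t

lemma refine_spec (S : Scheme) (h : ℕ → ℕ → ℕ → ℕ) (Y : ℕ → ℕ → ℕ → Bool) (ℓ : ℕ) (hℓ : ℓ < S.L)
    {s : Store} {P : Finset (ℕ × ℕ × ℕ)} (hP : P ⊆ increasing (3 ^ ℓ)) (hF : s.Fresh S.n ℓ)
    (hL : s.Lists P) :
    (refine S h Y ℓ s).val.Inv S.n (ℓ + 1)
      ((survivors (h ℓ) (Y ℓ) (S.reps ℓ) P).biUnion children) := by
  have hg : 3 * 3 ^ ℓ ≤ S.n := by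
    rw [← pow_succ']
    exact Nat.pow_le_pow_right (by norm_num) hℓ
  rw [refine, forEach_val]
  have key : ∀ (l : List (ℕ × ℕ × ℕ)) (s' : Store) (A : Set (ℕ × ℕ × ℕ)), (∀ t ∈ l, t ∈ P) →
      s'.Inv S.n (ℓ + 1) A →
      (l.foldl (fun s' t => (do
        let out ← ruledOut (h ℓ) (Y ℓ) t.1 t.2.1 t.2.2 (S.reps ℓ)
        if out then pure s' else addChildren S.n (ℓ + 1) t s' : Timed Store).val) s').Inv S.n
        (ℓ + 1) (A ∪ {u | ∃ t ∈ l, ¬ RuledOut (h ℓ) (Y ℓ) (S.reps ℓ) t ∧ u ∈ children t}) := by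
    intro l
    induction l with
    | nil =>
      intro s' A _ hs'
      simpa using hs'
    | cons t l ih =>
      intro s' A hl hs'
      have hl' : ∀ t ∈ l, t ∈ P := fun u hu => hl u (List.mem_cons_of_mem _ hu)
      have htP := hP (hl t (List.mem_cons_self))
      rw [List.foldl_cons]
      by_cases hr : RuledOut (h ℓ) (Y ℓ) (S.reps ℓ) t
      · have hv := (ruledOut_val (h ℓ) (Y ℓ) (S.reps ℓ) t).2 hr
        simp only [bind_val, hv, if_true, pure_val]
        have hset : {u | ∃ x ∈ t :: l, ¬ RuledOut (h ℓ) (Y ℓ) (S.reps ℓ) x ∧ u ∈ children x}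
            = {u | ∃ x ∈ l, ¬ RuledOut (h ℓ) (Y ℓ) (S.reps ℓ) x ∧ u ∈ children x} := by
          ext u
          simp [hr]
        rw [hset]
        exact ih s' A hl' hs'
      · have hv : ¬ (ruledOut (h ℓ) (Y ℓ) t.1 t.2.1 t.2.2 (S.reps ℓ)).val = true :=
          fun h' => hr ((ruledOut_val (h ℓ) (Y ℓ) (S.reps ℓ) t).1 h')
        simp only [bind_val, hv, Bool.false_eq_true, if_false]
        have hset : A ∪ {u | ∃ x ∈ t :: l, ¬ RuledOut (h ℓ) (Y ℓ) (S.reps ℓ) x ∧ u ∈ children x}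
            = A ∪ children t
              ∪ {u | ∃ x ∈ l, ¬ RuledOut (h ℓ) (Y ℓ) (S.reps ℓ) x ∧ u ∈ children x} := by
          ext u
          simp [hr, or_assoc]
        rw [hset]
        exact ih _ _ hl' (addChildren_inv htP hg hs')
  have h0 : Store.Inv S.n (ℓ + 1) ⟨s.mark, []⟩ ∅ := by
    refine ⟨fun ℓ' hℓ' => hF ℓ' (by omega), ⟨List.nodup_nil, by simp⟩, ?_⟩
    intro a ha b hb c hc
    simp [hF (ℓ + 1) (Nat.lt_succ_self ℓ) a ha b hb c hc]
  convert key s.pd _ ∅ (fun t ht => (hL.2 t).1 ht) h0 using 1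
  ext u
  have := hL.2
  simp only [Finset.mem_coe] at this
  simp [mem_survivors, this, and_assoc]

lemma refine_steps_le (S : Scheme) (h : ℕ → ℕ → ℕ → ℕ) (Y : ℕ → ℕ → ℕ → Bool) (ℓ : ℕ) (s : Store) :
    (refine S h Y ℓ s).steps ≤ s.pd.length * (8 * S.reps ℓ + 30006) + 1 := by
  refine (forEach_steps_le _ (8 * S.reps ℓ + 30001) s.pd _ ?_).trans ?_
  · intro t s'
    have h1 := ruledOut_steps_le (h ℓ) (Y ℓ) t.1 t.2.1 t.2.2 (S.reps ℓ)
    have h2 := addChildren_steps_le S.n (ℓ + 1) t s'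
    simp only [bind_steps]
    split_ifs
    · simp only [pure_steps]
      omega
    · omega
  · exact le_of_eq (by ring)

/-- The store after `d` rounds of refinement. -/
lemma refine_loop_spec (S : Scheme) (h : ℕ → ℕ → ℕ → ℕ) (Y : ℕ → ℕ → ℕ → Bool) (d : ℕ)
    (hd : S.lMin + d ≤ S.L) (s : Store) (hF : s.Fresh S.n S.lMin)
    (hL : s.Lists (increasing (3 ^ S.lMin))) :
    (forLoop (fun i s => do
      let ℓ ← op (S.lMin + i)
      refine S h Y ℓ s) d s).val.Fresh S.n (S.lMin + d) ∧
    (forLoop (fun i s => do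
      let ℓ ← op (S.lMin + i)
      refine S h Y ℓ s) d s).val.Lists (possible S h Y d) := by
  apply forLoop_induct _ (fun i (s : Store) => s.Fresh S.n (S.lMin + i) ∧
    s.Lists (possible S h Y i))
  · exact ⟨hF, hL⟩
  · rintro i hi s ⟨h1, h2⟩
    have := refine_spec S h Y (S.lMin + i) (by omega) (possible_subset S h Y i) h1 h2
    exact ⟨this.fresh, this.lists⟩

lemma Store.Lists.length_eq {s : Store} {P : Finset (ℕ × ℕ × ℕ)} (h : s.Lists P) :
    s.pd.length = P.card := by
  rw [← List.toFinset_card_of_nodup h.1]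
  congr 1
  ext t
  simpa using h.2 t

lemma forLoop_pow_three (m : ℕ) : (forLoop (fun _ g => op (3 * g)) m 1).val = 3 ^ m := by
  induction m with
  | zero => rfl
  | succ m ih => rw [forLoop_succ_val, ih, op_val, pow_succ']

lemma mem_decode (S : Scheme) (h : ℕ → ℕ → ℕ → ℕ) (Y : ℕ → ℕ → ℕ → Bool) (hS : S.lMin ≤ S.L)
    (t : ℕ × ℕ × ℕ) : t ∈ (decode S h Y).val ↔
      t ∈ survivors (h S.L) (Y S.L) (S.reps S.L) (possible S h Y (S.L - S.lMin)) := by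
  have hF : Store.Fresh S.n S.lMin ⟨fun _ => false, (allTriples (3 ^ S.lMin)).val⟩ :=
    fun _ _ _ _ _ _ _ _ => rfl
  have hspec := (refine_loop_spec S h Y (S.L - S.lMin) (by omega) _ hF
    (allTriples_lists (3 ^ S.lMin) _)).2
  simp only [decode, bind_val, op_val, forLoop_pow_three, forEach_val]
  have key : ∀ (l res : List (ℕ × ℕ × ℕ)), t ∈ l.foldl (fun res t => (do
        let out ← ruledOut (h S.L) (Y S.L) t.1 t.2.1 t.2.2 (S.reps S.L)
        if out then pure res else ops 4 (t :: res) : Timed (List (ℕ × ℕ × ℕ))).val) res ↔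
      t ∈ res ∨ t ∈ l ∧ ¬ RuledOut (h S.L) (Y S.L) (S.reps S.L) t := by
    intro l
    induction l with
    | nil => simp
    | cons u l ih =>
      intro res
      rw [List.foldl_cons, ih]
      by_cases hr : RuledOut (h S.L) (Y S.L) (S.reps S.L) u
      · have hv := (ruledOut_val (h S.L) (Y S.L) (S.reps S.L) u).2 hr
        simp only [bind_val, hv, if_true, pure_val, List.mem_cons]
        have : t = u → RuledOut (h S.L) (Y S.L) (S.reps S.L) t := fun h' => h' ▸ hr
        tauto
      · have hv : ¬ (ruledOut (h S.L) (Y S.L) u.1 u.2.1 u.2.2 (S.reps S.L)).val = true :=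
          fun h' => hr ((ruledOut_val (h S.L) (Y S.L) (S.reps S.L) u).1 h')
        simp only [bind_val, hv, Bool.false_eq_true, if_false, ops_val, List.mem_cons]
        have : t = u → ¬ RuledOut (h S.L) (Y S.L) (S.reps S.L) t := fun h' => h' ▸ hr
        tauto
  have := hspec.2 t
  simp only [Finset.mem_coe] at this
  rw [mem_survivors, ← this]
  simpa using key _ []

lemma decode_steps_le (S : Scheme) (h : ℕ → ℕ → ℕ → ℕ) (Y : ℕ → ℕ → ℕ → Bool)
    (hS : S.lMin ≤ S.L) : (decode S h Y).steps ≤ 3 * S.lMin + 13 * (3 ^ S.lMin) ^ 3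
      + ∑ d ∈ Finset.range (S.L - S.lMin),
        ((possible S h Y d).card * (8 * S.reps (S.lMin + d) + 30006) + 4)
      + (possible S h Y (S.L - S.lMin)).card * (8 * S.reps S.L + 10) + 4 := by
  have hF : Store.Fresh S.n S.lMin ⟨fun _ => false, (allTriples (3 ^ S.lMin)).val⟩ :=
    fun _ _ _ _ _ _ _ _ => rfl
  have hspec : ∀ d ≤ S.L - S.lMin, _ := fun d hd => (refine_loop_spec S h Y d (by omega) _ hF
    (allTriples_lists (3 ^ S.lMin) _)).2.length_eq
  simp only [decode, bind_steps, op_val, op_steps, forLoop_pow_three]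
  have h1 := forLoop_steps_le (fun _ g => op (3 * g)) S.lMin 1 1 (by simp)
  have h2 := allTriples_steps_le (g := 3 ^ S.lMin) (Nat.one_le_pow _ _ (by norm_num))
  have h3 : (forLoop (fun i s => do
      let ℓ ← op (S.lMin + i)
      refine S h Y ℓ s) (S.L - S.lMin)
        ⟨fun _ => false, (allTriples (3 ^ S.lMin)).val⟩).steps
      ≤ ∑ d ∈ Finset.range (S.L - S.lMin),
        ((possible S h Y d).card * (8 * S.reps (S.lMin + d) + 30006) + 4) + 1 := by
    rw [forLoop_steps]
    apply Nat.add_le_add_right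
    apply Finset.sum_le_sum
    intro d hd
    rw [← hspec d (Finset.mem_range.1 hd).le]
    have := refine_steps_le S h Y (S.lMin + d) (forLoop (fun i s => do
      let ℓ ← op (S.lMin + i)
      refine S h Y ℓ s) d ⟨fun _ => false, (allTriples (3 ^ S.lMin)).val⟩).val
    simp only [bind_steps, op_steps, op_val]
    omega
  have h4 := forEach_steps_le (fun t res => do
      let out ← ruledOut (h S.L) (Y S.L) t.1 t.2.1 t.2.2 (S.reps S.L)
      if out then pure res else ops 4 (t :: res)) (8 * S.reps S.L + 5)
    (forLoop (fun i s => do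
      let ℓ ← op (S.lMin + i)
      refine S h Y ℓ s) (S.L - S.lMin)
        ⟨fun _ => false, (allTriples (3 ^ S.lMin)).val⟩).val.pd [] (by
      intro t res
      have h1 := ruledOut_steps_le (h S.L) (Y S.L) t.1 t.2.1 t.2.2 (S.reps S.L)
      simp only [bind_steps]
      split_ifs
      · simp only [pure_steps]
        omega
      · simp only [ops_steps]
        omega)
  rw [hspec _ le_rfl] at h4
  have h5 : 5 + (8 * S.reps S.L + 5) = 8 * S.reps S.L + 10 := by ring
  rw [h5] at h4
  omega

end HyperLearn

namespace HyperLearn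

open Timed

/-! ### Blocks, triples of blocks and negative tests -/

/-- `y` is one of the three entries of `t`. -/
def InTriple (t : ℕ × ℕ × ℕ) (y : ℕ) : Prop := y = t.1 ∨ y = t.2.1 ∨ y = t.2.2

lemma exists_increasing_superset {g : ℕ} (hg : 3 ≤ g) {s : Finset ℕ} (hs : ∀ y ∈ s, y < g)
    (hcard : s.card ≤ 3) : ∃ t ∈ increasing g, ∀ y ∈ s, InTriple t y := by
  have hsub : s ⊆ Finset.range g := fun y hy => Finset.mem_range.2 (hs y hy)
  obtain ⟨u, hsu, hu, hu3⟩ := Finset.exists_subsuperset_card_eq hsub hcard (by simpa using hg)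
  set f := u.orderEmbOfFin hu3
  have hf : ∀ i, f i ∈ u := fun i => Finset.orderEmbOfFin_mem u hu3 i
  refine ⟨(f 0, f 1, f 2), ?_, ?_⟩
  · rw [mem_increasing]
    exact ⟨f.strictMono (by decide), f.strictMono (by decide), Finset.mem_range.1 (hu (hf 2))⟩
  · intro y hy
    have : y ∈ Set.range f := by
      rw [Finset.range_orderEmbOfFin]
      exact hsu hy
    obtain ⟨i, rfl⟩ := this
    fin_cases i
    · exact Or.inl rfl
    · exact Or.inr (Or.inl rfl)
    · exact Or.inr (Or.inr rfl)

lemma exists_childOf_eq {t : ℕ × ℕ × ℕ} {y : ℕ} (h : InTriple t (y / 3)) :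
    ∃ x < 9, childOf t x = y := by
  rcases h with h | h | h
  · refine ⟨y % 3, by omega, ?_⟩
    have : y % 3 / 3 = 0 := by omega
    simp only [childOf, this, if_true]
    omega
  · refine ⟨3 + y % 3, by omega, ?_⟩
    have : (3 + y % 3) / 3 = 1 := by omega
    simp only [childOf, this, if_true]
    norm_num
    omega
  · refine ⟨6 + y % 3, by omega, ?_⟩
    have : (6 + y % 3) / 3 = 2 := by omega
    simp only [childOf, this]
    norm_num
    omega

namespace Scheme

variable (S : Scheme)

lemma block_lt {ℓ : ℕ} (hℓ : ℓ ≤ S.L) (v : Fin S.n) : S.block ℓ v < 3 ^ ℓ := by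
  unfold block
  apply Nat.div_lt_of_lt_mul
  rw [← pow_add, Nat.sub_add_cancel hℓ]
  exact v.2

lemma block_succ_div {ℓ : ℕ} (hℓ : ℓ < S.L) (v : Fin S.n) :
    S.block (ℓ + 1) v / 3 = S.block ℓ v := by
  unfold block
  rw [Nat.div_div_eq_div_mul, ← pow_succ]
  congr 2
  omega

lemma block_last (v : Fin S.n) : S.block S.L v = v := by
  simp [block]

/-- The set of the blocks of level `ℓ` that meet `e`. -/
def blocks (ℓ : ℕ) (e : Finset (Fin S.n)) : Finset (Fin (3 ^ ℓ)) :=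
  Finset.univ.filter fun x => ∃ v ∈ e, S.block ℓ v = x

end Scheme

/-- The blocks of the triple `t`, as a set of blocks of level `ℓ`. -/
def tripleSet (ℓ : ℕ) (t : ℕ × ℕ × ℕ) : Finset (Fin (3 ^ ℓ)) :=
  Finset.univ.filter fun x => (x : ℕ) = t.1 ∨ (x : ℕ) = t.2.1 ∨ (x : ℕ) = t.2.2

lemma mem_tripleSet {ℓ : ℕ} {t : ℕ × ℕ × ℕ} {x : Fin (3 ^ ℓ)} :
    x ∈ tripleSet ℓ t ↔ InTriple t x := by
  simp [tripleSet, InTriple]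

lemma tripleSet_eq {ℓ : ℕ} {t : ℕ × ℕ × ℕ} (h1 : t.1 < 3 ^ ℓ) (h2 : t.2.1 < 3 ^ ℓ)
    (h3 : t.2.2 < 3 ^ ℓ) : tripleSet ℓ t = {⟨t.1, h1⟩, ⟨t.2.1, h2⟩, ⟨t.2.2, h3⟩} := by
  ext x
  simp [mem_tripleSet, InTriple, Fin.ext_iff]

lemma card_tripleSet {ℓ : ℕ} {t : ℕ × ℕ × ℕ} (ht : t ∈ increasing (3 ^ ℓ)) :
    (tripleSet ℓ t).card = 3 := by
  rw [mem_increasing] at ht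
  rw [tripleSet_eq (by omega) (by omega) (by omega)]
  apply Finset.card_eq_three.2
  refine ⟨_, _, _, ?_, ?_, ?_, rfl⟩
  all_goals
    simp only [ne_eq, Fin.mk.injEq]
    omega

variable {S : Scheme}

lemma blocks_subset_tripleSet_iff {ℓ : ℕ} (hℓ : ℓ ≤ S.L) {e : Finset (Fin S.n)}
    {t : ℕ × ℕ × ℕ} :
    S.blocks ℓ e ⊆ tripleSet ℓ t ↔ ∀ v ∈ e, InTriple t (S.block ℓ v) := by
  constructor
  · intro h v hv
    exact mem_tripleSet.1 (h (x := ⟨S.block ℓ v, S.block_lt hℓ v⟩)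
      (Finset.mem_filter.2 ⟨Finset.mem_univ _, v, hv, rfl⟩))
  · intro h x hx
    obtain ⟨-, v, hv, hvx⟩ := Finset.mem_filter.1 hx
    rw [mem_tripleSet, ← hvx]
    exact h v hv

/-- The part of the design at level `ℓ`. -/
def Scheme.levelPart (h : S.Design) {ℓ : ℕ} (hℓ : ℓ ≤ S.L) :
    Fin (S.reps ℓ) → Fin (3 ^ ℓ) → Fin S.width :=
  fun r j => h ⟨⟨ℓ, Nat.lt_succ_of_le hℓ⟩, r, j⟩

lemma assign_eq (h : S.Design) {ℓ : ℕ} (hℓ : ℓ ≤ S.L) (r : Fin (S.reps ℓ)) (j : Fin (3 ^ ℓ)) :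
    Scheme.assign h ℓ r j = Scheme.levelPart h hℓ r j := by
  simp [Scheme.assign, Scheme.levelPart, Nat.lt_succ_of_le hℓ]

lemma outcomes_eq_false_iff (F : Finset (Finset (Fin S.n))) (h : S.Design) (ℓ r t : ℕ) :
    outcomes (F : Set (Finset (Fin S.n))) h ℓ r t = false ↔
      ∀ e ∈ F, ∃ v ∈ e, Scheme.assign h ℓ r (S.block ℓ v) ≠ t := by
  simp only [outcomes, query, decide_eq_false_iff_not, not_exists, not_and, Finset.mem_coe,
    Finset.not_subset, Scheme.pool, Finset.mem_filter, Finset.mem_univ, true_and]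

/-- A triple is ruled out exactly when some iteration covers it by a negative test. -/
lemma ruledOut_iff_covered (F : Finset (Finset (Fin S.n))) (h : S.Design) {ℓ : ℕ} (hℓ : ℓ ≤ S.L)
    {t : ℕ × ℕ × ℕ} (ht : t ∈ increasing (3 ^ ℓ)) :
    RuledOut (Scheme.assign h ℓ) (outcomes (F : Set (Finset (Fin S.n))) h ℓ) (S.reps ℓ) t ↔
      ∃ r, Covered F (S.blocks ℓ) (tripleSet ℓ t) (Scheme.levelPart h hℓ r) := by
  rw [mem_increasing] at ht
  have h1 : t.1 < 3 ^ ℓ := by omega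
  have h2 : t.2.1 < 3 ^ ℓ := by omega
  have h3 : t.2.2 < 3 ^ ℓ := by omega
  have key : ∀ r : Fin (S.reps ℓ), (Scheme.assign h ℓ r t.1 = Scheme.assign h ℓ r t.2.1 ∧
      Scheme.assign h ℓ r t.2.1 = Scheme.assign h ℓ r t.2.2 ∧
      outcomes (F : Set (Finset (Fin S.n))) h ℓ r (Scheme.assign h ℓ r t.1) = false) ↔
      Covered F (S.blocks ℓ) (tripleSet ℓ t) (Scheme.levelPart h hℓ r) := by
    intro r
    have e1 := assign_eq h hℓ r ⟨t.1, h1⟩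
    have e2 := assign_eq h hℓ r ⟨t.2.1, h2⟩
    have e3 := assign_eq h hℓ r ⟨t.2.2, h3⟩
    have eb : ∀ v : Fin S.n, Scheme.assign h ℓ r (S.block ℓ v)
        = Scheme.levelPart h hℓ r ⟨S.block ℓ v, S.block_lt hℓ v⟩ :=
      fun v => assign_eq h hℓ r ⟨S.block ℓ v, S.block_lt hℓ v⟩
    simp only at e1 e2 e3
    rw [outcomes_eq_false_iff, e1, e2, e3]
    simp only [eb, Fin.val_inj, ne_eq]
    set f := Scheme.levelPart h hℓ r
    rw [tripleSet_eq h1 h2 h3]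
    set a : Fin (3 ^ ℓ) := ⟨t.1, h1⟩
    set b : Fin (3 ^ ℓ) := ⟨t.2.1, h2⟩
    set c : Fin (3 ^ ℓ) := ⟨t.2.2, h3⟩
    have hmono : Mono f {a, b, c} ↔ f a = f b ∧ f b = f c := by
      simp only [Mono, Finset.mem_insert, Finset.mem_singleton]
      constructor
      · intro hM
        exact ⟨hM a (by simp) b (by simp), hM b (by simp) c (by simp)⟩
      · rintro ⟨hab, hbc⟩ i (rfl | rfl | rfl) j (rfl | rfl | rfl) <;> simp_all
    have hmem : ∀ e : Finset (Fin S.n), ∀ v ∈ e,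
        (⟨S.block ℓ v, S.block_lt hℓ v⟩ : Fin (3 ^ ℓ)) ∈ S.blocks ℓ e := fun e v hv =>
      Finset.mem_filter.2 ⟨Finset.mem_univ _, v, hv, rfl⟩
    unfold Covered
    rw [hmono, and_assoc]
    refine and_congr_right fun hab => and_congr_right fun hbc => forall₂_congr fun e _ => ?_
    constructor
    · rintro ⟨v, hv, hne⟩ hM
      exact hne (hM _ (Finset.mem_union_right _ (hmem e v hv)) a
        (Finset.mem_union_left _ (by simp)))
    · intro hM
      by_contra hcon
      push Not at hcon
      apply hM
      have hall : ∀ i ∈ ({a, b, c} : Finset (Fin (3 ^ ℓ))) ∪ S.blocks ℓ e, f i = f a := by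
        intro i hi
        rcases Finset.mem_union.1 hi with hi | hi
        · exact hmono.2 ⟨hab, hbc⟩ i hi a (by simp)
        · obtain ⟨-, v, hv, hvi⟩ := Finset.mem_filter.1 hi
          have : i = ⟨S.block ℓ v, S.block_lt hℓ v⟩ := Fin.ext hvi.symm
          rw [this]
          exact hcon v hv
      intro i hi j hj
      rw [hall i hi, hall j hj]
  constructor
  · rintro ⟨r, hr, hrest⟩
    exact ⟨⟨r, hr⟩, (key ⟨r, hr⟩).1 hrest⟩
  · rintro ⟨r, hr⟩
    exact ⟨r, r.2, (key r).2 hr⟩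

/-- The triple `t` of blocks of level `ℓ` contains a hyperedge. -/
def Defective (F : Finset (Finset (Fin S.n))) (ℓ : ℕ) (t : ℕ × ℕ × ℕ) : Prop :=
  ∃ e ∈ F, S.blocks ℓ e ⊆ tripleSet ℓ t

lemma Defective.not_ruledOut {F : Finset (Finset (Fin S.n))} {ℓ : ℕ} (hℓ : ℓ ≤ S.L)
    {t : ℕ × ℕ × ℕ} (ht : t ∈ increasing (3 ^ ℓ)) (hd : Defective F ℓ t) (h : S.Design) :
    ¬ RuledOut (Scheme.assign h ℓ) (outcomes (F : Set (Finset (Fin S.n))) h ℓ) (S.reps ℓ) t := by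
  rw [ruledOut_iff_covered F h hℓ ht]
  rintro ⟨r, hM, hall⟩
  obtain ⟨e, he, hsub⟩ := hd
  apply hall e he
  rwa [Finset.union_eq_left.2 hsub]

/-! ### Correctness of the decoder -/

/-- The decoder's set of possibly defective triples at level `S.lMin + d`. -/
noncomputable def pd (F : Finset (Finset (Fin S.n))) (h : S.Design) (d : ℕ) :
    Finset (ℕ × ℕ × ℕ) :=
  possible S (Scheme.assign h) (outcomes (F : Set (Finset (Fin S.n))) h) d

/-- The triples of `pd F h d` that are not ruled out. -/
noncomputable def kept (F : Finset (Finset (Fin S.n))) (h : S.Design) (d : ℕ) :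
    Finset (ℕ × ℕ × ℕ) :=
  survivors (Scheme.assign h (S.lMin + d)) (outcomes (F : Set (Finset (Fin S.n))) h (S.lMin + d))
    (S.reps (S.lMin + d)) (pd F h d)

lemma pd_subset (F : Finset (Finset (Fin S.n))) (h : S.Design) (d : ℕ) :
    pd F h d ⊆ increasing (3 ^ (S.lMin + d)) :=
  possible_subset S _ _ d

lemma pd_succ (F : Finset (Finset (Fin S.n))) (h : S.Design) (d : ℕ) :
    pd F h (d + 1) = (kept F h d).biUnion children := rfl

lemma card_pd_succ_le (F : Finset (Finset (Fin S.n))) (h : S.Design) (d : ℕ) :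
    (pd F h (d + 1)).card ≤ 729 * (kept F h d).card :=
  card_possible_succ_le S _ _ d

/-- No hyperedge is ever lost, even if two or three of its vertices share a block: some triple of
blocks in the current set contains it. -/
lemma exists_mem_pd (F : Finset (Finset (Fin S.n))) (h : S.Design) (hmin : 1 ≤ S.lMin) {d : ℕ}
    (hd : S.lMin + d ≤ S.L) {e : Finset (Fin S.n)} (he : e ∈ F) (hcard : e.card ≤ 3) :
    ∃ t ∈ kept F h d, ∀ v ∈ e, InTriple t (S.block (S.lMin + d) v) := by
  suffices hpd : ∃ t ∈ pd F h d, ∀ v ∈ e, InTriple t (S.block (S.lMin + d) v) by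
    obtain ⟨t, ht, hv⟩ := hpd
    have hinc := pd_subset F h d ht
    exact ⟨t, mem_survivors.2 ⟨ht, Defective.not_ruledOut hd hinc
      ⟨e, he, (blocks_subset_tripleSet_iff hd).2 hv⟩ h⟩, hv⟩
  induction d with
  | zero =>
    obtain ⟨t, ht, hs⟩ := exists_increasing_superset (g := 3 ^ S.lMin)
      (s := e.image (S.block S.lMin)) (Nat.le_self_pow (by omega) 3) (by
        intro y hy
        obtain ⟨v, -, rfl⟩ := Finset.mem_image.1 hy
        exact S.block_lt hd v) (Finset.card_image_le.trans hcard)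
    exact ⟨t, ht, fun v hv => hs _ (Finset.mem_image_of_mem _ hv)⟩
  | succ d ih =>
    obtain ⟨t, ht, hv⟩ := ih (by omega)
    have hinc := pd_subset F h d ht
    have hkept : t ∈ kept F h d := mem_survivors.2 ⟨ht, Defective.not_ruledOut (by omega) hinc
      ⟨e, he, (blocks_subset_tripleSet_iff (by omega)).2 hv⟩ h⟩
    have hchild : ∀ v, v ∈ e → ∃ x < 9, childOf t x = S.block (S.lMin + (d + 1)) v := by
      intro v hve
      apply exists_childOf_eq
      rw [← add_assoc, S.block_succ_div (by omega)]
      exact hv v hve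
    choose! x hx9 hx using hchild
    obtain ⟨p, hp, hs⟩ := exists_increasing_superset (g := 9) (s := e.image x) (by norm_num) (by
        intro y hy
        obtain ⟨v, hve, rfl⟩ := Finset.mem_image.1 hy
        exact hx9 v hve) (Finset.card_image_le.trans hcard)
    refine ⟨childTriple t p, ?_, ?_⟩
    · rw [pd_succ]
      exact Finset.mem_biUnion.2 ⟨t, hkept, Finset.mem_image_of_mem _ hp⟩
    · intro v hve
      rw [← hx v hve]
      rcases hs _ (Finset.mem_image_of_mem x hve) with h' | h' | h'
      · exact Or.inl (by rw [h']; rfl)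
      · exact Or.inr (Or.inl (by rw [h']; rfl))
      · exact Or.inr (Or.inr (by rw [h']; rfl))

lemma mem_estimate_iff (F : Finset (Finset (Fin S.n))) (h : S.Design) (hS : S.lMin ≤ S.L)
    (e : Finset (Fin S.n)) :
    e ∈ estimate (F : Set (Finset (Fin S.n))) h ↔
      ∃ t ∈ kept F h (S.L - S.lMin), e.map Fin.valEmbedding = {t.1, t.2.1, t.2.2} := by
  have hL : S.lMin + (S.L - S.lMin) = S.L := by omega
  simp only [estimate, edgeSet, run, Set.mem_ofPred_eq, mem_decode _ _ _ hS, kept, hL]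
  rfl

lemma inTriple_iff {t : ℕ × ℕ × ℕ} {y : ℕ} :
    InTriple t y ↔ y ∈ ({t.1, t.2.1, t.2.2} : Finset ℕ) := by
  simp [InTriple]

lemma card_of_mem_increasing {g : ℕ} {t : ℕ × ℕ × ℕ} (ht : t ∈ increasing g) :
    ({t.1, t.2.1, t.2.2} : Finset ℕ).card = 3 := by
  rw [mem_increasing] at ht
  exact Finset.card_eq_three.2 ⟨_, _, _, by omega, by omega, by omega, rfl⟩

lemma map_eq_of_subset {g n : ℕ} {t : ℕ × ℕ × ℕ} (ht : t ∈ increasing g) {e : Finset (Fin n)}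
    (he : e.card = 3) (h : ∀ v ∈ e, InTriple t v) :
    e.map Fin.valEmbedding = {t.1, t.2.1, t.2.2} := by
  apply Finset.eq_of_subset_of_card_le
  · intro y hy
    obtain ⟨v, hv, rfl⟩ := Finset.mem_map.1 hy
    exact inTriple_iff.1 (h v hv)
  · rw [card_of_mem_increasing ht, Finset.card_map, he]

/-- The decoder is exact as soon as every triple of vertices that is not a hyperedge is covered by
a negative test of the finest level. -/
lemma estimate_eq (F : Finset (Finset (Fin S.n))) (h : S.Design) (hS : S.lMin ≤ S.L)
    (hmin : 1 ≤ S.lMin) (hF : ∀ e ∈ F, e.card = 3)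
    (hcov : ∀ t ∈ increasing (3 ^ S.L), ¬ Defective F S.L t →
      ∃ r, Covered F (S.blocks S.L) (tripleSet S.L t) (Scheme.levelPart h le_rfl r)) :
    estimate (F : Set (Finset (Fin S.n))) h = F := by
  have hL : S.lMin + (S.L - S.lMin) = S.L := by omega
  ext e
  rw [mem_estimate_iff F h hS]
  constructor
  · rintro ⟨t, ht, hte⟩
    obtain ⟨htpd, hnot⟩ := mem_survivors.1 ht
    have hinc := pd_subset F h _ htpd
    rw [hL] at hinc hnot
    have hdef : Defective F S.L t := by
      by_contra hd
      exact hnot ((ruledOut_iff_covered F h le_rfl hinc).2 (hcov t hinc hd))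
    obtain ⟨e', he', hsub⟩ := hdef
    rw [blocks_subset_tripleSet_iff le_rfl] at hsub
    have := map_eq_of_subset hinc (hF e' he') (fun v hv => by
      have := hsub v hv
      rwa [S.block_last] at this)
    rw [← hte] at this
    have := Finset.map_injective _ this
    rwa [← this]
  · intro he
    obtain ⟨t, ht, hv⟩ := exists_mem_pd F h hmin hL.le he (hF e he).le
    refine ⟨t, ht, map_eq_of_subset (pd_subset F h _ (mem_survivors.1 ht).1) (hF e he) ?_⟩
    intro v hve
    have := hv v hve
    rwa [hL, S.block_last] at this

end HyperLearn

namespace HyperLearn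

open Timed

variable {S : Scheme}

/-! ### The decoder under a random design, for a fixed hypergraph -/

instance [NeZero S.width] : Nonempty S.Design := ⟨fun _ => 0⟩

/-- Resampling the design at one level: `ρ h k` is `h` with level `ℓ` replaced by `k`. -/
lemma exists_resample [NeZero S.width] {ℓ : ℕ} (hℓ : ℓ ≤ S.L) :
    ∃ ρ : S.Design → (Fin (S.reps ℓ) → Fin (3 ^ ℓ) → Fin S.width) → S.Design,
      (∀ h k, Scheme.levelPart (ρ h k) hℓ = k) ∧
      (∀ h k, ∀ ℓ' ≠ ℓ, Scheme.assign (ρ h k) ℓ' = Scheme.assign h ℓ') ∧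
      ∀ f : S.Design → ℝ, mean f = mean fun h => mean fun k => f (ρ h k) := by
  classical
  let i : Fin (S.L + 1) := ⟨ℓ, Nat.lt_succ_of_le hℓ⟩
  let W : Fin (S.L + 1) → Type := fun j => Fin (S.reps j) × Fin (3 ^ (j : ℕ)) → Fin S.width
  let e₁ : S.Design ≃ ∀ j, W j :=
    { toFun := fun h j x => h ⟨j, x⟩
      invFun := fun h x => h x.1 x.2
      left_inv := fun _ => rfl
      right_inv := fun _ => rfl }
  let e₂ := Equiv.piSplitAt i W
  let e₃ : W i ≃ (Fin (S.reps ℓ) → Fin (3 ^ ℓ) → Fin S.width) := Equiv.curry _ _ _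
  let e := (e₁.trans e₂).trans (Equiv.prodCongr e₃ (Equiv.refl (∀ j : {j // j ≠ i}, W j)))
  have hO : Nonempty (∀ j : {j // j ≠ i}, W j) := ⟨fun _ _ => 0⟩
  have hval : ∀ k o, ∀ x : (Σ ℓ : Fin (S.L + 1), Fin (S.reps ℓ) × Fin (3 ^ (ℓ : ℕ))),
      (hx : x.1 ≠ i) → e.symm (k, o) x = o ⟨x.1, hx⟩ x.2 := by
    intro k o x hx
    change (Equiv.piSplitAt i W).symm (e₃.symm k, o) x.1 x.2 = _
    rw [Equiv.piSplitAt_symm_apply, dif_neg hx]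
  refine ⟨fun h k => e.symm (k, (e h).2), ?_, ?_, ?_⟩
  · intro h k
    ext r j
    change ((Equiv.piSplitAt i W).symm (e₃.symm k, (e h).2) i (r, j) : ℕ) = _
    rw [Equiv.piSplitAt_symm_apply, dif_pos rfl]
    rfl
  · intro h k ℓ' hne
    ext r j
    unfold Scheme.assign
    split_ifs with h1 h2 h3
    · have hx : (⟨ℓ', h1⟩ : Fin (S.L + 1)) ≠ i := fun hcon => hne (congrArg Fin.val hcon)
      have h4 := hval k (e h).2 ⟨⟨ℓ', h1⟩, ⟨r, h2⟩, ⟨j, h3⟩⟩ hx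
      have h5 := hval (e h).1 (e h).2 ⟨⟨ℓ', h1⟩, ⟨r, h2⟩, ⟨j, h3⟩⟩ hx
      rw [Prod.mk.eta, Equiv.symm_apply_apply] at h5
      exact congrArg Fin.val (h4.trans h5.symm)
    all_goals rfl
  · intro f
    rw [← mean_equiv e f, mean_prod]
    rw [← mean_equiv e (fun h => mean fun k => f (e.symm (k, (e h).2))), mean_prod]
    congr 1
    ext o
    simp only [Equiv.apply_symm_apply]
    rw [mean_const]

lemma outcomes_congr (F : Finset (Finset (Fin S.n))) {h h' : S.Design} {ℓ : ℕ}
    (hh : Scheme.assign h ℓ = Scheme.assign h' ℓ) :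
    outcomes (F : Set (Finset (Fin S.n))) h ℓ = outcomes (F : Set (Finset (Fin S.n))) h' ℓ := by
  ext r t
  simp only [outcomes, Scheme.pool, hh]

/-- The triples of level `ℓ` depend on the coarser levels of the design only. -/
lemma pd_congr (F : Finset (Finset (Fin S.n))) {h h' : S.Design} {d : ℕ}
    (hh : ∀ ℓ < S.lMin + d, Scheme.assign h ℓ = Scheme.assign h' ℓ) : pd F h d = pd F h' d := by
  induction d with
  | zero => rfl
  | succ d ih =>
    have h1 := hh (S.lMin + d) (by omega)
    rw [pd_succ, pd_succ, kept, kept, ih fun ℓ hℓ => hh ℓ (by omega), h1, outcomes_congr F h1]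

open Classical in
/-- The defective triples of level `ℓ`. -/
noncomputable def defectives (F : Finset (Finset (Fin S.n))) (ℓ : ℕ) : Finset (ℕ × ℕ × ℕ) :=
  (increasing (3 ^ ℓ)).filter fun t => Defective F ℓ t

/-- For each non-defective triple of level `ℓ`, the expected number of hyperedges that are
completed by the blocks joining the triple in a test is at most `9 / 10`. -/
def Sparse (F : Finset (Finset (Fin S.n))) (ℓ : ℕ) : Prop :=
  ∀ t ∈ increasing (3 ^ ℓ), ¬ Defective F ℓ t →
    ∑ e ∈ F, (1 / (S.width : ℝ)) ^ (S.blocks ℓ e \ tripleSet ℓ t).card ≤ 9 / 10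

lemma Sparse.le_frac_covered [NeZero S.width] {F : Finset (Finset (Fin S.n))} {ℓ : ℕ}
    (hF : Sparse F ℓ) {t : ℕ × ℕ × ℕ} (ht : t ∈ increasing (3 ^ ℓ)) (hd : ¬ Defective F ℓ t) :
    1 / 10 * (1 / (S.width : ℝ)) ^ 2 ≤
      frac (fun f : Fin (3 ^ ℓ) → Fin S.width => Covered F (S.blocks ℓ) (tripleSet ℓ t) f) := by
  refine le_trans (le_of_eq ?_) (HyperLearn.le_frac_covered F (S.blocks ℓ) (card_tripleSet ht)
    (hF t ht hd))
  norm_num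

open Classical in
/-- The non-defective triples of `pd F h d`. -/
noncomputable def nondefectives (F : Finset (Finset (Fin S.n))) (h : S.Design) (d : ℕ) :
    Finset (ℕ × ℕ × ℕ) :=
  (pd F h d).filter fun t => ¬ Defective F (S.lMin + d) t

lemma card_nondefectives_le (F : Finset (Finset (Fin S.n))) (h : S.Design) (d : ℕ) :
    (nondefectives F h d).card ≤ (pd F h d).card := by
  classical
  exact Finset.card_filter_le _ _

lemma mem_nondefectives {F : Finset (Finset (Fin S.n))} {h : S.Design} {d : ℕ} {t : ℕ × ℕ × ℕ} :
    t ∈ nondefectives F h d ↔ t ∈ pd F h d ∧ ¬ Defective F (S.lMin + d) t := by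
  simp [nondefectives]

lemma card_kept_le (F : Finset (Finset (Fin S.n))) (h : S.Design) {d : ℕ}
    (hd : S.lMin + d ≤ S.L) :
    (kept F h d).card ≤ (defectives F (S.lMin + d)).card +
      missed (nondefectives F h d)
        (fun t f => Covered F (S.blocks (S.lMin + d)) (tripleSet (S.lMin + d) t) f)
        (Scheme.levelPart h hd) := by
  classical
  unfold missed
  refine (Finset.card_le_card ?_).trans (Finset.card_union_le _ _)
  intro t ht
  obtain ⟨htpd, hnot⟩ := mem_survivors.1 ht
  have hinc := pd_subset F h d htpd
  rw [Finset.mem_union]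
  by_cases hdef : Defective F (S.lMin + d) t
  · exact Or.inl (Finset.mem_filter.2 ⟨hinc, hdef⟩)
  · refine Or.inr (Finset.mem_filter.2 ⟨mem_nondefectives.2 ⟨htpd, hdef⟩, ?_⟩)
    rw [ruledOut_iff_covered F h hd hinc] at hnot
    exact not_exists.1 hnot

lemma reps_of_lt {d : ℕ} (hd : S.lMin + d < S.L) : S.reps (S.lMin + d) = S.iters := by
  unfold Scheme.reps
  rw [if_neg (by omega), if_neg (by omega)]

lemma card_filter_not_disjoint_le {ℓ : ℕ} {P : Finset (ℕ × ℕ × ℕ)} (hP : P ⊆ increasing (3 ^ ℓ))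
    (t : ℕ × ℕ × ℕ) :
    (P.filter fun u => ¬ Disjoint (tripleSet ℓ t) (tripleSet ℓ u)).card ≤ 9 * (3 ^ ℓ) ^ 2 := by
  set T : Finset ℕ := {t.1, t.2.1, t.2.2} with hT
  have hTc : T.card ≤ 3 := Finset.card_le_three
  set R := Finset.range (3 ^ ℓ) with hR
  have hsub : (P.filter fun u => ¬ Disjoint (tripleSet ℓ t) (tripleSet ℓ u)) ⊆
      T ×ˢ R ×ˢ R ∪ (R ×ˢ T ×ˢ R ∪ R ×ˢ R ×ˢ T) := by
    intro u hu
    obtain ⟨huP, hnd⟩ := Finset.mem_filter.1 hu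
    have hinc := mem_increasing.1 (hP huP)
    rw [Finset.not_disjoint_iff] at hnd
    obtain ⟨x, hxt, hxu⟩ := hnd
    rw [mem_tripleSet, inTriple_iff] at hxt
    rw [mem_tripleSet] at hxu
    have h1 : u.1 ∈ R := Finset.mem_range.2 (by omega)
    have h2 : u.2.1 ∈ R := Finset.mem_range.2 (by omega)
    have h3 : u.2.2 ∈ R := Finset.mem_range.2 (by omega)
    simp only [Finset.mem_union, Finset.mem_product]
    rcases hxu with h | h | h
    · rw [h] at hxt
      exact Or.inl ⟨hxt, h2, h3⟩
    · rw [h] at hxt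
      exact Or.inr (Or.inl ⟨h1, hxt, h3⟩)
    · rw [h] at hxt
      exact Or.inr (Or.inr ⟨h1, h2, hxt⟩)
  refine (Finset.card_le_card hsub).trans ((Finset.card_union_le _ _).trans
    (Nat.add_le_add_left (Finset.card_union_le _ _) _) |>.trans ?_)
  simp only [Finset.card_product, hR, Finset.card_range]
  nlinarith [Nat.zero_le ((3 ^ ℓ) * (3 ^ ℓ))]

/-- The expected number of possibly defective triples at a level, in terms of the level before. -/
lemma mean_card_pd_succ_le [NeZero S.width] {F : Finset (Finset (Fin S.n))} {d : ℕ}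
    (hd : S.lMin + d < S.L) (hF : Sparse F (S.lMin + d)) :
    mean (fun h : S.Design => ((pd F h (d + 1)).card : ℝ)) ≤
      729 * ((defectives F (S.lMin + d)).card + mean (fun h : S.Design => ((pd F h d).card : ℝ))
        * Real.exp (-(1 / 10 * (1 / (S.width : ℝ)) ^ 2 * S.iters))) := by
  obtain ⟨ρ, hρ₁, hρ₂, hρ₃⟩ := exists_resample (S := S) hd.le
  have hpd : ∀ h k, pd F (ρ h k) d = pd F h d := fun h k =>
    pd_congr F fun ℓ hℓ => hρ₂ h k ℓ hℓ.ne
  have hnd : ∀ h k, nondefectives F (ρ h k) d = nondefectives F h d := fun h k => by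
    simp only [nondefectives, hpd]
  set p := Real.exp (-(1 / 10 * (1 / (S.width : ℝ)) ^ 2 * S.iters)) with hp
  rw [hρ₃]
  have hstep : ∀ h : S.Design, mean (fun k => ((pd F (ρ h k) (d + 1)).card : ℝ)) ≤
      729 * ((defectives F (S.lMin + d)).card + (pd F h d).card * p) := by
    intro h
    calc mean (fun k => ((pd F (ρ h k) (d + 1)).card : ℝ))
        ≤ mean (fun k => 729 * ((defectives F (S.lMin + d)).card + (missed (nondefectives F h d)
            (fun t f => Covered F (S.blocks (S.lMin + d)) (tripleSet (S.lMin + d) t) f) k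
            : ℝ))) := by
          apply mean_mono
          intro k
          have h1 := card_pd_succ_le F (ρ h k) d
          have h2 := card_kept_le F (ρ h k) hd.le
          rw [hρ₁, hnd] at h2
          have h3 := h1.trans (Nat.mul_le_mul_left 729 h2)
          exact_mod_cast h3
      _ ≤ 729 * ((defectives F (S.lMin + d)).card + (nondefectives F h d).card * p) := by
          rw [mean_const_mul, mean_add, mean_const]
          have := mean_missed_le (nondefectives F h d) (fun t (f : Fin _ → Fin S.width) =>
            Covered F (S.blocks (S.lMin + d)) (tripleSet (S.lMin + d) t) f)
            (S.reps (S.lMin + d)) (a := 1 / 10 * (1 / (S.width : ℝ)) ^ 2) (fun t ht =>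
              hF.le_frac_covered (pd_subset F h d (mem_nondefectives.1 ht).1)
                (mem_nondefectives.1 ht).2)
          rw [show ((S.reps (S.lMin + d) : ℕ) : ℝ) = S.iters by rw [reps_of_lt hd]] at this
          linarith
      _ ≤ _ := by
          have h1 : ((nondefectives F h d).card : ℝ) ≤ (pd F h d).card := by
            exact_mod_cast card_nondefectives_le F h d
          have h2 : 0 ≤ p := (Real.exp_pos _).le
          nlinarith
  refine (mean_mono hstep).trans (le_of_eq ?_)
  rw [mean_const_mul, mean_add, mean_const]
  congr 2
  rw [mul_comm, ← mean_const_mul]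
  congr 1
  ext h
  ring

/-- The number of possibly defective triples is unlikely to grow from a level to the next one. -/
lemma frac_card_pd_succ_le [NeZero S.width] {F : Finset (Finset (Fin S.n))} {d : ℕ}
    (hd : S.lMin + d < S.L) (hF : Sparse F (S.lMin + d)) {N δ : ℝ} (hN : 0 ≤ N) (hδ : 0 < δ) :
    frac (fun h : S.Design => ((pd F h d).card : ℝ) ≤ N ∧
      729 * ((defectives F (S.lMin + d)).card
        + N * Real.exp (-(1 / 10 * (1 / (S.width : ℝ)) ^ 2 * S.iters)) + δ)
        < (pd F h (d + 1)).card)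
      ≤ (N ^ 2 * (S.iters * (1 / (S.width : ℝ)) ^ 4) + N * (9 * (3 ^ (S.lMin + d)) ^ 2))
        / δ ^ 2 := by
  classical
  obtain ⟨ρ, hρ₁, hρ₂, hρ₃⟩ := exists_resample (S := S) hd.le
  have hpd : ∀ h k, pd F (ρ h k) d = pd F h d := fun h k =>
    pd_congr F fun ℓ hℓ => hρ₂ h k ℓ hℓ.ne
  have hnd : ∀ h k, nondefectives F (ρ h k) d = nondefectives F h d := fun h k => by
    simp only [nondefectives, hpd]
  set a : ℝ := 1 / 10 * (1 / (S.width : ℝ)) ^ 2 with ha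
  rw [frac_def, hρ₃]
  refine le_trans (mean_mono (g := fun _ => (N ^ 2 * (S.iters * (1 / (S.width : ℝ)) ^ 4)
    + N * (9 * (3 ^ (S.lMin + d)) ^ 2)) / δ ^ 2) fun h => ?_) (mean_const _).le
  rw [← frac_def]
  simp only [hpd]
  have hRHS : 0 ≤ (N ^ 2 * (S.iters * (1 / (S.width : ℝ)) ^ 4)
      + N * (9 * (3 ^ (S.lMin + d)) ^ 2)) / δ ^ 2 := by positivity
  by_cases hcard : ((pd F h d).card : ℝ) ≤ N
  swap
  · refine le_trans (le_of_eq ?_) hRHS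
    rw [frac_def]
    simp [hcard, mean]
  set P := nondefectives F h d with hP
  have hPN : (P.card : ℝ) ≤ N :=
    le_trans (by exact_mod_cast card_nondefectives_le F h d) hcard
  have hPsub : P ⊆ increasing (3 ^ (S.lMin + d)) := fun t ht =>
    pd_subset F h d (mem_nondefectives.1 ht).1
  have hcheb := frac_missed_ge_le P (fun t (f : Fin _ → Fin S.width) =>
    Covered F (S.blocks (S.lMin + d)) (tripleSet (S.lMin + d) t) f) (S.reps (S.lMin + d))
    (a := a) (b := (1 / (S.width : ℝ)) ^ 4) (B := 9 * (3 ^ (S.lMin + d)) ^ 2) (δ := δ)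
    (fun t ht => hF.le_frac_covered (hPsub ht) (mem_nondefectives.1 ht).2)
    (fun t u => ¬ Disjoint (tripleSet (S.lMin + d) t) (tripleSet (S.lMin + d) u))
    (fun t ht u hu hdis => (frac_mono fun f hf => ⟨hf.1.1, hf.2.1⟩).trans
      (frac_mono_and_mono_le (not_not.1 hdis) (card_tripleSet (hPsub ht))
        (card_tripleSet (hPsub hu)))) (by positivity)
    (fun t _ => by
      have := card_filter_not_disjoint_le hPsub t
      have h' : ((P.filter fun u => ¬ Disjoint (tripleSet (S.lMin + d) t)
          (tripleSet (S.lMin + d) u)).card : ℝ) ≤ 9 * (3 ^ (S.lMin + d)) ^ 2 := by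
        exact_mod_cast this
      convert h' using 4) hδ
  rw [show ((S.reps (S.lMin + d) : ℕ) : ℝ) = S.iters by rw [reps_of_lt hd]] at hcheb
  refine (frac_mono ?_).trans (hcheb.trans ?_)
  · rintro k ⟨-, hlt⟩
    have h1 := card_pd_succ_le F (ρ h k) d
    have h2 := card_kept_le F (ρ h k) hd.le
    rw [hρ₁, hnd] at h2
    have h3 : ((pd F (ρ h k) (d + 1)).card : ℝ) ≤ 729 * ((defectives F (S.lMin + d)).card
        + (missed P (fun t f => Covered F (S.blocks (S.lMin + d)) (tripleSet (S.lMin + d) t) f) k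
            : ℝ)) := by
      exact_mod_cast h1.trans (Nat.mul_le_mul_left 729 h2)
    have h4 := mul_le_mul_of_nonneg_right hPN (Real.exp_pos (-(a * S.iters))).le
    linarith
  · gcongr

/-- At the finest level all the non-defective triples are likely to be covered. -/
lemma frac_exists_not_covered_le [NeZero S.width] {F : Finset (Finset (Fin S.n))}
    (hF : Sparse F S.L) :
    frac (fun h : S.Design => ∃ t ∈ increasing (3 ^ S.L), ¬ Defective F S.L t ∧
      ∀ r, ¬ Covered F (S.blocks S.L) (tripleSet S.L t) (Scheme.levelPart h le_rfl r))
      ≤ (3 ^ S.L) ^ 3 * Real.exp (-(1 / 10 * (1 / (S.width : ℝ)) ^ 2 * S.reps S.L)) := by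
  classical
  obtain ⟨ρ, hρ₁, hρ₂, hρ₃⟩ := exists_resample (S := S) (ℓ := S.L) le_rfl
  refine (frac_exists_le _ _).trans ?_
  have hcard : ((increasing (3 ^ S.L)).card : ℝ) ≤ (3 ^ S.L) ^ 3 := by
    exact_mod_cast card_increasing_le (3 ^ S.L)
  set p := Real.exp (-(1 / 10 * (1 / (S.width : ℝ)) ^ 2 * S.reps S.L)) with hp
  calc _ ≤ (increasing (3 ^ S.L)).card • p := by
        apply Finset.sum_le_card_nsmul
        intro t ht
        by_cases hd : Defective F S.L t
        · rw [frac_def]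
          simp only [hd, not_true, false_and, if_false]
          rw [mean_const]
          exact (Real.exp_pos _).le
        · rw [frac_def, hρ₃]
          refine le_trans (mean_mono (g := fun _ => p) fun h => ?_) (mean_const _).le
          rw [← frac_def]
          simp only [hρ₁, hd, not_false_eq_true, true_and]
          exact frac_forall_not_le_exp (S.reps S.L) (fun f : Fin _ → Fin S.width =>
            Covered F (S.blocks S.L) (tripleSet S.L t) f) (hF.le_frac_covered ht hd)
    _ ≤ _ := by
        rw [nsmul_eq_mul]
        exact mul_le_mul_of_nonneg_right hcard (Real.exp_pos _).le

end HyperLearn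

namespace HyperLearn

/-! ### Linear statistics of a random set -/

section Bernoulli

variable {ι : Type*} [DecidableEq ι]

/-- The probability that the random subset of `U` with inclusion probability `p` equals `F`. -/
def bernoulliWeight (p : ℝ) (U F : Finset ι) : ℝ := p ^ F.card * (1 - p) ^ (U \ F).card

lemma bernoulliWeight_nonneg {p : ℝ} (h0 : 0 ≤ p) (h1 : p ≤ 1) (U F : Finset ι) :
    0 ≤ bernoulliWeight p U F :=
  mul_nonneg (pow_nonneg h0 _) (pow_nonneg (by linarith) _)

lemma sum_bernoulliWeight_mul_exp (p : ℝ) (U : Finset ι) (c : ι → ℝ) :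
    ∑ F ∈ U.powerset, bernoulliWeight p U F * Real.exp (∑ e ∈ F, c e)
      = ∏ e ∈ U, (p * Real.exp (c e) + (1 - p)) := by
  rw [Finset.prod_add]
  apply Finset.sum_congr rfl
  intro F _
  rw [Finset.prod_mul_distrib, Finset.prod_const, Finset.prod_const, Real.exp_sum,
    bernoulliWeight]
  ring

lemma sum_bernoulliWeight_of_mem (p : ℝ) {U : Finset ι} {e : ι} (he : e ∈ U) :
    ∑ F ∈ U.powerset, (if e ∈ F then bernoulliWeight p U F else 0) = p := by
  have h := Finset.prod_add (fun _ => p) (fun e' => if e' = e then 0 else 1 - p) U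
  have h1 : ∏ e' ∈ U, (p + if e' = e then 0 else 1 - p) = p := by
    rw [Finset.prod_eq_single_of_mem e he]
    · simp
    · intro e' _ hne
      simp [hne]
  rw [h1] at h
  conv_rhs => rw [h]
  apply Finset.sum_congr rfl
  intro F hF
  rw [Finset.prod_const]
  split_ifs with heF
  · rw [bernoulliWeight]
    congr 1
    rw [← Finset.prod_const]
    apply Finset.prod_congr rfl
    intro e' he'
    have : e' ≠ e := fun h => (Finset.mem_sdiff.1 he').2 (h ▸ heF)
    rw [if_neg this]
  · rw [Finset.prod_eq_zero (Finset.mem_sdiff.2 ⟨he, heF⟩) (by simp), mul_zero]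

lemma exp_sub_one_le_two_mul {x : ℝ} (h0 : 0 ≤ x) (h1 : x ≤ 1) : Real.exp x - 1 ≤ 2 * x := by
  have := Real.abs_exp_sub_one_le (x := x) (by rwa [abs_of_nonneg h0])
  rw [abs_of_nonneg h0] at this
  exact (le_abs_self _).trans this

/-- An upper Chernoff bound. -/
lemma sum_bernoulliWeight_ge_le_exp {p : ℝ} (h0 : 0 ≤ p) (h1 : p ≤ 1) (U : Finset ι) (c : ι → ℝ)
    {l a : ℝ} (hl : 0 ≤ l) (hc : ∀ e ∈ U, 0 ≤ c e) (hlc : ∀ e ∈ U, l * c e ≤ 1) :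
    ∑ F ∈ U.powerset with a ≤ ∑ e ∈ F, c e, bernoulliWeight p U F
      ≤ Real.exp (2 * l * (p * ∑ e ∈ U, c e) - l * a) := by
  have hprod : ∏ e ∈ U, (p * Real.exp (l * c e) + (1 - p))
      ≤ Real.exp (2 * l * (p * ∑ e ∈ U, c e)) := by
    calc ∏ e ∈ U, (p * Real.exp (l * c e) + (1 - p))
        ≤ ∏ e ∈ U, Real.exp (2 * l * p * c e) := by
          apply Finset.prod_le_prod
          · intro e _
            have := Real.exp_pos (l * c e)
            nlinarith
          · intro e he
            have h2 := exp_sub_one_le_two_mul (mul_nonneg hl (hc e he)) (hlc e he)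
            have h3 := Real.add_one_le_exp (2 * l * p * c e)
            nlinarith
      _ = _ := by
          rw [← Real.exp_sum, ← Finset.mul_sum]
          ring_nf
  calc ∑ F ∈ U.powerset with a ≤ ∑ e ∈ F, c e, bernoulliWeight p U F
      ≤ ∑ F ∈ U.powerset, bernoulliWeight p U F * Real.exp (∑ e ∈ F, l * c e)
          * Real.exp (-(l * a)) := by
        rw [Finset.sum_filter]
        apply Finset.sum_le_sum
        intro F _
        have hw := bernoulliWeight_nonneg h0 h1 U F
        split_ifs with h
        · rw [mul_assoc, ← Real.exp_add, ← Finset.mul_sum]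
          have : 0 ≤ l * ∑ e ∈ F, c e + -(l * a) := by nlinarith
          have := Real.one_le_exp this
          nlinarith
        · positivity
    _ = (∏ e ∈ U, (p * Real.exp (l * c e) + (1 - p))) * Real.exp (-(l * a)) := by
        rw [← Finset.sum_mul, sum_bernoulliWeight_mul_exp]
    _ ≤ Real.exp (2 * l * (p * ∑ e ∈ U, c e)) * Real.exp (-(l * a)) := by
        gcongr
    _ = _ := by rw [← Real.exp_add]; ring_nf

/-- Markov's inequality. -/
lemma sum_bernoulliWeight_ge_le_div {p : ℝ} (h0 : 0 ≤ p) (h1 : p ≤ 1) (U : Finset ι) (c : ι → ℝ)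
    {a : ℝ} (ha : 0 < a) (hc : ∀ e ∈ U, 0 ≤ c e) :
    ∑ F ∈ U.powerset with a ≤ ∑ e ∈ F, c e, bernoulliWeight p U F
      ≤ p * (∑ e ∈ U, c e) / a := by
  rw [le_div_iff₀ ha, Finset.sum_mul]
  calc ∑ F ∈ U.powerset with a ≤ ∑ e ∈ F, c e, bernoulliWeight p U F * a
      ≤ ∑ F ∈ U.powerset, bernoulliWeight p U F * ∑ e ∈ F, c e := by
        rw [Finset.sum_filter]
        apply Finset.sum_le_sum
        intro F hF
        have hw := bernoulliWeight_nonneg h0 h1 U F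
        split_ifs with h
        · exact mul_le_mul_of_nonneg_left h hw
        · exact mul_nonneg hw (Finset.sum_nonneg fun e he => hc e (Finset.mem_powerset.1 hF he))
    _ = ∑ F ∈ U.powerset, ∑ e ∈ U, c e * (if e ∈ F then bernoulliWeight p U F else 0) := by
        apply Finset.sum_congr rfl
        intro F hF
        rw [Finset.mul_sum, ← Finset.sum_subset (Finset.mem_powerset.1 hF)]
        · apply Finset.sum_congr rfl
          intro e he
          rw [if_pos he, mul_comm]
        · intro e _ he
          simp [he]
    _ = p * ∑ e ∈ U, c e := by
        rw [Finset.sum_comm, Finset.mul_sum]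
        apply Finset.sum_congr rfl
        intro e he
        rw [← Finset.mul_sum, sum_bernoulliWeight_of_mem p he, mul_comm]

/-- Events about the random set `E ⊆ U` translate into sums over the finite subsets of `U`. -/
lemma setBernoulli_exists_le [Countable ι] (p : unitInterval) (U : Finset ι)
    (P : Finset ι → Prop) [DecidablePred P] :
    setBernoulli (U : Set ι) p {E | ∃ F ⊆ U, (F : Set ι) = E ∧ P F}
      ≤ ENNReal.ofReal (∑ F ∈ U.powerset with P F, bernoulliWeight p U F) := by
  have hsub : {E : Set ι | ∃ F ⊆ U, (F : Set ι) = E ∧ P F}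
      ⊆ ⋃ F ∈ U.powerset.filter P, {(F : Set ι)} := by
    rintro E ⟨F, hFU, rfl, hP⟩
    simp only [Set.mem_iUnion]
    exact ⟨F, Finset.mem_filter.2 ⟨Finset.mem_powerset.2 hFU, hP⟩, rfl⟩
  refine (measure_mono hsub).trans ((measure_biUnion_finset_le _ _).trans ?_)
  rw [ENNReal.ofReal_sum_of_nonneg fun F _ => bernoulliWeight_nonneg p.2.1 p.2.2 U F]
  apply Finset.sum_le_sum
  intro F hF
  have hFU := Finset.mem_powerset.1 (Finset.mem_filter.1 hF).1
  have h := setBernoulli_real_singleton (u := (U : Set ι)) (s := (F : Set ι)) p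
    (by exact_mod_cast hFU) U.finite_toSet
  rw [← Finset.coe_sdiff, Set.ncard_coe_finset, Set.ncard_coe_finset] at h
  rw [bernoulliWeight, ← h, measureReal_def, ENNReal.ofReal_toReal (measure_ne_top _ _)]

end Bernoulli

/-! ### Sums over hyperedges and blocks -/

/-- The sets of three vertices. -/
def allEdges (n : ℕ) : Finset (Finset (Fin n)) := Finset.univ.filter fun e => e.card = 3

lemma mem_allEdges {n : ℕ} {e : Finset (Fin n)} : e ∈ allEdges n ↔ e.card = 3 := by
  simp [allEdges]

lemma erdosRenyi_eq (n : ℕ) (p : unitInterval) :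
    erdosRenyi n p = setBernoulli (allEdges n : Set (Finset (Fin n))) p := by
  unfold erdosRenyi
  congr 1
  ext e
  simp [mem_allEdges]

/-- Each set of three vertices arises from six ordered triples. -/
lemma six_mul_sum_allEdges_le {n : ℕ} (Φ : Finset (Fin n) → ℝ) (hΦ : ∀ e, 0 ≤ Φ e) :
    6 * ∑ e ∈ allEdges n, Φ e ≤ ∑ u, ∑ v, ∑ x, Φ {u, v, x} := by
  have h1 : ∑ u, ∑ v, ∑ x, Φ {u, v, x}
      = ∑ q : Fin n × Fin n × Fin n, Φ {q.1, q.2.1, q.2.2} := by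
    rw [Fintype.sum_prod_type]
    simp only [Fintype.sum_prod_type]
  have h2 : ∑ e ∈ allEdges n, ∑ q : Fin n × Fin n × Fin n with
      ({q.1, q.2.1, q.2.2} : Finset (Fin n)) = e, Φ {q.1, q.2.1, q.2.2}
      ≤ ∑ q : Fin n × Fin n × Fin n, Φ {q.1, q.2.1, q.2.2} := by
    rw [← Finset.sum_fiberwise Finset.univ
      (fun q : Fin n × Fin n × Fin n => ({q.1, q.2.1, q.2.2} : Finset (Fin n)))]
    apply Finset.sum_le_sum_of_subset_of_nonneg (Finset.subset_univ _)
    intro e _ _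
    exact Finset.sum_nonneg fun q _ => hΦ _
  rw [h1, Finset.mul_sum]
  refine le_trans (Finset.sum_le_sum fun e he => ?_) h2
  obtain ⟨a, b, c, hab, hac, hbc, rfl⟩ := Finset.card_eq_three.1 (mem_allEdges.1 he)
  have hsub : ({(a, b, c), (a, c, b), (b, a, c), (b, c, a), (c, a, b), (c, b, a)} :
      Finset (Fin n × Fin n × Fin n)) ⊆ Finset.univ.filter fun q : Fin n × Fin n × Fin n =>
        ({q.1, q.2.1, q.2.2} : Finset (Fin n)) = {a, b, c} := by
    intro q hq
    simp only [Finset.mem_insert, Finset.mem_singleton] at hq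
    refine Finset.mem_filter.2 ⟨Finset.mem_univ _, ?_⟩
    rcases hq with rfl | rfl | rfl | rfl | rfl | rfl <;> ext y <;> simp <;> tauto
  have hcard : ({(a, b, c), (a, c, b), (b, a, c), (b, c, a), (c, a, b), (c, b, a)} :
      Finset (Fin n × Fin n × Fin n)).card = 6 := by
    have hba := hab.symm
    have hca := hac.symm
    have hcb := hbc.symm
    simp [Finset.card_insert_of_notMem, *]
  calc 6 * Φ {a, b, c} = ∑ _q ∈ ({(a, b, c), (a, c, b), (b, a, c), (b, c, a), (c, a, b),
        (c, b, a)} : Finset (Fin n × Fin n × Fin n)), Φ {a, b, c} := by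
        rw [Finset.sum_const, hcard]
        norm_num
    _ ≤ ∑ q : Fin n × Fin n × Fin n with ({q.1, q.2.1, q.2.2} : Finset (Fin n)) = {a, b, c},
        Φ {a, b, c} :=
        Finset.sum_le_sum_of_subset_of_nonneg hsub fun _ _ _ => hΦ _
    _ = _ := by
        apply Finset.sum_congr rfl
        intro q hq
        rw [(Finset.mem_filter.1 hq).2]

variable {S : Scheme}

lemma sum_block_eq {ℓ : ℕ} (hℓ : ℓ ≤ S.L) (G : Fin (3 ^ ℓ) → ℝ) :
    ∑ v : Fin S.n, G ⟨S.block ℓ v, S.block_lt hℓ v⟩ = 3 ^ (S.L - ℓ) * ∑ i, G i := by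
  have hn : 3 ^ ℓ * 3 ^ (S.L - ℓ) = S.n := by
    rw [← pow_add, Nat.add_sub_cancel' hℓ]
  rw [← (finProdFinEquiv.trans (finCongr hn)).sum_comp, Fintype.sum_prod_type, Finset.mul_sum]
  apply Finset.sum_congr rfl
  intro i _
  have hb : ∀ j : Fin (3 ^ (S.L - ℓ)), (⟨S.block ℓ ((finProdFinEquiv.trans (finCongr hn)) (i, j)),
      S.block_lt hℓ _⟩ : Fin (3 ^ ℓ)) = i := by
    intro j
    apply Fin.ext
    have h3 : 0 < 3 ^ (S.L - ℓ) := by positivity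
    simp only [Scheme.block, Equiv.trans_apply, finProdFinEquiv_apply_val, finCongr_apply,
      Fin.val_cast]
    rw [Nat.add_mul_div_left _ _ h3, Nat.div_eq_of_lt j.2, zero_add]
  simp only [hb]
  simp

lemma blocks_triple {ℓ : ℕ} (hℓ : ℓ ≤ S.L) (u v x : Fin S.n) :
    S.blocks ℓ {u, v, x} = {⟨S.block ℓ u, S.block_lt hℓ u⟩, ⟨S.block ℓ v, S.block_lt hℓ v⟩,
      ⟨S.block ℓ x, S.block_lt hℓ x⟩} := by
  ext y
  simp only [Scheme.blocks, Finset.mem_filter, Finset.mem_univ, true_and, Finset.mem_insert,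
    Finset.mem_singleton, exists_eq_or_imp, exists_eq_left, Fin.ext_iff (a := y),
    eq_comm (b := (y : ℕ))]

/-- Passing from sums over hyperedges to sums over triples of blocks. -/
lemma sum_allEdges_blocks_le {ℓ : ℕ} (hℓ : ℓ ≤ S.L) (Φ : Finset (Fin (3 ^ ℓ)) → ℝ)
    (hΦ : ∀ s, 0 ≤ Φ s) :
    ∑ e ∈ allEdges S.n, Φ (S.blocks ℓ e)
      ≤ (3 ^ (S.L - ℓ)) ^ 3 / 6 * ∑ i, ∑ j, ∑ k, Φ {i, j, k} := by
  have h := six_mul_sum_allEdges_le (fun e => Φ (S.blocks ℓ e)) fun e => hΦ _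
  simp only [blocks_triple hℓ] at h
  have h1 : ∑ u : Fin S.n, ∑ v : Fin S.n, ∑ x : Fin S.n, Φ {⟨S.block ℓ u, S.block_lt hℓ u⟩,
      ⟨S.block ℓ v, S.block_lt hℓ v⟩, ⟨S.block ℓ x, S.block_lt hℓ x⟩}
      = (3 ^ (S.L - ℓ)) ^ 3 * ∑ i, ∑ j, ∑ k, Φ {i, j, k} := by
    simp only [fun a b => sum_block_eq hℓ fun k => Φ {a, b, k}]
    simp only [← Finset.mul_sum]
    simp only [fun a => sum_block_eq hℓ fun j => ∑ k, Φ {a, j, k}]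
    simp only [← Finset.mul_sum]
    simp only [sum_block_eq hℓ fun i => ∑ j, ∑ k, Φ {i, j, k}]
    ring
  rw [h1] at h
  linarith

/-- Adding a block to `s` multiplies the weight `y ^ |s \ T|` by `1` for the blocks in `s ∪ T`
and by `y` for the others. -/
lemma sum_pow_card_insert_sdiff_le {α : Type*} [Fintype α] [DecidableEq α] (T s : Finset α)
    {y : ℝ} (hy : 0 ≤ y) :
    ∑ k, y ^ (insert k s \ T).card
      ≤ y ^ (s \ T).card * ((s ∪ T).card + Fintype.card α * y) := by
  have h : ∀ k, y ^ (insert k s \ T).card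
      ≤ y ^ (s \ T).card * ((if k ∈ s ∪ T then 1 else 0) + y) := by
    intro k
    have hp : 0 ≤ y ^ (s \ T).card := pow_nonneg hy _
    by_cases hk : k ∈ s ∪ T
    · rw [if_pos hk]
      have : insert k s \ T = s \ T := by
        rcases Finset.mem_union.1 hk with hk | hk
        · rw [Finset.insert_eq_of_mem hk]
        · exact Finset.insert_sdiff_of_mem _ hk
      rw [this]
      nlinarith
    · rw [if_neg hk, zero_add]
      rw [Finset.mem_union, not_or] at hk
      rw [Finset.insert_sdiff_of_notMem _ hk.2, Finset.card_insert_of_notMem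
        (fun h => hk.1 (Finset.mem_sdiff.1 h).1), pow_succ]
  refine (Finset.sum_le_sum fun k _ => h k).trans (le_of_eq ?_)
  rw [← Finset.mul_sum, Finset.sum_add_distrib, Finset.sum_boole, Finset.filter_mem_eq_inter,
    Finset.univ_inter, Finset.sum_const, nsmul_eq_mul, Finset.card_univ]

/-- The total weight `y ^ |{i, j, k} \ T|` of the triples of blocks `(i, j, k)` that are not
contained in `T`.  With `x` the number of blocks times `y`, a triple with `j` blocks outside of `T`
contributes to the term `x ^ j`. -/
lemma sum_pow_card_sdiff_le {α : Type*} [Fintype α] [DecidableEq α] {T : Finset α}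
    (hT : T.card = 3) {y x : ℝ} (hy : 0 ≤ y) (hx : x = Fintype.card α * y) :
    ∑ i, ∑ j, ∑ k, (if ({i, j, k} : Finset α) ⊆ T then 0 else y ^ (({i, j, k} : Finset α) \ T).card)
      ≤ 41 * x + 12 * x ^ 2 + x ^ 3 := by
  have hx0 : 0 ≤ x := by rw [hx]; positivity
  have hswap : ∀ i j k : α, ({i, j, k} : Finset α) = insert k {j, i} := by
    intro i j k
    ext z
    simp
    tauto
  -- the sum over the last block
  have h3 : ∀ i j, ∑ k, y ^ (({i, j, k} : Finset α) \ T).card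
      ≤ y ^ (({j, i} : Finset α) \ T).card * ((({j, i} : Finset α) ∪ T).card + x) := by
    intro i j
    simp only [hswap]
    rw [hx]
    exact sum_pow_card_insert_sdiff_le T {j, i} hy
  have h2 : ∀ i, ∑ j, y ^ (({j, i} : Finset α) \ T).card
      ≤ y ^ (({i} : Finset α) \ T).card * ((({i} : Finset α) ∪ T).card + x) := by
    intro i
    rw [hx]
    exact sum_pow_card_insert_sdiff_le T {i} hy
  have hcard1 : ∀ i, (({i} : Finset α) ∪ T).card ≤ 4 := fun i => by
    have := Finset.card_union_le {i} T
    rw [hT, Finset.card_singleton] at this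
    omega
  have hcard2 : ∀ i j, (({j, i} : Finset α) ∪ T).card ≤ 5 := fun i j => by
    have := Finset.card_union_le {j, i} T
    have h' : ({j, i} : Finset α).card ≤ 2 := Finset.card_le_two
    omega
  have hout : ∀ i ∉ T, (({i} : Finset α) \ T).card = 1 := by
    intro i hi
    rw [Finset.sdiff_eq_self_of_disjoint (Finset.disjoint_singleton_left.2 hi),
      Finset.card_singleton]
  have hterm : ∀ i j k, (if ({i, j, k} : Finset α) ⊆ T then 0
      else y ^ (({i, j, k} : Finset α) \ T).card) ≤ y ^ (({i, j, k} : Finset α) \ T).card := by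
    intro i j k
    split_ifs
    · positivity
    · exact le_rfl
  -- the first block lies outside `T`
  have hA : ∀ i ∉ T, ∑ j, ∑ k, (if ({i, j, k} : Finset α) ⊆ T then 0
      else y ^ (({i, j, k} : Finset α) \ T).card) ≤ y * (4 + x) * (5 + x) := by
    intro i hi
    calc _ ≤ ∑ j, y ^ (({j, i} : Finset α) \ T).card * (5 + x) := by
          apply Finset.sum_le_sum
          intro j _
          refine (Finset.sum_le_sum fun k _ => hterm i j k).trans ((h3 i j).trans ?_)
          have : ((({j, i} : Finset α) ∪ T).card : ℝ) ≤ 5 := by exact_mod_cast hcard2 i j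
          gcongr
      _ ≤ _ := by
          rw [← Finset.sum_mul]
          have h4 := h2 i
          rw [hout i hi, pow_one] at h4
          have : ((({i} : Finset α) ∪ T).card : ℝ) ≤ 4 := by exact_mod_cast hcard1 i
          have h5 : y * ((({i} : Finset α) ∪ T).card + x) ≤ y * (4 + x) := by gcongr
          gcongr
          exact h4.trans h5
  -- the first block lies in `T` and the second outside
  have hB : ∀ i ∈ T, ∀ j ∉ T, ∑ k, (if ({i, j, k} : Finset α) ⊆ T then 0
      else y ^ (({i, j, k} : Finset α) \ T).card) ≤ y * (4 + x) := by
    intro i hi j hj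
    refine (Finset.sum_le_sum fun k _ => hterm i j k).trans ((h3 i j).trans ?_)
    have e1 : ({j, i} : Finset α) \ T = {j} := by
      rw [Finset.insert_sdiff_of_notMem _ hj, Finset.sdiff_eq_empty_iff_subset.2
        (Finset.singleton_subset_iff.2 hi), insert_empty_eq]
    have e2 : (({j, i} : Finset α) ∪ T).card ≤ 4 := by
      have : ({j, i} : Finset α) ∪ T = {j} ∪ T := by
        ext z
        simp only [Finset.mem_union, Finset.mem_insert, Finset.mem_singleton]
        constructor
        · rintro ((h | rfl) | h)
          · exact Or.inl h
          · exact Or.inr hi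
          · exact Or.inr h
        · rintro (h | h)
          · exact Or.inl (Or.inl h)
          · exact Or.inr h
      rw [this]
      exact hcard1 j
    have e3 : ((({j, i} : Finset α) ∪ T).card : ℝ) ≤ 4 := by exact_mod_cast e2
    rw [e1, Finset.card_singleton, pow_one]
    gcongr
  -- the first two blocks lie in `T`
  have hC : ∀ i ∈ T, ∀ j ∈ T, ∑ k, (if ({i, j, k} : Finset α) ⊆ T then 0
      else y ^ (({i, j, k} : Finset α) \ T).card) ≤ x := by
    intro i hi j hj
    calc _ ≤ ∑ _k : α, y := by
          apply Finset.sum_le_sum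
          intro k _
          split_ifs with h
          · exact hy
          · have hk : k ∉ T := by
              intro hk
              apply h
              intro z hz
              simp only [Finset.mem_insert, Finset.mem_singleton] at hz
              rcases hz with rfl | rfl | rfl <;> assumption
            have : (({i, j, k} : Finset α) \ T).card = 1 := by
              rw [Finset.insert_sdiff_of_mem _ hi, Finset.insert_sdiff_of_mem _ hj, hout k hk]
            rw [this, pow_one]
      _ = x := by simp [hx]
  have hcompl : ∀ c : ℝ, 0 ≤ c → ∑ _i ∈ (Finset.univ \ T), y * c ≤ x * c := by
    intro c hc
    rw [Finset.sum_const, nsmul_eq_mul, hx]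
    have : ((Finset.univ \ T).card : ℝ) ≤ Fintype.card α := by
      exact_mod_cast Finset.card_le_univ _
    have h0 : 0 ≤ y * c := mul_nonneg hy hc
    nlinarith
  have hD : ∀ i ∈ T, ∑ j, ∑ k, (if ({i, j, k} : Finset α) ⊆ T then 0
      else y ^ (({i, j, k} : Finset α) \ T).card) ≤ x * (4 + x) + 3 * x := by
    intro i hi
    rw [← Finset.sum_sdiff (Finset.subset_univ T)]
    apply add_le_add
    · exact (Finset.sum_le_sum fun j hj => hB i hi j (Finset.mem_sdiff.1 hj).2).trans
        (hcompl _ (by positivity))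
    · refine (Finset.sum_le_card_nsmul T _ x fun j hj => hC i hi j hj).trans ?_
      rw [hT, nsmul_eq_mul]
      norm_num
  rw [← Finset.sum_sdiff (Finset.subset_univ T)]
  have hfin1 := (Finset.sum_le_sum fun i hi => hA i (Finset.mem_sdiff.1 hi).2).trans
    (by simpa only [mul_assoc] using hcompl ((4 + x) * (5 + x)) (by positivity))
  have hfin2 := Finset.sum_le_card_nsmul T _ _ fun i hi => hD i hi
  rw [hT, nsmul_eq_mul] at hfin2
  refine (add_le_add hfin1 hfin2).trans (le_of_eq ?_)
  push_cast
  ring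

/-- The number of triples of blocks of level `ℓ` that contain the set `s` of blocks. -/
def containing (ℓ : ℕ) (s : Finset (Fin (3 ^ ℓ))) : ℕ :=
  ((increasing (3 ^ ℓ)).filter fun t => s ⊆ tripleSet ℓ t).card

lemma containing_le {ℓ : ℕ} {s : Finset (Fin (3 ^ ℓ))} (hs : s.Nonempty) :
    containing ℓ s ≤ 9 * (3 ^ ℓ) ^ 2 := by
  obtain ⟨x, hx⟩ := hs
  refine le_trans (Finset.card_le_card ?_)
    (card_filter_not_disjoint_le subset_rfl ((x : ℕ), (x : ℕ), (x : ℕ)))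
  intro t ht
  obtain ⟨h1, h2⟩ := Finset.mem_filter.1 ht
  refine Finset.mem_filter.2 ⟨h1, Finset.not_disjoint_iff.2 ⟨x, ?_, h2 hx⟩⟩
  rw [mem_tripleSet]
  exact Or.inl rfl

lemma sum_containing_le (ℓ : ℕ) :
    ∑ i, ∑ j, ∑ k, (containing ℓ {i, j, k} : ℝ) ≤ 27 * (3 ^ ℓ) ^ 3 := by
  have h1 : ∀ i j k : Fin (3 ^ ℓ), (containing ℓ {i, j, k} : ℝ)
      = ∑ t ∈ increasing (3 ^ ℓ), (if i ∈ tripleSet ℓ t then (1 : ℝ) else 0)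
        * ((if j ∈ tripleSet ℓ t then 1 else 0) * (if k ∈ tripleSet ℓ t then 1 else 0)) := by
    intro i j k
    rw [containing, ← Finset.sum_boole]
    apply Finset.sum_congr rfl
    intro t _
    by_cases hi : i ∈ tripleSet ℓ t <;> by_cases hj : j ∈ tripleSet ℓ t <;>
      by_cases hk : k ∈ tripleSet ℓ t <;> simp [hi, hj, hk, Finset.insert_subset_iff]
  simp only [h1]
  calc _ = ∑ t ∈ increasing (3 ^ ℓ), ∑ i, ∑ j, ∑ k,
        (if i ∈ tripleSet ℓ t then (1 : ℝ) else 0)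
        * ((if j ∈ tripleSet ℓ t then 1 else 0) * (if k ∈ tripleSet ℓ t then 1 else 0)) := by
        simp only [Finset.sum_comm (t := increasing (3 ^ ℓ))]
    _ = ∑ t ∈ increasing (3 ^ ℓ), (27 : ℝ) := by
        apply Finset.sum_congr rfl
        intro t ht
        simp only [← Finset.mul_sum, ← Finset.sum_mul]
        have : ∑ i, (if i ∈ tripleSet ℓ t then (1 : ℝ) else 0) = 3 := by
          rw [Finset.sum_boole, Finset.filter_mem_eq_inter, Finset.univ_inter,
            card_tripleSet ht]
          norm_num
        rw [this]
        norm_num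
    _ ≤ _ := by
        rw [Finset.sum_const, nsmul_eq_mul, mul_comm]
        have : ((increasing (3 ^ ℓ)).card : ℝ) ≤ (3 ^ ℓ) ^ 3 := by
          exact_mod_cast card_increasing_le (3 ^ ℓ)
        linarith

/-- This replaces the number of defective triples, which depends on `F` in a complicated way, by a
linear statistic of `F`. -/
lemma card_defectives_le (F : Finset (Finset (Fin S.n))) (ℓ : ℕ) :
    (defectives F ℓ).card ≤ ∑ e ∈ F, containing ℓ (S.blocks ℓ e) := by
  classical
  refine (Finset.card_le_card (t := F.biUnion fun e =>
    (increasing (3 ^ ℓ)).filter fun t => S.blocks ℓ e ⊆ tripleSet ℓ t) ?_).trans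
    Finset.card_biUnion_le
  intro t ht
  obtain ⟨h1, e, he, hsub⟩ := Finset.mem_filter.1 ht
  exact Finset.mem_biUnion.2 ⟨e, he, Finset.mem_filter.2 ⟨h1, hsub⟩⟩

end HyperLearn

namespace HyperLearn

variable {S : Scheme}

/-! ### Typical hypergraphs -/

/-- The quantitative relations between the parameters of a scheme, the edge probability `p` and the
cube root `M` of the expected number of hyperedges that hold for all large `n`: the
`3 ^ lMin` blocks of the coarsest level are about `M`, and by `miss_le` a triple that an iteration
covers with probability at least `1 / (10 * width ^ 2)` is missed by all the iterations of a
level with probability at most `1 / 1458`, which is half of `1 / 729`, the inverse of the bound `729` used for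
the number of children of a triple. -/
structure Regime (S : Scheme) (p : unitInterval) (M : ℝ) : Prop where
  one_le : 1 ≤ M
  one_le_lMin : 1 ≤ S.lMin
  lMin_le : S.lMin ≤ S.L
  le_pow : M ≤ 3 ^ S.lMin
  pow_le : (3 : ℝ) ^ S.lMin ≤ 3 * M
  width_ge : 155 * M ≤ S.width
  edges_le : (p : ℝ) * ((3 : ℝ) ^ S.L) ^ 3 / 6 ≤ 11 / 10 * M ^ 3
  miss_le : Real.exp (-(1 / 10 * (1 / (S.width : ℝ)) ^ 2 * S.iters)) ≤ 1 / 1458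

open Classical in
/-- The weight of the hyperedge `e` for the triple `t`: the probability that the blocks of `e`
outside of `t` join the blocks of `t`, and `0` if there are no such blocks. -/
noncomputable def weight (S : Scheme) (ℓ : ℕ) (t : ℕ × ℕ × ℕ)
    (s : Finset (Fin (3 ^ ℓ))) : ℝ :=
  if s ⊆ tripleSet ℓ t then 0 else (1 / (S.width : ℝ)) ^ (s \ tripleSet ℓ t).card

lemma weight_nonneg (ℓ : ℕ) (t : ℕ × ℕ × ℕ) (s : Finset (Fin (3 ^ ℓ))) :
    0 ≤ weight S ℓ t s := by
  unfold weight
  split_ifs <;> positivity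

lemma sum_biUnion_le {ι τ : Type*} [DecidableEq ι] (A : Finset τ) (B : τ → Finset ι) (f : ι → ℝ)
    (hf : ∀ x, 0 ≤ f x) : ∑ x ∈ A.biUnion B, f x ≤ ∑ t ∈ A, ∑ x ∈ B t, f x := by
  classical
  induction A using Finset.induction_on with
  | empty => simp
  | insert t A ht ih =>
    rw [Finset.biUnion_insert, Finset.sum_insert ht]
    have h1 := Finset.sum_union_inter (s₁ := B t) (s₂ := A.biUnion B) (f := f)
    have h2 : 0 ≤ ∑ x ∈ B t ∩ A.biUnion B, f x := Finset.sum_nonneg fun x _ => hf x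
    linarith

namespace Regime

variable {p : unitInterval} {M : ℝ}

lemma width_pos (R : Regime S p M) : (0 : ℝ) < S.width := by
  have := R.one_le
  have := R.width_ge
  linarith

lemma neZero_width (R : Regime S p M) : NeZero S.width :=
  ⟨fun h => by have := R.width_pos; rw [h] at this; simp at this⟩

lemma le_pow' (R : Regime S p M) {ℓ : ℕ} (hℓ : S.lMin ≤ ℓ) : M ≤ 3 ^ ℓ :=
  R.le_pow.trans (pow_le_pow_right₀ (by norm_num) hℓ)

/-- The edge probability times the number of vertex triples in a triple of blocks. -/
lemma mul_pow_div_le (R : Regime S p M) {ℓ : ℕ} (hℓ : ℓ ≤ S.L) :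
    (p : ℝ) * ((3 ^ (S.L - ℓ)) ^ 3 / 6) ≤ 11 / 10 * M ^ 3 / (3 ^ ℓ) ^ 3 := by
  rw [le_div_iff₀ (by positivity)]
  refine le_trans (le_of_eq ?_) R.edges_le
  have : (3 : ℝ) ^ S.L = 3 ^ (S.L - ℓ) * 3 ^ ℓ := by rw [← pow_add, Nat.sub_add_cancel hℓ]
  rw [this]
  ring

/-- The expected weight of the hyperedges is well below `9 / 10`. -/
lemma mean_weight_le (R : Regime S p M) {ℓ : ℕ} (h1 : S.lMin ≤ ℓ) (h2 : ℓ ≤ S.L)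
    {t : ℕ × ℕ × ℕ} (ht : t ∈ increasing (3 ^ ℓ)) :
    (p : ℝ) * ∑ e ∈ allEdges S.n, weight S ℓ t (S.blocks ℓ e) ≤ 3 / 10 := by
  have hw := R.width_pos
  have hM : 0 < M := lt_of_lt_of_le one_pos R.one_le
  set g : ℝ := 3 ^ ℓ with hg
  have hgpos : 0 < g := by positivity
  set w : ℝ := (S.width : ℝ) with hwdef
  have hsum := sum_allEdges_blocks_le h2 (weight S ℓ t) (weight_nonneg ℓ t)
  have hblk := sum_pow_card_sdiff_le (card_tripleSet ht) (y := 1 / w) (x := g / w) (by positivity)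
    (by rw [Fintype.card_fin, hg]; push_cast; ring)
  have hblk' : ∑ i, ∑ j, ∑ k, weight S ℓ t {i, j, k}
      ≤ 41 * (g / w) + 12 * (g / w) ^ 2 + (g / w) ^ 3 := by
    refine le_trans (le_of_eq ?_) hblk
    refine Finset.sum_congr rfl fun i _ => Finset.sum_congr rfl fun j _ =>
      Finset.sum_congr rfl fun k _ => ?_
    unfold weight
    congr
  have hp0 : (0 : ℝ) ≤ p := p.2.1
  have hN : (0 : ℝ) ≤ (3 ^ (S.L - ℓ)) ^ 3 / 6 := by positivity
  have hs : M / w ≤ 1 / 155 := by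
    rw [div_le_div_iff₀ hw (by norm_num)]
    linarith [R.width_ge]
  have hs0 : 0 ≤ M / w := by positivity
  have hr : M / g ≤ 1 := by
    rw [div_le_one hgpos]
    exact R.le_pow' h1
  have hr0 : 0 ≤ M / g := by positivity
  calc (p : ℝ) * ∑ e ∈ allEdges S.n, weight S ℓ t (S.blocks ℓ e)
      ≤ (p : ℝ) * ((3 ^ (S.L - ℓ)) ^ 3 / 6 * (41 * (g / w) + 12 * (g / w) ^ 2 + (g / w) ^ 3)) := by
        gcongr
        exact hsum.trans (mul_le_mul_of_nonneg_left hblk' hN)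
    _ ≤ 11 / 10 * M ^ 3 / g ^ 3 * (41 * (g / w) + 12 * (g / w) ^ 2 + (g / w) ^ 3) := by
        rw [← mul_assoc]
        exact mul_le_mul_of_nonneg_right (R.mul_pow_div_le h2) (by positivity)
    _ = 11 / 10 * (41 * ((M / g) ^ 2 * (M / w)) + 12 * (M / g * (M / w) ^ 2) + (M / w) ^ 3) := by
        field_simp
    _ ≤ 11 / 10 * (41 * (1 ^ 2 * (1 / 155)) + 12 * (1 * (1 / 155) ^ 2) + (1 / 155) ^ 3) := by
        gcongr
    _ ≤ 3 / 10 := by norm_num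

/-- The expected number of defective triples of a level is of the order of the expected number of
hyperedges. -/
lemma mean_containing_le (R : Regime S p M) {ℓ : ℕ} (hℓ : ℓ ≤ S.L) :
    (p : ℝ) * ∑ e ∈ allEdges S.n, (containing ℓ (S.blocks ℓ e) : ℝ) ≤ 30 * M ^ 3 := by
  have hM : 0 < M := lt_of_lt_of_le one_pos R.one_le
  have hsum := sum_allEdges_blocks_le hℓ (fun s => (containing ℓ s : ℝ)) fun s => Nat.cast_nonneg _
  have hp0 : (0 : ℝ) ≤ p := p.2.1
  have hg : (0 : ℝ) < (3 ^ ℓ) ^ 3 := by positivity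
  calc (p : ℝ) * ∑ e ∈ allEdges S.n, (containing ℓ (S.blocks ℓ e) : ℝ)
      ≤ (p : ℝ) * ((3 ^ (S.L - ℓ)) ^ 3 / 6 * (27 * (3 ^ ℓ) ^ 3)) := by
        gcongr
        exact hsum.trans (mul_le_mul_of_nonneg_left (sum_containing_le ℓ) (by positivity))
    _ ≤ 11 / 10 * M ^ 3 / (3 ^ ℓ) ^ 3 * (27 * (3 ^ ℓ) ^ 3) := by
        rw [← mul_assoc]
        exact mul_le_mul_of_nonneg_right (R.mul_pow_div_le hℓ) (by positivity)
    _ = 297 / 10 * M ^ 3 := by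
        field_simp
        norm_num
    _ ≤ 30 * M ^ 3 := by
        have : 0 < M ^ 3 := by positivity
        linarith

/-- A union bound over the triples of a level and, for each triple, a Chernoff bound with parameter
`width`, the inverse of the largest possible weight. -/
lemma prob_not_sparse_le (R : Regime S p M) {ℓ : ℕ} (h1 : S.lMin ≤ ℓ) (h2 : ℓ ≤ S.L) :
    erdosRenyi S.n p {E | ∃ F ⊆ allEdges S.n, (F : Set _) = E ∧ ¬ Sparse F ℓ}
      ≤ ENNReal.ofReal ((3 ^ S.L) ^ 3 * Real.exp (-(3 / 10 * S.width))) := by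
  classical
  have hw := R.width_pos
  rw [erdosRenyi_eq]
  refine (setBernoulli_exists_le p (allEdges S.n) _).trans (ENNReal.ofReal_le_ofReal ?_)
  set b : ℝ := Real.exp (-(3 / 10 * S.width)) with hb
  have hone : ∀ t ∈ increasing (3 ^ ℓ),
      ∑ F ∈ (allEdges S.n).powerset with 9 / 10 ≤ ∑ e ∈ F, weight S ℓ t (S.blocks ℓ e),
        bernoulliWeight p (allEdges S.n) F ≤ b := by
    intro t ht
    refine (sum_bernoulliWeight_ge_le_exp p.2.1 p.2.2 (allEdges S.n)
      (fun e => weight S ℓ t (S.blocks ℓ e)) (l := S.width) hw.le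
      (fun e _ => weight_nonneg ℓ t _) ?_).trans ?_
    · intro e _
      unfold weight
      split_ifs with hsub
      · simp
      · have hk : (S.blocks ℓ e \ tripleSet ℓ t).card ≠ 0 := by
          rw [Ne, Finset.card_eq_zero, Finset.sdiff_eq_empty_iff_subset]
          exact hsub
        have h1w : (1 : ℝ) ≤ S.width := by linarith [R.one_le, R.width_ge]
        have : (1 / (S.width : ℝ)) ^ (S.blocks ℓ e \ tripleSet ℓ t).card ≤ 1 / S.width :=
          pow_le_of_le_one (by positivity) ((div_le_one hw).2 h1w) hk
        calc (S.width : ℝ) * (1 / (S.width : ℝ)) ^ (S.blocks ℓ e \ tripleSet ℓ t).card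
            ≤ S.width * (1 / S.width) := by gcongr
          _ = 1 := by field_simp
    · apply Real.exp_le_exp.2
      have := R.mean_weight_le h1 h2 ht
      nlinarith
  have hnn : ∀ F, 0 ≤ bernoulliWeight (p : ℝ) (allEdges S.n) F := fun F =>
    bernoulliWeight_nonneg p.2.1 p.2.2 _ F
  calc ∑ F ∈ (allEdges S.n).powerset with ¬ Sparse F ℓ, bernoulliWeight p (allEdges S.n) F
      ≤ ∑ F ∈ (increasing (3 ^ ℓ)).biUnion fun t => (allEdges S.n).powerset.filter fun F =>
          9 / 10 ≤ ∑ e ∈ F, weight S ℓ t (S.blocks ℓ e), bernoulliWeight p (allEdges S.n) F := by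
        apply Finset.sum_le_sum_of_subset_of_nonneg
        · intro F hF
          obtain ⟨hFU, hns⟩ := Finset.mem_filter.1 hF
          unfold Sparse at hns
          push Not at hns
          obtain ⟨t, ht, hnd, hlt⟩ := hns
          refine Finset.mem_biUnion.2 ⟨t, ht, Finset.mem_filter.2 ⟨hFU, hlt.le.trans
            (le_of_eq ?_)⟩⟩
          apply Finset.sum_congr rfl
          intro e he
          unfold weight
          rw [if_neg fun hsub => hnd ⟨e, he, hsub⟩]
        · intro F _ _
          exact hnn F
    _ ≤ ∑ t ∈ increasing (3 ^ ℓ), ∑ F ∈ (allEdges S.n).powerset with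
          9 / 10 ≤ ∑ e ∈ F, weight S ℓ t (S.blocks ℓ e), bernoulliWeight p (allEdges S.n) F :=
        sum_biUnion_le _ _ _ hnn
    _ ≤ (increasing (3 ^ ℓ)).card • b := Finset.sum_le_card_nsmul _ _ _ hone
    _ ≤ _ := by
        rw [nsmul_eq_mul]
        have h3 : ((increasing (3 ^ ℓ)).card : ℝ) ≤ (3 ^ ℓ) ^ 3 := by
          exact_mod_cast card_increasing_le (3 ^ ℓ)
        have h4 : (3 : ℝ) ^ ℓ ≤ 3 ^ S.L := pow_le_pow_right₀ (by norm_num) h2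
        have h5 : ((3 : ℝ) ^ ℓ) ^ 3 ≤ (3 ^ S.L) ^ 3 := by gcongr
        exact mul_le_mul_of_nonneg_right (h3.trans h5) (Real.exp_pos _).le

/-- A Chernoff bound whose parameter is the inverse of `9 * (3 ^ ℓ) ^ 2`, the largest number of
triples that a single hyperedge can make defective. -/
lemma prob_defectives_ge_le (R : Regime S p M) {ℓ : ℕ} (hℓ : ℓ ≤ S.L) :
    erdosRenyi S.n p {E | ∃ F ⊆ allEdges S.n, (F : Set _) = E ∧
      69 * M ^ 3 ≤ (defectives F ℓ).card}
      ≤ ENNReal.ofReal (Real.exp (-(M ^ 3 / (3 ^ S.L) ^ 2))) := by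
  classical
  have hM : 0 < M := lt_of_lt_of_le one_pos R.one_le
  rw [erdosRenyi_eq]
  refine (setBernoulli_exists_le p (allEdges S.n) _).trans (ENNReal.ofReal_le_ofReal ?_)
  set l : ℝ := 1 / (9 * (3 ^ ℓ) ^ 2) with hl
  have hlpos : 0 < l := by positivity
  have hnn : ∀ F, 0 ≤ bernoulliWeight (p : ℝ) (allEdges S.n) F := fun F =>
    bernoulliWeight_nonneg p.2.1 p.2.2 _ F
  calc ∑ F ∈ (allEdges S.n).powerset with 69 * M ^ 3 ≤ (defectives F ℓ).card,
        bernoulliWeight p (allEdges S.n) F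
      ≤ ∑ F ∈ (allEdges S.n).powerset with
          69 * M ^ 3 ≤ ∑ e ∈ F, (containing ℓ (S.blocks ℓ e) : ℝ),
          bernoulliWeight p (allEdges S.n) F := by
        apply Finset.sum_le_sum_of_subset_of_nonneg
        · intro F hF
          obtain ⟨hFU, hge⟩ := Finset.mem_filter.1 hF
          refine Finset.mem_filter.2 ⟨hFU, hge.trans ?_⟩
          exact_mod_cast card_defectives_le F ℓ
        · intro F _ _
          exact hnn F
    _ ≤ Real.exp (2 * l * (p * ∑ e ∈ allEdges S.n, (containing ℓ (S.blocks ℓ e) : ℝ))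
          - l * (69 * M ^ 3)) := by
        apply sum_bernoulliWeight_ge_le_exp p.2.1 p.2.2 _ _ hlpos.le
        · intro e _
          exact Nat.cast_nonneg _
        · intro e he
          have hne : (S.blocks ℓ e).Nonempty := by
            obtain ⟨v, hv⟩ : e.Nonempty := Finset.card_pos.1 (by
              have := mem_allEdges.1 he
              omega)
            exact ⟨⟨S.block ℓ v, S.block_lt hℓ v⟩,
              Finset.mem_filter.2 ⟨Finset.mem_univ _, v, hv, rfl⟩⟩
          have h9 : (containing ℓ (S.blocks ℓ e) : ℝ) ≤ 9 * (3 ^ ℓ) ^ 2 := by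
            exact_mod_cast containing_le hne
          rw [hl, one_div_mul_eq_div, div_le_one (by positivity)]
          exact h9
    _ ≤ _ := by
        apply Real.exp_le_exp.2
        have h1 := R.mean_containing_le hℓ
        have h2 : (3 : ℝ) ^ ℓ ≤ 3 ^ S.L := pow_le_pow_right₀ (by norm_num) hℓ
        have h3 : M ^ 3 / (3 ^ S.L) ^ 2 ≤ M ^ 3 / (3 ^ ℓ) ^ 2 := by gcongr
        have h4 : M ^ 3 / (3 ^ ℓ) ^ 2 = 9 * l * M ^ 3 := by
          rw [hl]
          field_simp
        have h5 := mul_le_mul_of_nonneg_left h1 (by positivity : 0 ≤ 2 * l)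
        linarith

/-- Markov's inequality for the number of defective triples of all levels. -/
lemma prob_sum_defectives_ge_le (R : Regime S p M) {a : ℝ} (ha : 0 < a) :
    erdosRenyi S.n p {E | ∃ F ⊆ allEdges S.n, (F : Set _) = E ∧
      a ≤ ∑ d ∈ Finset.range (S.L - S.lMin), ((defectives F (S.lMin + d)).card : ℝ)}
      ≤ ENNReal.ofReal (S.L * (30 * M ^ 3) / a) := by
  classical
  have hM : 0 < M := lt_of_lt_of_le one_pos R.one_le
  rw [erdosRenyi_eq]
  refine (setBernoulli_exists_le p (allEdges S.n) _).trans (ENNReal.ofReal_le_ofReal ?_)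
  have hnn : ∀ F, 0 ≤ bernoulliWeight (p : ℝ) (allEdges S.n) F := fun F =>
    bernoulliWeight_nonneg p.2.1 p.2.2 _ F
  set c : Finset (Fin S.n) → ℝ := fun e => ∑ d ∈ Finset.range (S.L - S.lMin),
    (containing (S.lMin + d) (S.blocks (S.lMin + d) e) : ℝ) with hc
  have hle : ∀ F, ∑ d ∈ Finset.range (S.L - S.lMin), ((defectives F (S.lMin + d)).card : ℝ)
      ≤ ∑ e ∈ F, c e := by
    intro F
    rw [hc, Finset.sum_comm]
    apply Finset.sum_le_sum
    intro d _
    exact_mod_cast card_defectives_le F (S.lMin + d)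
  calc _ ≤ ∑ F ∈ (allEdges S.n).powerset with a ≤ ∑ e ∈ F, c e,
          bernoulliWeight p (allEdges S.n) F := by
        apply Finset.sum_le_sum_of_subset_of_nonneg
        · intro F hF
          obtain ⟨hFU, hge⟩ := Finset.mem_filter.1 hF
          exact Finset.mem_filter.2 ⟨hFU, hge.trans (hle F)⟩
        · intro F _ _
          exact hnn F
    _ ≤ p * (∑ e ∈ allEdges S.n, c e) / a :=
        sum_bernoulliWeight_ge_le_div p.2.1 p.2.2 _ _ ha fun e _ =>
          Finset.sum_nonneg fun d _ => Nat.cast_nonneg _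
    _ ≤ _ := by
        apply div_le_div_of_nonneg_right _ ha.le
        rw [hc, Finset.sum_comm, Finset.mul_sum]
        have h1 := Finset.sum_le_card_nsmul (Finset.range (S.L - S.lMin))
          (fun d => (p : ℝ) * ∑ e ∈ allEdges S.n,
            (containing (S.lMin + d) (S.blocks (S.lMin + d) e) : ℝ)) (30 * M ^ 3) (by
          intro d hd
          exact R.mean_containing_le (by have := Finset.mem_range.1 hd; omega))
        refine h1.trans ?_
        rw [nsmul_eq_mul, Finset.card_range]
        have h2 : ((S.L - S.lMin : ℕ) : ℝ) ≤ S.L := by exact_mod_cast Nat.sub_le _ _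
        gcongr

/-! ### Success probability for a typical hypergraph -/

lemma card_pd_zero_le (R : Regime S p M) (F : Finset (Finset (Fin S.n))) (h : S.Design) :
    ((pd F h 0).card : ℝ) ≤ 27 * M ^ 3 := by
  have h1 : ((pd F h 0).card : ℝ) ≤ (3 ^ S.lMin) ^ 3 := by
    exact_mod_cast card_increasing_le (3 ^ S.lMin)
  have h2 : ((3 : ℝ) ^ S.lMin) ^ 3 ≤ (3 * M) ^ 3 := by
    have := R.pow_le
    gcongr
  calc _ ≤ _ := h1.trans h2
    _ = _ := by ring

/-- If all levels have few defective triples, then with high probability all levels have few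
possibly defective triples: each level loses all but a small fraction of its non-defective
triples, up to fluctuations that Chebyshev's inequality controls.  The constant `102060` is the
solution `κ` of `729 * (69 + κ / 1458 + 1) = κ`. -/
lemma frac_exists_card_pd_gt_le (R : Regime S p M) {F : Finset (Finset (Fin S.n))}
    (hsp : ∀ ℓ, S.lMin ≤ ℓ → ℓ ≤ S.L → Sparse F ℓ)
    (hdef : ∀ ℓ, S.lMin ≤ ℓ → ℓ ≤ S.L → ((defectives F ℓ).card : ℝ) ≤ 69 * M ^ 3) :
    frac (fun h : S.Design => ∃ d ≤ S.L - S.lMin, 102060 * M ^ 3 < (pd F h d).card) ≤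
      S.L * (102060 ^ 2 * (S.iters * (1 / (S.width : ℝ)) ^ 4)
        + 102060 * 9 * ((3 ^ S.L) ^ 2 / M ^ 3)) := by
  have := R.neZero_width
  have hM : 0 < M := lt_of_lt_of_le one_pos R.one_le
  have hM3 : 0 < M ^ 3 := by positivity
  set N : ℝ := 102060 * M ^ 3 with hN
  set q := Real.exp (-(1 / 10 * (1 / (S.width : ℝ)) ^ 2 * S.iters)) with hq
  set ε : ℝ := 102060 ^ 2 * (S.iters * (1 / (S.width : ℝ)) ^ 4)
        + 102060 * 9 * ((3 ^ S.L) ^ 2 / M ^ 3) with hε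
  have hε0 : 0 ≤ ε := by positivity
  calc frac (fun h : S.Design => ∃ d ≤ S.L - S.lMin, N < (pd F h d).card)
      ≤ frac (fun h : S.Design => ∃ d ∈ Finset.range (S.L - S.lMin), ((pd F h d).card : ℝ) ≤ N ∧
        729 * ((defectives F (S.lMin + d)).card + N * q + M ^ 3) < (pd F h (d + 1)).card) := by
        apply frac_mono
        rintro h hex
        classical
        -- the first level with too many triples
        have hmin := Nat.find_spec hex
        set d := Nat.find hex with hd
        rcases Nat.eq_zero_or_eq_succ_pred d with h0 | hs
        · rw [h0] at hmin
          have := R.card_pd_zero_le F h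
          linarith [hmin.2]
        · set d' := d.pred
          rw [hs] at hmin
          refine ⟨d', Finset.mem_range.2 (by omega), ?_, ?_⟩
          · by_contra hcon
            exact Nat.find_min hex (m := d') (by omega) ⟨by omega, not_le.1 hcon⟩
          · refine lt_of_le_of_lt ?_ hmin.2
            have h1 := hdef (S.lMin + d') (by omega) (by omega)
            have h2 : N * q ≤ N * (1 / 1458) :=
              mul_le_mul_of_nonneg_left R.miss_le (by positivity)
            linarith
    _ ≤ ∑ d ∈ Finset.range (S.L - S.lMin), frac (fun h : S.Design => ((pd F h d).card : ℝ) ≤ N ∧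
        729 * ((defectives F (S.lMin + d)).card + N * q + M ^ 3) < (pd F h (d + 1)).card) :=
        frac_exists_le _ _
    _ ≤ (Finset.range (S.L - S.lMin)).card • ε := by
        apply Finset.sum_le_card_nsmul
        intro d hd
        have hd' := Finset.mem_range.1 hd
        refine (frac_card_pd_succ_le (by omega) (hsp _ (by omega) (by omega)) (by positivity)
          hM3).trans ?_
        have h1 : (3 : ℝ) ^ (S.lMin + d) ≤ 3 ^ S.L := pow_le_pow_right₀ (by norm_num) (by omega)
        calc (N ^ 2 * (S.iters * (1 / (S.width : ℝ)) ^ 4) + N * (9 * (3 ^ (S.lMin + d)) ^ 2))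
              / (M ^ 3) ^ 2
            ≤ (N ^ 2 * (S.iters * (1 / (S.width : ℝ)) ^ 4) + N * (9 * (3 ^ S.L) ^ 2))
              / (M ^ 3) ^ 2 := by gcongr
          _ = ε := by
              rw [hN, hε]
              field_simp
    _ ≤ S.L * ε := by
        rw [nsmul_eq_mul, Finset.card_range]
        have h2 : ((S.L - S.lMin : ℕ) : ℝ) ≤ S.L := by exact_mod_cast Nat.sub_le _ _
        gcongr

/-- If there are few defective triples in total, then by Markov's inequality no level is likely to
have many possibly defective triples. -/
lemma frac_exists_card_pd_gt_le_of_sum (R : Regime S p M) {F : Finset (Finset (Fin S.n))}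
    (hsp : ∀ ℓ, S.lMin ≤ ℓ → ℓ ≤ S.L → Sparse F ℓ) {a : ℝ}
    (hdef : ∑ d ∈ Finset.range (S.L - S.lMin), ((defectives F (S.lMin + d)).card : ℝ) ≤ a)
    {N : ℝ} (hN : 0 < N) :
    frac (fun h : S.Design => ∃ d ≤ S.L - S.lMin, N < (pd F h d).card) ≤
      (54 * M ^ 3 + 1458 * a) / N := by
  have := R.neZero_width
  set x : ℕ → ℝ := fun d => mean (fun h : S.Design => ((pd F h d).card : ℝ)) with hx
  have hx0 : ∀ d, 0 ≤ x d := fun d => mean_nonneg fun h => Nat.cast_nonneg _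
  have hrec : ∀ d, S.lMin + d < S.L →
      x (d + 1) ≤ 729 * (defectives F (S.lMin + d)).card + x d / 2 := by
    intro d hd
    have h1 := mean_card_pd_succ_le hd (hsp _ (by omega) (by omega))
    have h2 := mul_le_mul_of_nonneg_left R.miss_le (hx0 d)
    simp only [hx] at h2 ⊢
    linarith
  -- the term `x D` on the left absorbs the halves `x d / 2` of the recursion
  have hsum : ∀ D ≤ S.L - S.lMin, ∑ d ∈ Finset.range (D + 1), x d + x D
      ≤ 54 * M ^ 3 + 1458 * ∑ d ∈ Finset.range D, ((defectives F (S.lMin + d)).card : ℝ) := by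
    intro D
    induction D with
    | zero =>
      intro _
      have h0 : x 0 ≤ 27 * M ^ 3 := by
        refine (mean_mono fun h => R.card_pd_zero_le F h).trans_eq (mean_const _)
      simp only [zero_add, Finset.sum_range_one, Finset.sum_range_zero]
      linarith
    | succ D ih =>
      intro hD
      have h1 := ih (by omega)
      have h2 := hrec D (by omega)
      rw [Finset.sum_range_succ x (D + 1),
        Finset.sum_range_succ (fun d => ((defectives F (S.lMin + d)).card : ℝ)) D]
      linarith
  calc frac (fun h : S.Design => ∃ d ≤ S.L - S.lMin, N < (pd F h d).card)
      ≤ frac (fun h : S.Design => N ≤ ∑ d ∈ Finset.range (S.L - S.lMin + 1),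
          ((pd F h d).card : ℝ)) := by
        apply frac_mono
        rintro h ⟨d, hd, hlt⟩
        exact hlt.le.trans (Finset.single_le_sum (f := fun d => ((pd F h d).card : ℝ))
          (fun d _ => Nat.cast_nonneg _) (Finset.mem_range.2 (by omega)))
    _ ≤ mean (fun h : S.Design => ∑ d ∈ Finset.range (S.L - S.lMin + 1),
          ((pd F h d).card : ℝ)) / N :=
        frac_ge_le_mean_div (fun h => Finset.sum_nonneg fun d _ => Nat.cast_nonneg _) hN
    _ ≤ _ := by
        apply div_le_div_of_nonneg_right _ hN.le
        rw [mean_sum]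
        have h1 := hsum _ le_rfl
        have h2 := hx0 (S.L - S.lMin)
        simp only [hx] at h1 h2
        linarith

/-- The decoding time in terms of the number of possibly defective triples. -/
lemma decodingTime_le (R : Regime S p M) (F : Finset (Finset (Fin S.n))) (h : S.Design) {N : ℝ}
    (hN : ∀ d ≤ S.L - S.lMin, ((pd F h d).card : ℝ) ≤ N) :
    (decodingTime (F : Set (Finset (Fin S.n))) h : ℝ) ≤ 3 * S.L + 351 * M ^ 3
      + S.L * (N * (8 * S.iters + 30006) + 4) + N * (8 * S.reps S.L + 10) + 4 := by
  have h1 : decodingTime (F : Set (Finset (Fin S.n))) h ≤ 3 * S.lMin + 13 * (3 ^ S.lMin) ^ 3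
      + ∑ d ∈ Finset.range (S.L - S.lMin),
        ((pd F h d).card * (8 * S.reps (S.lMin + d) + 30006) + 4)
      + (pd F h (S.L - S.lMin)).card * (8 * S.reps S.L + 10) + 4 :=
    decode_steps_le S _ _ R.lMin_le
  have h1' : (decodingTime (F : Set (Finset (Fin S.n))) h : ℝ) ≤ 3 * S.lMin
      + 13 * (3 ^ S.lMin) ^ 3 + ∑ d ∈ Finset.range (S.L - S.lMin),
        (((pd F h d).card : ℝ) * (8 * S.reps (S.lMin + d) + 30006) + 4)
      + (pd F h (S.L - S.lMin)).card * (8 * S.reps S.L + 10) + 4 := by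
    exact_mod_cast h1
  have hN0 : 0 ≤ N := (Nat.cast_nonneg _).trans (hN 0 (Nat.zero_le _))
  have h2 : ((3 : ℝ) ^ S.lMin) ^ 3 ≤ (3 * M) ^ 3 := by
    have := R.pow_le
    gcongr
  have h3 : ∑ d ∈ Finset.range (S.L - S.lMin),
      (((pd F h d).card : ℝ) * (8 * S.reps (S.lMin + d) + 30006) + 4)
      ≤ S.L * (N * (8 * S.iters + 30006) + 4) := by
    refine (Finset.sum_le_card_nsmul _ _ (N * (8 * S.iters + 30006) + 4) ?_).trans ?_
    · intro d hd
      have hd' := Finset.mem_range.1 hd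
      rw [reps_of_lt (by omega)]
      have := hN d (by omega)
      gcongr
    · rw [nsmul_eq_mul, Finset.card_range]
      have h2 : ((S.L - S.lMin : ℕ) : ℝ) ≤ S.L := by exact_mod_cast Nat.sub_le _ _
      gcongr
  have h4 : ((pd F h (S.L - S.lMin)).card : ℝ) * (8 * S.reps S.L + 10)
      ≤ N * (8 * S.reps S.L + 10) := by
    have := hN _ le_rfl
    gcongr
  have h5 : (S.lMin : ℝ) ≤ S.L := by exact_mod_cast R.lMin_le
  nlinarith

/-- For a fixed hypergraph, the decoder succeeds within time `T` unless some level has too many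
possibly defective triples or some non-defective triple of vertices is not covered. -/
lemma frac_failure_le (R : Regime S p M) {F : Finset (Finset (Fin S.n))}
    (hF : F ⊆ allEdges S.n) (hsp : Sparse F S.L) {N T ε : ℝ}
    (hfrac : frac (fun h : S.Design => ∃ d ≤ S.L - S.lMin, N < (pd F h d).card) ≤ ε)
    (hT : 3 * S.L + 351 * M ^ 3 + S.L * (N * (8 * S.iters + 30006) + 4)
      + N * (8 * S.reps S.L + 10) + 4 ≤ T) :
    frac (fun h : S.Design => ¬ (estimate (F : Set (Finset (Fin S.n))) h = F ∧
      (decodingTime (F : Set (Finset (Fin S.n))) h : ℝ) ≤ T)) ≤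
      ε + (3 ^ S.L) ^ 3 * Real.exp (-(1 / 10 * (1 / (S.width : ℝ)) ^ 2 * S.reps S.L)) := by
  have := R.neZero_width
  refine le_trans ?_ (add_le_add hfrac (frac_exists_not_covered_le hsp))
  refine le_trans (frac_mono ?_) (frac_or_le _ _)
  intro h hfail
  by_contra hcon
  push Not at hcon
  obtain ⟨h1, h2⟩ := hcon
  exact hfail ⟨estimate_eq F h R.lMin_le R.one_le_lMin (fun e he => mem_allEdges.1 (hF he)) h2,
    (R.decodingTime_le F h h1).trans hT⟩

end Regime

/-! ### From typical hypergraphs to the joint law -/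

/-- The law of the design is the uniform law on the finite type of designs. -/
lemma designLaw_apply [NeZero S.width] (A : Set S.Design) :
    designLaw S A = ENNReal.ofReal (frac fun h => h ∈ A) := by
  classical
  have h1 : designLaw S = uniformOn Set.univ := by
    unfold designLaw
    rw [← uniformOn_pi, Set.pi_univ]
  rw [h1, uniformOn_univ, frac_eq_card, ENNReal.ofReal_div_of_pos (by
    exact_mod_cast Fintype.card_pos), ENNReal.ofReal_natCast, ENNReal.ofReal_natCast,
    Measure.count_apply_finite A (Set.toFinite A), ← Set.toFinset_card]
  congr 3
  ext x
  simp

/-- It suffices to bound the probability that the hypergraph is atypical, and the failure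
probability over the design for each typical hypergraph. -/
lemma one_sub_le_successProb [NeZero S.width] {p : unitInterval} {T ε : ℝ} {η : ENNReal}
    (G : Finset (Finset (Fin S.n)) → Prop)
    (hG : erdosRenyi S.n p {E | ∃ F ⊆ allEdges S.n, (F : Set _) = E ∧ ¬ G F} ≤ η)
    (hfail : ∀ F ⊆ allEdges S.n, G F → frac (fun h : S.Design =>
      ¬ (estimate (F : Set (Finset (Fin S.n))) h = F ∧
        (decodingTime (F : Set (Finset (Fin S.n))) h : ℝ) ≤ T)) ≤ ε) :
    1 - (ENNReal.ofReal ε + η) ≤ successProb S p T := by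
  have hprob : IsProbabilityMeasure (erdosRenyi S.n p) := by
    unfold erdosRenyi
    infer_instance
  have hprob' : IsProbabilityMeasure (designLaw S) := by
    unfold designLaw
    infer_instance
  set B := {E : Set (Finset (Fin S.n)) | ∃ F ⊆ allEdges S.n, (F : Set _) = E ∧ ¬ G F} with hB
  set A := {ω : Set (Finset (Fin S.n)) × S.Design |
    estimate ω.1 ω.2 = ω.1 ∧ (decodingTime ω.1 ω.2 : ℝ) ≤ T} with hA
  have hexp : IsProbabilityMeasure (experiment S p) := by
    unfold experiment
    infer_instance
  have hcompl : experiment S p Aᶜ ≤ ENNReal.ofReal ε + η := by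
    have hmeas : MeasurableSet Aᶜ := (Set.toFinite _).measurableSet
    have hBm : MeasurableSet B := (Set.toFinite _).measurableSet
    unfold experiment
    rw [Measure.prod_apply hmeas]
    calc ∫⁻ E, designLaw S (Prod.mk E ⁻¹' Aᶜ) ∂erdosRenyi S.n p
        ≤ ∫⁻ E, (ENNReal.ofReal ε + B.indicator 1 E) ∂erdosRenyi S.n p := by
          apply lintegral_mono_ae
          have hsub : ∀ᵐ E ∂erdosRenyi S.n p, E ⊆ (allEdges S.n : Set (Finset (Fin S.n))) := by
            rw [erdosRenyi_eq]
            exact setBernoulli_ae_subset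
          filter_upwards [hsub] with E hE
          obtain ⟨F, rfl⟩ : ∃ F : Finset (Finset (Fin S.n)), (F : Set _) = E :=
            ⟨(Set.toFinite E).toFinset, by simp⟩
          have hFU : F ⊆ allEdges S.n := by exact_mod_cast hE
          by_cases hGF : G F
          · rw [designLaw_apply]
            refine le_add_right (ENNReal.ofReal_le_ofReal ?_)
            exact hfail F hFU hGF
          · have : (F : Set (Finset (Fin S.n))) ∈ B := ⟨F, hFU, rfl, hGF⟩
            rw [Set.indicator_of_mem this]
            exact le_add_left prob_le_one
      _ = ENNReal.ofReal ε + erdosRenyi S.n p B := by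
          rw [lintegral_add_left measurable_const, lintegral_indicator_one hBm, lintegral_const,
            measure_univ, mul_one]
      _ ≤ _ := by gcongr
  have h1 : 1 ≤ successProb S p T + experiment S p Aᶜ := by
    have : (1 : ENNReal) = experiment S p Set.univ := measure_univ.symm
    rw [this, ← Set.union_compl_self A]
    exact measure_union_le _ _
  rw [tsub_le_iff_right]
  exact h1.trans (by gcongr)

lemma successProb_le_one [NeZero S.width] (p : unitInterval) (T : ℝ) : successProb S p T ≤ 1 := by
  have hprob : IsProbabilityMeasure (erdosRenyi S.n p) := by
    unfold erdosRenyi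
    infer_instance
  have hprob' : IsProbabilityMeasure (designLaw S) := by
    unfold designLaw
    infer_instance
  unfold successProb experiment
  exact prob_le_one

end HyperLearn

namespace HyperLearn

/-! ### The parameters of the scheme for large `n` -/

lemma pow_three_div_six_le_choose {n : ℕ} (hn : 60 ≤ n) :
    (n : ℝ) ^ 3 / 6 ≤ 11 / 10 * (n.choose 3 : ℝ) := by
  obtain ⟨k, rfl⟩ : ∃ k, n = k + 2 := ⟨n - 2, by omega⟩
  have h1 : (k + 2).descFactorial 3 = Nat.factorial 3 * (k + 2).choose 3 :=
    Nat.descFactorial_eq_factorial_mul_choose _ _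
  have h2 : (k + 2).descFactorial 3 = k * ((k + 1) * (k + 2)) := by
    simp [Nat.descFactorial]
  rw [h2] at h1
  have h3 : (k : ℝ) * ((k + 1) * (k + 2)) = 6 * ((k + 2).choose 3 : ℝ) := by
    exact_mod_cast h1
  have h4 : (58 : ℝ) ≤ k := by exact_mod_cast (by omega : 58 ≤ k)
  have h5 : ((k + 2).choose 3 : ℝ) = k * ((k + 1) * (k + 2)) / 6 := by linarith
  rw [h5]
  push_cast
  have h6 : ((k : ℝ) + 2) ^ 2 ≤ 11 / 10 * (k * (k + 1)) := by nlinarith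
  have h7 : (0 : ℝ) ≤ k + 2 := by linarith
  nlinarith [mul_le_mul_of_nonneg_right h6 h7]

lemma choose_three_le (n : ℕ) : (n.choose 3 : ℝ) ≤ (n : ℝ) ^ 3 := by
  exact_mod_cast Nat.choose_le_pow n 3

lemma one_le_log_three : 1 ≤ Real.log 3 := by
  rw [Real.le_log_iff_exp_le (by norm_num)]
  linarith [Real.exp_one_lt_d9]

lemma exp_neg_fourteen_le : Real.exp (-14) ≤ 1 / 1458 := by
  have h1 : (2 : ℝ) ≤ Real.exp 1 := by linarith [Real.add_one_le_exp (1 : ℝ)]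
  have h2 : (2 : ℝ) ^ 14 ≤ Real.exp 1 ^ 14 := by gcongr
  rw [← Real.exp_nat_mul] at h2
  norm_num at h2
  rw [Real.exp_neg, ← one_div]
  exact one_div_le_one_div_of_le (by norm_num) (by linarith)

/-- The sizes of the parameters of the scheme once `n` is large; `M` is the cube root of the
expected number of hyperedges. -/
structure Large (C₁ C₂ C' : ℝ) (S : Scheme) (p : unitInterval) (M : ℝ) : Prop where
  regime : Regime S p M
  one_le_L : (1 : ℝ) ≤ S.L
  L_le_log : (S.L : ℝ) ≤ Real.log ((3 : ℝ) ^ S.L)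
  width_le : (S.width : ℝ) ≤ 2 * C₁ * M
  one_le_iters : (1 : ℝ) ≤ S.iters
  iters_le : (S.iters : ℝ) ≤ 2 * C₂ * M ^ 2
  one_le_rounds : (1 : ℝ) ≤ S.rounds
  rounds_le : (S.rounds : ℝ) ≤ 2 * C' * Real.log ((3 : ℝ) ^ S.L)
  reps_eq : S.reps S.L = S.rounds * S.iters
  decay : 4 * Real.log ((3 : ℝ) ^ S.L) ≤ 1 / 10 * (1 / (S.width : ℝ)) ^ 2 * S.reps S.L

/-- The constants of the scheme satisfy all the requirements: `C₁ ≥ 155` makes the tests sparse,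
`C₂ = C₁ ^ 3` makes `iters / width ^ 2` at least `140`, and `C' > 4` provides the decay
`n ^ (-4)` that beats the number of triples of vertices. -/
lemma large_scheme {C₁ C₂ C' : ℝ} (hC₁ : 155 ≤ C₁) (hC₂ : C₂ = C₁ ^ 3) (hC' : 4 < C') {L : ℕ}
    (hL : 4 ≤ L) (p : unitInterval) {m M : ℝ} (hm : m = meanEdges (3 ^ L) p)
    (hM : M = m ^ (1 / 3 : ℝ)) (hM1 : 1 < M) : Large C₁ C₂ C' (scheme C₁ C₂ C' L m) p M := by
  have hm0 : 0 ≤ m := by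
    rw [hm]
    exact mul_nonneg p.2.1 (Nat.cast_nonneg _)
  have hM3 : M ^ 3 = m := by
    rw [hM, ← Real.rpow_natCast, ← Real.rpow_mul hm0]
    norm_num
  have hM2 : m ^ (2 / 3 : ℝ) = M ^ 2 := by
    rw [hM, ← Real.rpow_natCast, ← Real.rpow_mul hm0]
    norm_num
  have hMpos : 0 < M := by linarith
  have hcast : (((3 ^ L : ℕ) : ℕ) : ℝ) = (3 : ℝ) ^ L := by push_cast; rfl
  set S := scheme C₁ C₂ C' L m with hS
  have hSL : S.L = L := rfl
  have hSw : S.width = ⌈C₁ * M⌉₊ := by rw [hM]; rfl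
  have hSi : S.iters = ⌈C₂ * M ^ 2⌉₊ := by rw [← hM2]; rfl
  have hSr : S.rounds = ⌈C' * Real.log ((3 : ℝ) ^ L)⌉₊ := by rw [← hcast]; rfl
  have hSm : S.lMin = ⌈Real.logb 3 M⌉₊ := by rw [hM]; rfl
  have hC₂pos : 0 < C₂ := by rw [hC₂]; positivity
  have hlogM : 0 < Real.logb 3 M := Real.logb_pos (by norm_num) hM1
  have hrM : (3 : ℝ) ^ Real.logb 3 M = M := Real.rpow_logb (by norm_num) (by norm_num) hMpos
  -- the number of tests of an iteration
  have hw1 : C₁ * M ≤ S.width := by rw [hSw]; exact Nat.le_ceil _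
  have hw2 : (S.width : ℝ) ≤ C₁ * M + 1 := by
    rw [hSw]
    exact (Nat.ceil_lt_add_one (by positivity)).le
  have hCM : 155 ≤ C₁ * M := by nlinarith
  have hwpos : (0 : ℝ) < S.width := by linarith
  -- the number of iterations
  have hi1 : C₂ * M ^ 2 ≤ S.iters := by rw [hSi]; exact Nat.le_ceil _
  have hi2 : (S.iters : ℝ) ≤ C₂ * M ^ 2 + 1 := by
    rw [hSi]
    exact (Nat.ceil_lt_add_one (by positivity)).le
  have hM2' : 1 ≤ M ^ 2 := by nlinarith
  have hC₂1 : 1 ≤ C₂ := by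
    rw [hC₂]
    exact one_le_pow₀ (by linarith)
  have hCM2 : 1 ≤ C₂ * M ^ 2 := by nlinarith
  -- `iters / width ^ 2` is about `C₁`
  have hratio : 14 ≤ 1 / 10 * (1 / (S.width : ℝ)) ^ 2 * S.iters := by
    have h1 : (S.width : ℝ) ^ 2 ≤ 11 / 10 * (C₁ * M) ^ 2 := by
      have : (S.width : ℝ) ^ 2 ≤ (C₁ * M + 1) ^ 2 := by gcongr
      nlinarith
    have h2 : 14 * (10 * (S.width : ℝ) ^ 2) ≤ S.iters := by
      have h3 : 155 * (C₁ * M) ^ 2 ≤ C₂ * M ^ 2 := by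
        rw [hC₂]
        have : 0 ≤ (C₁ * M) ^ 2 := by positivity
        nlinarith
      have h4 : 0 ≤ (C₁ * M) ^ 2 := by positivity
      linarith
    have h5 : 1 / 10 * (1 / (S.width : ℝ)) ^ 2 * S.iters = S.iters / (10 * (S.width : ℝ) ^ 2) := by
      field_simp
    rw [h5, le_div_iff₀ (by positivity)]
    exact h2
  have hL4 : (4 : ℝ) ≤ L := by exact_mod_cast hL
  have hLlog : (L : ℝ) ≤ Real.log ((3 : ℝ) ^ L) := by
    rw [Real.log_pow]
    nlinarith [one_le_log_three]
  have hr1 : C' * Real.log ((3 : ℝ) ^ L) ≤ S.rounds := by rw [hSr]; exact Nat.le_ceil _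
  have hClog : 1 ≤ C' * Real.log ((3 : ℝ) ^ L) := by nlinarith
  have hr2 : (S.rounds : ℝ) ≤ C' * Real.log ((3 : ℝ) ^ L) + 1 := by
    rw [hSr]
    exact (Nat.ceil_lt_add_one (by positivity)).le
  -- the coarsest level
  have hlMin : S.lMin ≤ S.L := by
    rw [hSm, hSL, Nat.ceil_le, Real.logb_le_iff_le_rpow (by norm_num) hMpos, Real.rpow_natCast]
    have h1 : m ≤ ((3 : ℝ) ^ L) ^ 3 := by
      rw [hm, meanEdges]
      have h2 := choose_three_le (3 ^ L)
      rw [hcast] at h2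
      have h3 : (p : ℝ) * ((3 ^ L).choose 3 : ℝ) ≤ 1 * ((3 ^ L).choose 3 : ℝ) :=
        mul_le_mul_of_nonneg_right p.2.2 (Nat.cast_nonneg _)
      linarith
    rw [← hM3] at h1
    exact le_of_pow_le_pow_left₀ (by norm_num) (by positivity) h1
  have hreps : S.reps S.L = S.rounds * S.iters := by
    unfold Scheme.reps
    rw [if_neg (by omega), if_pos rfl]
  refine ⟨⟨hM1.le, ?_, hlMin, ?_, ?_, ?_, ?_, ?_⟩, ?_, hLlog, ?_, ?_, ?_, ?_, ?_, hreps, ?_⟩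
  · rw [hSm]
    exact Nat.one_le_ceil_iff.2 hlogM
  · calc M = (3 : ℝ) ^ Real.logb 3 M := hrM.symm
      _ ≤ (3 : ℝ) ^ (S.lMin : ℝ) := by
        apply Real.rpow_le_rpow_of_exponent_le (by norm_num)
        rw [hSm]
        exact Nat.le_ceil _
      _ = _ := Real.rpow_natCast _ _
  · calc (3 : ℝ) ^ S.lMin = (3 : ℝ) ^ (S.lMin : ℝ) := (Real.rpow_natCast _ _).symm
      _ ≤ (3 : ℝ) ^ (Real.logb 3 M + 1) := by
        apply Real.rpow_le_rpow_of_exponent_le (by norm_num)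
        rw [hSm]
        exact (Nat.ceil_lt_add_one hlogM.le).le
      _ = 3 * M := by
        rw [Real.rpow_add (by norm_num), hrM, Real.rpow_one, mul_comm]
  · nlinarith
  · rw [hM3, hm, meanEdges]
    have h60 : 60 ≤ 3 ^ L := le_trans (by norm_num) (Nat.pow_le_pow_right (by norm_num) hL)
    have h1 := pow_three_div_six_le_choose h60
    rw [hcast] at h1
    have h2 := mul_le_mul_of_nonneg_left h1 p.2.1
    rw [hSL]
    linarith
  · refine le_trans (Real.exp_le_exp.2 ?_) exp_neg_fourteen_le
    linarith
  · rw [hSL]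
    linarith
  · linarith
  · linarith
  · linarith
  · linarith
  · rw [hSL]
    linarith
  · rw [hreps]
    push_cast
    have h1 : 0 ≤ Real.log ((3 : ℝ) ^ L) := by linarith
    have h2 : 4 * Real.log ((3 : ℝ) ^ L) ≤ S.rounds :=
      (mul_le_mul_of_nonneg_right hC'.le h1).trans hr1
    have h3 : 14 * (4 * Real.log ((3 : ℝ) ^ L))
        ≤ 1 / 10 * (1 / (S.width : ℝ)) ^ 2 * S.iters * S.rounds :=
      mul_le_mul hratio h2 (by linarith) ((by norm_num : (0 : ℝ) ≤ 14).trans hratio)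
    rw [hSL, mul_comm (S.rounds : ℝ), ← mul_assoc]
    exact le_trans (by linarith) h3

namespace Large

variable {C₁ C₂ C' : ℝ} {S : Scheme} {p : unitInterval} {M : ℝ}

lemma numTests_le (B : Large C₁ C₂ C' S p M) :
    (S.numTests : ℝ) ≤ (8 + 8 * C') * C₁ * C₂ * (M ^ 3 * Real.log ((3 : ℝ) ^ S.L)) := by
  have hM := B.regime.one_le
  set l := Real.log ((3 : ℝ) ^ S.L) with hl
  have hl1 : 1 ≤ l := B.one_le_L.trans B.L_le_log
  have h1 : S.numTests ≤ (S.L + 1) * (S.iters * S.width) + S.reps S.L * S.width := by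
    unfold Scheme.numTests
    rw [Finset.sum_range_succ]
    apply Nat.add_le_add_right
    calc ∑ ℓ ∈ Finset.range S.L, S.reps ℓ * S.width
        ≤ ∑ ℓ ∈ Finset.range S.L, S.iters * S.width := by
          apply Finset.sum_le_sum
          intro ℓ hℓ
          apply Nat.mul_le_mul_right
          unfold Scheme.reps
          have := Finset.mem_range.1 hℓ
          split_ifs
          · exact Nat.zero_le _
          · omega
          · exact le_rfl
      _ ≤ _ := by
          rw [Finset.sum_const, Finset.card_range, smul_eq_mul]
          exact Nat.mul_le_mul_right _ (Nat.le_succ _)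
  rw [B.reps_eq] at h1
  have h2 : (S.numTests : ℝ) ≤ (S.L + 1) * (S.iters * S.width)
      + S.rounds * S.iters * S.width := by exact_mod_cast h1
  have h3 : (S.iters : ℝ) * S.width ≤ (2 * C₂ * M ^ 2) * (2 * C₁ * M) :=
    mul_le_mul B.iters_le B.width_le (Nat.cast_nonneg _) ((Nat.cast_nonneg _).trans B.iters_le)
  have h4 : (0 : ℝ) ≤ S.iters * S.width := by positivity
  have h5 : (S.L : ℝ) + 1 ≤ 2 * l := by linarith [B.L_le_log]
  have h6 : ((S.L : ℝ) + 1) * (S.iters * S.width) ≤ 2 * l * ((2 * C₂ * M ^ 2) * (2 * C₁ * M)) :=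
    mul_le_mul h5 h3 h4 (by positivity)
  have h7 : (S.rounds : ℝ) * (S.iters * S.width)
      ≤ 2 * C' * l * ((2 * C₂ * M ^ 2) * (2 * C₁ * M)) :=
    mul_le_mul B.rounds_le h3 h4 ((Nat.cast_nonneg _).trans B.rounds_le)
  calc (S.numTests : ℝ) ≤ _ := h2
    _ ≤ 2 * l * ((2 * C₂ * M ^ 2) * (2 * C₁ * M))
        + 2 * C' * l * ((2 * C₂ * M ^ 2) * (2 * C₁ * M)) := by
        rw [mul_assoc (S.rounds : ℝ)]
        exact add_le_add h6 h7
    _ = _ := by ring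

/-- The decoding time if all levels have at most `κ M ^ 3 s` possibly defective triples. -/
lemma time_le (B : Large C₁ C₂ C' S p M) {κ s : ℝ} (hκ : 0 ≤ κ) (hs : 1 ≤ s) :
    3 * S.L + 351 * M ^ 3 + S.L * (κ * M ^ 3 * s * (8 * S.iters + 30006) + 4)
      + κ * M ^ 3 * s * (8 * S.reps S.L + 10) + 4
      ≤ (362 + κ * (60028 * C₂ + 72 * C' * C₂)) * (M ^ 5 * s * Real.log ((3 : ℝ) ^ S.L)) := by
  have hM := B.regime.one_le
  set l := Real.log ((3 : ℝ) ^ S.L) with hl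
  have hl1 : 1 ≤ l := B.one_le_L.trans B.L_le_log
  have hiters := B.one_le_iters
  have hiters' := B.iters_le
  have hM2 : 1 ≤ M ^ 2 := one_le_pow₀ hM
  have hM3 : 1 ≤ M ^ 3 := one_le_pow₀ hM
  have hM5 : 1 ≤ M ^ 5 := one_le_pow₀ hM
  set Z := M ^ 5 * s * l with hZ
  have hlZ : l ≤ Z := by
    have : 1 * 1 ≤ M ^ 5 * s := mul_le_mul hM5 hs (by norm_num) (by linarith)
    nlinarith
  have hL : (S.L : ℝ) ≤ l := B.L_le_log
  have h1 : 3 * (S.L : ℝ) ≤ 3 * Z := by linarith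
  have h2 : M ^ 3 ≤ Z := by
    have e : Z = M ^ 3 * (M ^ 2 * s * l) := by rw [hZ]; ring
    rw [e]
    apply le_mul_of_one_le_right (by linarith)
    exact one_le_mul_of_one_le_of_one_le (one_le_mul_of_one_le_of_one_le hM2 hs) hl1
  have h3 : 1 ≤ Z := hl1.trans hlZ
  have hN : 0 ≤ κ * M ^ 3 * s := by positivity
  have h4 : (S.L : ℝ) * (κ * M ^ 3 * s * (8 * S.iters + 30006))
      ≤ l * (κ * M ^ 3 * s * (30014 * (2 * C₂ * M ^ 2))) := by
    have : 8 * (S.iters : ℝ) + 30006 ≤ 30014 * (2 * C₂ * M ^ 2) := by linarith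
    gcongr
  have hreps : (S.reps S.L : ℝ) ≤ 2 * C' * l * (2 * C₂ * M ^ 2) := by
    rw [B.reps_eq]
    push_cast
    exact mul_le_mul B.rounds_le hiters' (Nat.cast_nonneg _)
      ((Nat.cast_nonneg _).trans B.rounds_le)
  have hreps1 : (1 : ℝ) ≤ S.reps S.L := by
    rw [B.reps_eq]
    push_cast
    exact one_le_mul_of_one_le_of_one_le B.one_le_rounds hiters
  have h5 : κ * M ^ 3 * s * (8 * S.reps S.L + 10)
      ≤ κ * M ^ 3 * s * (18 * (2 * C' * l * (2 * C₂ * M ^ 2))) := by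
    have : 8 * (S.reps S.L : ℝ) + 10 ≤ 18 * (2 * C' * l * (2 * C₂ * M ^ 2)) := by linarith
    gcongr
  have e4 : l * (κ * M ^ 3 * s * (30014 * (2 * C₂ * M ^ 2))) = κ * (60028 * C₂) * Z := by
    rw [hZ]; ring
  have e5 : κ * M ^ 3 * s * (18 * (2 * C' * l * (2 * C₂ * M ^ 2))) = κ * (72 * C' * C₂) * Z := by
    rw [hZ]; ring
  linarith

lemma neZero_width (B : Large C₁ C₂ C' S p M) : NeZero S.width := B.regime.neZero_width

/-- The failure probability of the finest level. -/
lemma cover_failure_le (B : Large C₁ C₂ C' S p M) :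
    ((3 : ℝ) ^ S.L) ^ 3 * Real.exp (-(1 / 10 * (1 / (S.width : ℝ)) ^ 2 * S.reps S.L))
      ≤ 1 / S.L := by
  have hX : (0 : ℝ) < 3 ^ S.L := by positivity
  have h1 : Real.exp (-(1 / 10 * (1 / (S.width : ℝ)) ^ 2 * S.reps S.L))
      ≤ Real.exp (-(4 * Real.log ((3 : ℝ) ^ S.L))) := Real.exp_le_exp.2 (by linarith [B.decay])
  have h2 : Real.exp (-(4 * Real.log ((3 : ℝ) ^ S.L))) = (((3 : ℝ) ^ S.L) ^ 4)⁻¹ := by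
    rw [Real.exp_neg, mul_comm, Real.exp_mul, Real.exp_log hX]
    norm_cast
  have h3 : (S.L : ℝ) ≤ 3 ^ S.L := B.L_le_log.trans ((Real.log_le_sub_one_of_pos hX).trans
    (by linarith))
  have hL := B.one_le_L
  calc _ ≤ ((3 : ℝ) ^ S.L) ^ 3 * (((3 : ℝ) ^ S.L) ^ 4)⁻¹ := by
        rw [← h2]
        gcongr
    _ = 1 / 3 ^ S.L := by field_simp
    _ ≤ _ := one_div_le_one_div_of_le (by linarith) h3

/-- All levels are sparse with high probability, because `M` grows like a power of `n`. -/
lemma prob_exists_not_sparse_le (B : Large C₁ C₂ C' S p M) :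
    erdosRenyi S.n p {E | ∃ F ⊆ allEdges S.n, (F : Set _) = E ∧
      ¬ ∀ ℓ, S.lMin ≤ ℓ → ℓ ≤ S.L → Sparse F ℓ}
      ≤ ENNReal.ofReal (2 * (S.L * (((3 : ℝ) ^ S.L) ^ 3 * Real.exp (-M)))) := by
  have R := B.regime
  have hM := R.one_le
  set b : ℝ := ((3 : ℝ) ^ S.L) ^ 3 * Real.exp (-(3 / 10 * S.width)) with hb
  have hb' : b ≤ ((3 : ℝ) ^ S.L) ^ 3 * Real.exp (-M) := by
    have h1 : Real.exp (-(3 / 10 * S.width)) ≤ Real.exp (-M) :=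
      Real.exp_le_exp.2 (by linarith [R.width_ge])
    exact mul_le_mul_of_nonneg_left h1 (by positivity)
  have hsub : {E : Set (Finset (Fin S.n)) | ∃ F ⊆ allEdges S.n, (F : Set _) = E ∧
      ¬ ∀ ℓ, S.lMin ≤ ℓ → ℓ ≤ S.L → Sparse F ℓ} ⊆ ⋃ ℓ ∈ Finset.Icc S.lMin S.L,
      {E : Set (Finset (Fin S.n)) | ∃ F ⊆ allEdges S.n, (F : Set _) = E ∧ ¬ Sparse F ℓ} := by
    rintro E ⟨F, hF, rfl, hns⟩
    push Not at hns
    obtain ⟨ℓ, h1, h2, h3⟩ := hns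
    simp only [Set.mem_iUnion]
    exact ⟨ℓ, Finset.mem_Icc.2 ⟨h1, h2⟩, F, hF, rfl, h3⟩
  refine (measure_mono hsub).trans ((measure_biUnion_finset_le _ _).trans ?_)
  calc _ ≤ ∑ ℓ ∈ Finset.Icc S.lMin S.L, ENNReal.ofReal b := by
        apply Finset.sum_le_sum
        intro ℓ hℓ
        obtain ⟨h1, h2⟩ := Finset.mem_Icc.1 hℓ
        exact R.prob_not_sparse_le h1 h2
    _ = ENNReal.ofReal ((Finset.Icc S.lMin S.L).card * b) := by
        rw [Finset.sum_const, nsmul_eq_mul, ENNReal.ofReal_mul (Nat.cast_nonneg _),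
          ENNReal.ofReal_natCast]
    _ ≤ _ := by
        apply ENNReal.ofReal_le_ofReal
        have h1 : ((Finset.Icc S.lMin S.L).card : ℝ) ≤ S.L + 1 := by
          rw [Nat.card_Icc]
          exact_mod_cast Nat.sub_le _ _
        have h2 : (0 : ℝ) ≤ b := by positivity
        have hL := B.one_le_L
        have h3 : ((Finset.Icc S.lMin S.L).card : ℝ) ≤ 2 * S.L := by linarith
        calc _ ≤ 2 * (S.L : ℝ) * b := by gcongr
          _ ≤ 2 * (S.L : ℝ) * (((3 : ℝ) ^ S.L) ^ 3 * Real.exp (-M)) := by gcongr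
          _ = _ := by ring

/-- The probability that some level has many defective triples; this is small if the expected number
of hyperedges `M ^ 3` is much larger than `n ^ 2`. -/
lemma prob_exists_defectives_gt_le (B : Large C₁ C₂ C' S p M) :
    erdosRenyi S.n p {E | ∃ F ⊆ allEdges S.n, (F : Set _) = E ∧
      ¬ ∀ ℓ, S.lMin ≤ ℓ → ℓ ≤ S.L → ((defectives F ℓ).card : ℝ) ≤ 69 * M ^ 3}
      ≤ ENNReal.ofReal (2 * (S.L * ((3 ^ S.L) ^ 2 / M ^ 3))) := by
  have R := B.regime
  have hM := R.one_le
  set b : ℝ := Real.exp (-(M ^ 3 / (3 ^ S.L) ^ 2)) with hb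
  have hb' : b ≤ (3 ^ S.L) ^ 2 / M ^ 3 := by
    have h1 : 0 < M ^ 3 / (3 ^ S.L) ^ 2 := by positivity
    have h2 : M ^ 3 / (3 ^ S.L) ^ 2 ≤ Real.exp (M ^ 3 / (3 ^ S.L) ^ 2) := by
      linarith [Real.add_one_le_exp (M ^ 3 / (3 ^ S.L) ^ 2)]
    rw [hb, Real.exp_neg]
    exact (inv_anti₀ h1 h2).trans_eq (inv_div _ _)
  have hsub : {E : Set (Finset (Fin S.n)) | ∃ F ⊆ allEdges S.n, (F : Set _) = E ∧
      ¬ ∀ ℓ, S.lMin ≤ ℓ → ℓ ≤ S.L → ((defectives F ℓ).card : ℝ) ≤ 69 * M ^ 3}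
      ⊆ ⋃ ℓ ∈ Finset.Icc S.lMin S.L,
      {E : Set (Finset (Fin S.n)) | ∃ F ⊆ allEdges S.n, (F : Set _) = E ∧
        69 * M ^ 3 ≤ (defectives F ℓ).card} := by
    rintro E ⟨F, hF, rfl, hns⟩
    push Not at hns
    obtain ⟨ℓ, h1, h2, h3⟩ := hns
    simp only [Set.mem_iUnion]
    exact ⟨ℓ, Finset.mem_Icc.2 ⟨h1, h2⟩, F, hF, rfl, h3.le⟩
  refine (measure_mono hsub).trans ((measure_biUnion_finset_le _ _).trans ?_)
  calc _ ≤ ∑ ℓ ∈ Finset.Icc S.lMin S.L, ENNReal.ofReal b := by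
        apply Finset.sum_le_sum
        intro ℓ hℓ
        exact R.prob_defectives_ge_le (Finset.mem_Icc.1 hℓ).2
    _ = ENNReal.ofReal ((Finset.Icc S.lMin S.L).card * b) := by
        rw [Finset.sum_const, nsmul_eq_mul, ENNReal.ofReal_mul (Nat.cast_nonneg _),
          ENNReal.ofReal_natCast]
    _ ≤ _ := by
        apply ENNReal.ofReal_le_ofReal
        have h1 : ((Finset.Icc S.lMin S.L).card : ℝ) ≤ S.L + 1 := by
          rw [Nat.card_Icc]
          exact_mod_cast Nat.sub_le _ _
        have h2 : (0 : ℝ) ≤ b := (Real.exp_pos _).le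
        have hL := B.one_le_L
        have h3 : ((Finset.Icc S.lMin S.L).card : ℝ) ≤ 2 * S.L := by linarith
        calc _ ≤ 2 * (S.L : ℝ) * b := by gcongr
          _ ≤ 2 * (S.L : ℝ) * ((3 ^ S.L) ^ 2 / M ^ 3) := by gcongr
          _ = _ := by ring

lemma iters_mul_le (B : Large C₁ C₂ C' S p M) :
    (S.iters : ℝ) * (1 / (S.width : ℝ)) ^ 4 ≤ 2 * C₂ * (1 / M) := by
  have hM := B.regime.one_le
  have hMpos : 0 < M := by linarith
  have hw : M ≤ S.width := by linarith [B.regime.width_ge]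
  have h1 : 1 / (S.width : ℝ) ≤ 1 / M := one_div_le_one_div_of_le hMpos hw
  have hC : 0 ≤ 2 * C₂ * M ^ 2 := (Nat.cast_nonneg _).trans B.iters_le
  have hC2 : 0 ≤ 2 * C₂ := by
    by_contra h
    have : 0 < M ^ 2 := by positivity
    nlinarith
  calc (S.iters : ℝ) * (1 / (S.width : ℝ)) ^ 4 ≤ 2 * C₂ * M ^ 2 * (1 / M) ^ 4 := by
        have := B.iters_le
        gcongr
    _ = 2 * C₂ * ((1 / M) * (1 / M)) := by field_simp
    _ ≤ 2 * C₂ * ((1 / M) * 1) := by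
        have : 1 / M ≤ 1 := (div_le_one hMpos).2 hM
        gcongr
    _ = _ := by ring

/-- Success within time `O(M ^ 5 log n)`; the error is small if `M ^ 3` is much larger than
`n ^ 2`. -/
lemma le_successProb_dense (B : Large C₁ C₂ C' S p M) :
    1 - ENNReal.ofReal ((102060 ^ 2 * (2 * C₂) * (S.L * (1 / M))
        + (102060 * 9 + 2) * (S.L * ((3 ^ S.L) ^ 2 / M ^ 3)) + 1 / S.L)
        + 2 * (S.L * (((3 : ℝ) ^ S.L) ^ 3 * Real.exp (-M))))
      ≤ successProb S p ((362 + 102060 * (60028 * C₂ + 72 * C' * C₂))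
        * (M ^ 5 * Real.log ((3 : ℝ) ^ S.L))) := by
  have R := B.regime
  have := B.neZero_width
  have hM := R.one_le
  set ε : ℝ := S.L * (102060 ^ 2 * (S.iters * (1 / (S.width : ℝ)) ^ 4)
        + 102060 * 9 * ((3 ^ S.L) ^ 2 / M ^ 3)) with hε
  set η₁ : ℝ := 2 * (S.L * (((3 : ℝ) ^ S.L) ^ 3 * Real.exp (-M))) with hη₁
  set η₂ : ℝ := 2 * (S.L * ((3 ^ S.L) ^ 2 / M ^ 3)) with hη₂
  have hε0 : 0 ≤ ε := by positivity
  have hη₁0 : 0 ≤ η₁ := by positivity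
  have hη₂0 : 0 ≤ η₂ := by positivity
  have hεle : ε ≤ 102060 ^ 2 * (2 * C₂) * (S.L * (1 / M))
      + 102060 * 9 * (S.L * ((3 ^ S.L) ^ 2 / M ^ 3)) := by
    have h1 := mul_le_mul_of_nonneg_left B.iters_mul_le
      (by positivity : (0 : ℝ) ≤ S.L * 102060 ^ 2)
    rw [hε]
    linarith
  have hL0 : (0 : ℝ) ≤ 1 / S.L := by positivity
  refine le_trans ?_ (one_sub_le_successProb (p := p) (ε := ε + 1 / S.L)
    (η := ENNReal.ofReal η₁ + ENNReal.ofReal η₂)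
    (fun F => (∀ ℓ, S.lMin ≤ ℓ → ℓ ≤ S.L → Sparse F ℓ) ∧
      ∀ ℓ, S.lMin ≤ ℓ → ℓ ≤ S.L → ((defectives F ℓ).card : ℝ) ≤ 69 * M ^ 3) ?_ ?_)
  · apply tsub_le_tsub_left
    rw [← ENNReal.ofReal_add hη₁0 hη₂0, ← ENNReal.ofReal_add (by positivity) (by positivity)]
    apply ENNReal.ofReal_le_ofReal
    linarith
  · refine (measure_mono ?_).trans ((measure_union_le _ _).trans
      (add_le_add B.prob_exists_not_sparse_le B.prob_exists_defectives_gt_le))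
    rintro E ⟨F, hF, rfl, hG⟩
    rcases not_and_or.1 hG with h | h
    · exact Or.inl ⟨F, hF, rfl, h⟩
    · exact Or.inr ⟨F, hF, rfl, h⟩
  · rintro F hF ⟨hsp, hdef⟩
    refine (R.frac_failure_le hF (hsp S.L R.lMin_le le_rfl)
      (R.frac_exists_card_pd_gt_le hsp hdef) ?_).trans
      (add_le_add le_rfl B.cover_failure_le)
    have := B.time_le (κ := 102060) (s := 1) (by norm_num) le_rfl
    simpa only [mul_one] using this

/-- Success within time `O(M ^ 5 L ^ 2 log n)`, for any expected number of hyperedges. -/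
lemma le_successProb_general (B : Large C₁ C₂ C' S p M) :
    1 - ENNReal.ofReal ((54 * (1 / S.L) + 1488 * (1 / √(S.L : ℝ)) + 1 / S.L)
        + 2 * (S.L * (((3 : ℝ) ^ S.L) ^ 3 * Real.exp (-M))))
      ≤ successProb S p ((362 + 1 * (60028 * C₂ + 72 * C' * C₂))
        * (M ^ 5 * (S.L : ℝ) ^ 2 * Real.log ((3 : ℝ) ^ S.L))) := by
  have R := B.regime
  have := B.neZero_width
  have hM := R.one_le
  have hL1 := B.one_le_L
  set l : ℝ := (S.L : ℝ) with hl
  have hlpos : 0 < l := by linarith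
  have hsq : 0 < √l := Real.sqrt_pos.2 hlpos
  have hsql : √l * √l = l := Real.mul_self_sqrt hlpos.le
  have hM3 : 0 < M ^ 3 := by positivity
  -- any `a` with `l * M ^ 3 ≪ a ≪ l ^ 2 * M ^ 3` makes both applications of Markov's inequality
  -- effective
  set a : ℝ := M ^ 3 * (l * √l) with ha
  have hapos : 0 < a := by positivity
  set η₁ : ℝ := 2 * (l * (((3 : ℝ) ^ S.L) ^ 3 * Real.exp (-M))) with hη₁
  have hη₁0 : 0 ≤ η₁ := by positivity
  have hη₂ : l * (30 * M ^ 3) / a = 30 * (1 / √l) := by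
    rw [ha]
    field_simp
  have hε : (54 * M ^ 3 + 1458 * a) / (1 * M ^ 3 * l ^ 2) ≤ 54 * (1 / l) + 1458 * (1 / √l) := by
    have h1 : (54 * M ^ 3 + 1458 * a) / (1 * M ^ 3 * l ^ 2)
        = 54 * (1 / l ^ 2) + 1458 * (√l / l) := by
      rw [ha]
      field_simp
    have h2 : √l / l = 1 / √l := by
      rw [div_eq_div_iff hlpos.ne' hsq.ne', one_mul]
      exact hsql
    have h3 : 1 / l ^ 2 ≤ 1 / l :=
      one_div_le_one_div_of_le hlpos (by nlinarith)
    rw [h1, h2]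
    linarith
  refine le_trans ?_ (one_sub_le_successProb (p := p)
    (ε := (54 * (1 / l) + 1458 * (1 / √l)) + 1 / l)
    (η := ENNReal.ofReal η₁ + ENNReal.ofReal (30 * (1 / √l)))
    (fun F => (∀ ℓ, S.lMin ≤ ℓ → ℓ ≤ S.L → Sparse F ℓ) ∧
      ∑ d ∈ Finset.range (S.L - S.lMin), ((defectives F (S.lMin + d)).card : ℝ) ≤ a) ?_ ?_)
  · apply tsub_le_tsub_left
    rw [← ENNReal.ofReal_add hη₁0 (by positivity), ← ENNReal.ofReal_add (by positivity)
      (by positivity)]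
    apply ENNReal.ofReal_le_ofReal
    linarith
  · rw [← hη₂]
    refine (measure_mono ?_).trans ((measure_union_le _ _).trans
      (add_le_add B.prob_exists_not_sparse_le (R.prob_sum_defectives_ge_le hapos)))
    rintro E ⟨F, hF, rfl, hG⟩
    rcases not_and_or.1 hG with h | h
    · exact Or.inl ⟨F, hF, rfl, h⟩
    · exact Or.inr ⟨F, hF, rfl, (not_le.1 h).le⟩
  · rintro F hF ⟨hsp, hdef⟩
    refine (R.frac_failure_le hF (hsp S.L R.lMin_le le_rfl)
      ((R.frac_exists_card_pd_gt_le_of_sum hsp hdef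
        (N := 1 * M ^ 3 * l ^ 2) (by positivity)).trans hε) ?_).trans
      (add_le_add le_rfl B.cover_failure_le)
    exact B.time_le (κ := 1) (s := l ^ 2) (by norm_num) (one_le_pow₀ hL1)

end Large

end HyperLearn

namespace HyperLearn

/-! ### Asymptotics -/

lemma successProb_mono (S : Scheme) (p : unitInterval) {T T' : ℝ} (h : T ≤ T') :
    successProb S p T ≤ successProb S p T' :=
  measure_mono fun _ hω => ⟨hω.1, hω.2.trans h⟩

lemma tendsto_one_of_one_sub_le {f : ℕ → ENNReal} {δ : ℕ → ℝ} (hδ : Tendsto δ atTop (𝓝 0))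
    (h1 : ∀ᶠ L in atTop, 1 - ENNReal.ofReal (δ L) ≤ f L) (h2 : ∀ᶠ L in atTop, f L ≤ 1) :
    Tendsto f atTop (𝓝 1) := by
  have h3 : Tendsto (fun L => 1 - ENNReal.ofReal (δ L)) atTop (𝓝 1) := by
    have h4 := ENNReal.Tendsto.sub (tendsto_const_nhds (x := (1 : ENNReal)) (f := atTop))
      (ENNReal.tendsto_ofReal hδ) (Or.inl ENNReal.one_ne_top)
    simpa using h4
  exact tendsto_of_tendsto_of_tendsto_of_le_of_le' h3 tendsto_const_nhds h1 h2

lemma tendsto_nat_div_pow {A : ℝ} (hA : 1 < A) :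
    Tendsto (fun L : ℕ => (L : ℝ) / A ^ L) atTop (𝓝 0) := by
  simpa using tendsto_pow_const_div_const_pow_of_one_lt 1 hA

section Growth

variable {M : ℕ → ℝ} {c r : ℝ}

lemma tendsto_nat_div_of_pow_le (hc : 0 < c) (hr : 1 < r) (h : ∀ᶠ L in atTop, c * r ^ L ≤ M L) :
    Tendsto (fun L : ℕ => (L : ℝ) * (1 / M L)) atTop (𝓝 0) := by
  have h1 : Tendsto (fun L : ℕ => c⁻¹ * ((L : ℝ) / r ^ L)) atTop (𝓝 0) := by
    simpa using (tendsto_nat_div_pow hr).const_mul c⁻¹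
  refine squeeze_zero' ?_ ?_ h1
  · filter_upwards [h] with L hL
    have : 0 < c * r ^ L := by positivity
    have : 0 < M L := by linarith
    positivity
  · filter_upwards [h] with L hL
    have h2 : 0 < c * r ^ L := by positivity
    calc (L : ℝ) * (1 / M L) ≤ L * (1 / (c * r ^ L)) := by gcongr
      _ = _ := by field_simp

/-- The condition `9 < r ^ 3` with `r = 3 ^ θ` means `2 / 3 < θ`: there are many more than `n ^ 2`
hyperedges. -/
lemma tendsto_mul_sq_div_of_pow_le (hc : 0 < c) (hr : 1 < r) (hr3 : 9 < r ^ 3)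
    (h : ∀ᶠ L in atTop, c * r ^ L ≤ M L) :
    Tendsto (fun L : ℕ => (L : ℝ) * ((3 ^ L) ^ 2 / M L ^ 3)) atTop (𝓝 0) := by
  have hA : 1 < r ^ 3 / 9 := by linarith
  have h1 : Tendsto (fun L : ℕ => (c ^ 3)⁻¹ * ((L : ℝ) / (r ^ 3 / 9) ^ L)) atTop (𝓝 0) := by
    simpa using (tendsto_nat_div_pow hA).const_mul (c ^ 3)⁻¹
  refine squeeze_zero' ?_ ?_ h1
  · filter_upwards [h] with L hL
    have : 0 < c * r ^ L := by positivity
    have : 0 < M L := by linarith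
    positivity
  · filter_upwards [h] with L hL
    have h2 : 0 < c * r ^ L := by positivity
    have h9 : ((3 : ℝ) ^ L) ^ 2 = 9 ^ L := by rw [← pow_mul, mul_comm, pow_mul]; norm_num
    calc (L : ℝ) * ((3 ^ L) ^ 2 / M L ^ 3) ≤ L * ((3 ^ L) ^ 2 / (c * r ^ L) ^ 3) := by gcongr
      _ = _ := by
        rw [h9, div_pow, ← pow_mul, mul_comm 3 L, pow_mul]
        field_simp

lemma tendsto_mul_exp_neg_of_pow_le (hc : 0 < c) (hr : 1 < r)
    (h : ∀ᶠ L in atTop, c * r ^ L ≤ M L) :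
    Tendsto (fun L : ℕ => (L : ℝ) * (((3 : ℝ) ^ L) ^ 3 * Real.exp (-M L))) atTop (𝓝 0) := by
  -- the exponential decays faster than the power `M ^ (-k)`, and `r ^ k > 27` for large `k`
  obtain ⟨k, hk⟩ := pow_unbounded_of_one_lt 27 hr
  have hA : 1 < r ^ k / 27 := by linarith
  have h1 : Tendsto (fun L : ℕ => k.factorial * (c ^ k)⁻¹ * ((L : ℝ) / (r ^ k / 27) ^ L)) atTop
      (𝓝 0) := by
    simpa using (tendsto_nat_div_pow hA).const_mul (k.factorial * (c ^ k)⁻¹)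
  refine squeeze_zero' (Eventually.of_forall fun L => by positivity) ?_ h1
  filter_upwards [h] with L hL
  have h2 : 0 < c * r ^ L := by positivity
  have h27 : ((3 : ℝ) ^ L) ^ 3 = 27 ^ L := by rw [← pow_mul, mul_comm, pow_mul]; norm_num
  have h3 : Real.exp (-M L) ≤ k.factorial / (c * r ^ L) ^ k := by
    have h4 := Real.pow_div_factorial_le_exp _ h2.le k
    have h5 : 0 < (c * r ^ L) ^ k / (k.factorial : ℝ) := by positivity
    calc Real.exp (-M L) ≤ Real.exp (-(c * r ^ L)) := Real.exp_le_exp.2 (by linarith)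
      _ = (Real.exp (c * r ^ L))⁻¹ := Real.exp_neg _
      _ ≤ ((c * r ^ L) ^ k / (k.factorial : ℝ))⁻¹ := inv_anti₀ h5 h4
      _ = _ := inv_div _ _
  calc (L : ℝ) * (((3 : ℝ) ^ L) ^ 3 * Real.exp (-M L))
      ≤ L * (((3 : ℝ) ^ L) ^ 3 * (k.factorial / (c * r ^ L) ^ k)) := by gcongr
    _ = _ := by
      rw [h27, div_pow, mul_pow, ← pow_mul, ← pow_mul, mul_comm L k]
      field_simp

lemma tendsto_atTop_of_pow_le (hc : 0 < c) (hr : 1 < r)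
    (h : ∀ᶠ L in atTop, c * r ^ L ≤ M L) : Tendsto M atTop atTop :=
  tendsto_atTop_mono' _ h ((tendsto_pow_atTop_atTop_of_one_lt hr).const_mul_atTop hc)

end Growth

/-- The cube root of the expected number of hyperedges grows at least like `n ^ θ`. -/
lemma exists_mul_pow_le_rpow {θ : ℝ} {q : ℕ → unitInterval}
    (hq : (fun L : ℕ => ((3 ^ L : ℕ) : ℝ) ^ (-3 * (1 - θ))) =O[atTop]
      fun L : ℕ => (q (3 ^ L) : ℝ)) :
    ∃ c : ℝ, 0 < c ∧ ∀ᶠ L : ℕ in atTop,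
      c * ((3 : ℝ) ^ θ) ^ L ≤ meanEdges (3 ^ L) (q (3 ^ L)) ^ (1 / 3 : ℝ) := by
  obtain ⟨C, hC, hb⟩ := hq.exists_pos
  have hcpos : 0 < 1 / (7 * C) := by positivity
  refine ⟨(1 / (7 * C)) ^ (1 / 3 : ℝ), Real.rpow_pos_of_pos hcpos _, ?_⟩
  filter_upwards [hb.bound, eventually_ge_atTop 4] with L hL hL4
  have hX : (0 : ℝ) < 3 ^ L := by positivity
  have hcast : ((3 ^ L : ℕ) : ℝ) = 3 ^ L := by push_cast; rfl
  have hq0 : (0 : ℝ) ≤ q (3 ^ L) := (q (3 ^ L)).2.1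
  rw [hcast, Real.norm_of_nonneg (by positivity), Real.norm_of_nonneg hq0] at hL
  have h60 : 60 ≤ 3 ^ L := le_trans (by norm_num) (Nat.pow_le_pow_right (by norm_num) hL4)
  have h1 := pow_three_div_six_le_choose h60
  rw [hcast] at h1
  have e1 : ((3 : ℝ) ^ L) ^ (-3 * (1 - θ)) * ((3 : ℝ) ^ L) ^ 3 = (((3 : ℝ) ^ θ) ^ L) ^ 3 := by
    rw [← Real.rpow_natCast (((3 : ℝ) ^ L)) 3, ← Real.rpow_add hX, ← Real.rpow_natCast 3 L,
      ← Real.rpow_mul (by norm_num), ← Real.rpow_natCast ((3 : ℝ) ^ θ) L,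
      ← Real.rpow_mul (by norm_num), ← Real.rpow_natCast _ 3, ← Real.rpow_mul (by norm_num)]
    congr 1
    push_cast
    ring
  have h2 : (((3 : ℝ) ^ θ) ^ L) ^ 3 ≤ C * (q (3 ^ L) : ℝ) * ((3 : ℝ) ^ L) ^ 3 := by
    rw [← e1]
    exact mul_le_mul_of_nonneg_right hL (by positivity)
  have h3 : 1 / (7 * C) * (((3 : ℝ) ^ θ) ^ L) ^ 3 ≤ meanEdges (3 ^ L) (q (3 ^ L)) := by
    unfold meanEdges
    rw [one_div, inv_mul_le_iff₀ (by positivity)]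
    refine h2.trans ?_
    have h4 : ((3 : ℝ) ^ L) ^ 3 ≤ 7 * ((3 ^ L).choose 3 : ℝ) := by
      have : (0 : ℝ) ≤ ((3 ^ L).choose 3 : ℝ) := Nat.cast_nonneg _
      linarith
    calc C * (q (3 ^ L) : ℝ) * ((3 : ℝ) ^ L) ^ 3
        ≤ C * (q (3 ^ L) : ℝ) * (7 * ((3 ^ L).choose 3 : ℝ)) := by gcongr
      _ = _ := by ring
  calc (1 / (7 * C)) ^ (1 / 3 : ℝ) * ((3 : ℝ) ^ θ) ^ L
      = (1 / (7 * C) * (((3 : ℝ) ^ θ) ^ L) ^ 3) ^ (1 / 3 : ℝ) := by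
        rw [Real.mul_rpow hcpos.le (by positivity)]
        congr 1
        rw [← Real.rpow_natCast _ 3, ← Real.rpow_mul (by positivity)]
        norm_num
    _ ≤ _ := Real.rpow_le_rpow (by positivity) h3 (by norm_num)

end HyperLearn

open HyperLearn in
theorem theorem1 (θ : ℝ) (hθ₀ : 0 < θ) (hθ₁ : θ < 1)
    (q : ℕ → unitInterval)
    (hq : (fun L : ℕ => (q (3 ^ L) : ℝ)) =Θ[atTop]
      fun L : ℕ => ((3 ^ L : ℕ) : ℝ) ^ (-3 * (1 - θ)))
    (m : ℕ → ℝ) (hm : ∀ L, m L = meanEdges (3 ^ L) (q (3 ^ L)))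
    (C₁ C₂ C' : ℝ) (hC₁ : 155 ≤ C₁) (hC₂ : C₂ = C₁ ^ 3) (hC' : 4 < C') :
    ((fun L : ℕ => ((scheme C₁ C₂ C' L (m L)).numTests : ℝ)) =O[atTop]
      fun L : ℕ => m L * Real.log ((3 ^ L : ℕ) : ℝ)) ∧
    (2 / 3 < θ → ∃ K : ℝ, Tendsto (fun L : ℕ =>
      successProb (scheme C₁ C₂ C' L (m L)) (q (3 ^ L))
        (K * (m L ^ (5 / 3 : ℝ) * Real.log ((3 ^ L : ℕ) : ℝ)))) atTop (𝓝 1)) ∧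
    (θ ≤ 2 / 3 → ∃ K : ℝ, Tendsto (fun L : ℕ =>
      successProb (scheme C₁ C₂ C' L (m L)) (q (3 ^ L))
        (K * (m L ^ (5 / 3 : ℝ) * Real.log (m L) ^ 2 * Real.log ((3 ^ L : ℕ) : ℝ))))
      atTop (𝓝 1)) := by
  obtain ⟨c, hc, hgrow⟩ := exists_mul_pow_le_rpow hq.2
  set M : ℕ → ℝ := fun L => m L ^ (1 / 3 : ℝ) with hMdef
  set r : ℝ := 3 ^ θ with hr
  have hr1 : 1 < r := Real.one_lt_rpow (by norm_num) hθ₀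
  replace hgrow : ∀ᶠ L in atTop, c * r ^ L ≤ M L := by
    filter_upwards [hgrow] with L hL
    simpa only [hMdef, hm] using hL
  have hm0 : ∀ L, 0 ≤ m L := fun L => by
    rw [hm]
    exact mul_nonneg (q (3 ^ L)).2.1 (Nat.cast_nonneg _)
  have hM3 : ∀ L, M L ^ 3 = m L := fun L => by
    simp only [hMdef]
    rw [← Real.rpow_natCast, ← Real.rpow_mul (hm0 L)]
    norm_num
  have hM5 : ∀ L, M L ^ 5 = m L ^ (5 / 3 : ℝ) := fun L => by
    simp only [hMdef]
    rw [← Real.rpow_natCast, ← Real.rpow_mul (hm0 L)]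
    norm_num
  have hcast : ∀ L : ℕ, ((3 ^ L : ℕ) : ℝ) = 3 ^ L := fun L => by push_cast; rfl
  have hlarge : ∀ᶠ L in atTop,
      Large C₁ C₂ C' (scheme C₁ C₂ C' L (m L)) (q (3 ^ L)) (M L) := by
    filter_upwards [(tendsto_atTop_of_pow_le hc hr1 hgrow).eventually_gt_atTop 1,
      eventually_ge_atTop 4] with L h1 h2
    exact large_scheme hC₁ hC₂ hC' h2 _ (hm L) rfl h1
  have hone : ∀ T : ℕ → ℝ, ∀ᶠ L in atTop,
      successProb (scheme C₁ C₂ C' L (m L)) (q (3 ^ L)) (T L) ≤ 1 := by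
    intro T
    filter_upwards [hlarge] with L B
    have := B.neZero_width
    exact successProb_le_one _ _
  have hinv : Tendsto (fun L : ℕ => 1 / (L : ℝ)) atTop (𝓝 0) := tendsto_one_div_atTop_nhds_zero_nat
  have hexp := tendsto_mul_exp_neg_of_pow_le hc hr1 hgrow
  refine ⟨?_, fun hθ => ?_, fun _ => ?_⟩
  · refine IsBigO.of_bound ((8 + 8 * C') * C₁ * C₂) ?_
    filter_upwards [hlarge] with L B
    rw [Real.norm_of_nonneg (Nat.cast_nonneg _)]
    refine B.numTests_le.trans ?_
    rw [hM3, hcast]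
    have hC₁0 : 0 ≤ C₁ := by linarith
    have : 0 ≤ (8 + 8 * C') * C₁ * C₂ := by
      rw [hC₂]
      positivity
    exact mul_le_mul_of_nonneg_left (le_abs_self _) this
  · refine ⟨362 + 102060 * (60028 * C₂ + 72 * C' * C₂), ?_⟩
    have hr3 : 9 < r ^ 3 := by
      rw [hr, ← Real.rpow_natCast, ← Real.rpow_mul (by norm_num)]
      calc (9 : ℝ) = 3 ^ (2 : ℝ) := by norm_num
        _ < _ := Real.rpow_lt_rpow_of_exponent_lt (by norm_num) (by push_cast; linarith)
    have h1 := tendsto_nat_div_of_pow_le hc hr1 hgrow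
    have h2 := tendsto_mul_sq_div_of_pow_le hc hr1 hr3 hgrow
    have hδ := (((h1.const_mul (102060 ^ 2 * (2 * C₂))).add
      (h2.const_mul (102060 * 9 + 2))).add hinv).add (hexp.const_mul 2)
    simp only [mul_zero, add_zero] at hδ
    refine tendsto_one_of_one_sub_le hδ ?_ (hone _)
    filter_upwards [hlarge] with L B
    rw [← hM5, hcast]
    exact B.le_successProb_dense
  · have hK : 0 ≤ 362 + 1 * (60028 * C₂ + 72 * C' * C₂) := by
      have hC₁0 : 0 ≤ C₁ := by linarith
      rw [hC₂]
      positivity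
    refine ⟨(362 + 1 * (60028 * C₂ + 72 * C' * C₂)) / θ ^ 2, ?_⟩
    have hsqrt : Tendsto (fun L : ℕ => 1 / √(L : ℝ)) atTop (𝓝 0) := by
      simp only [one_div]
      exact (Real.tendsto_sqrt_atTop.comp tendsto_natCast_atTop_atTop).inv_tendsto_atTop
    have hδ := (((hinv.const_mul 54).add (hsqrt.const_mul 1488)).add hinv).add
      (hexp.const_mul 2)
    simp only [mul_zero, add_zero] at hδ
    refine tendsto_one_of_one_sub_le hδ ?_ (hone _)
    -- `L ≤ log m / θ` for large `L`, because `m ≥ c ^ 3 * r ^ (3 * L)` and `r = 3 ^ θ`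
    have hbig : ∀ᶠ L : ℕ in atTop, 1 ≤ c ^ 3 * (r ^ 2) ^ L :=
      ((tendsto_pow_atTop_atTop_of_one_lt (one_lt_pow₀ hr1 two_ne_zero)).const_mul_atTop
        (by positivity : 0 < c ^ 3)).eventually_ge_atTop 1
    filter_upwards [hlarge, hgrow, hbig] with L B hL hb
    refine B.le_successProb_general.trans (successProb_mono _ _ ?_)
    have hrL : 0 < r ^ L := by positivity
    have h1 : r ^ L ≤ m L := by
      rw [← hM3]
      calc r ^ L ≤ (c ^ 3 * (r ^ 2) ^ L) * r ^ L := le_mul_of_one_le_left hrL.le hb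
        _ = (c * r ^ L) ^ 3 := by rw [← pow_mul]; ring
        _ ≤ M L ^ 3 := by gcongr
    have h2 : θ * L ≤ Real.log (m L) := by
      calc θ * L ≤ L * (θ * Real.log 3) := by
            have := mul_le_mul_of_nonneg_left one_le_log_three
              (by positivity : (0 : ℝ) ≤ L * θ)
            linarith
        _ = Real.log (r ^ L) := by rw [Real.log_pow, hr, Real.log_rpow (by norm_num)]
        _ ≤ _ := Real.log_le_log hrL h1
    have h3 : (L : ℝ) ^ 2 ≤ Real.log (m L) ^ 2 / θ ^ 2 := by
      rw [le_div_iff₀ (by positivity), mul_comm, ← mul_pow]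
      exact pow_le_pow_left₀ (by positivity) h2 2
    have h4 : 0 ≤ Real.log ((3 : ℝ) ^ L) := Real.log_nonneg (one_le_pow₀ (by norm_num))
    have h5 : 0 ≤ M L ^ 5 := by
      rw [hM5]
      exact Real.rpow_nonneg (hm0 L) _
    rw [← hM5, hcast]
    calc _ ≤ (362 + 1 * (60028 * C₂ + 72 * C' * C₂)) *
          (M L ^ 5 * (Real.log (m L) ^ 2 / θ ^ 2) * Real.log ((3 : ℝ) ^ L)) := by
          change _ * (M L ^ 5 * (L : ℝ) ^ 2 * Real.log ((3 : ℝ) ^ L)) ≤ _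
          gcongr
      _ = _ := by ring
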